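/- **Conventions.** An additive category $\mathcal C$ is *weakly abelian* if every morphism has a weak kernel and a weak cokernel, is a weak kernel of some morphism and is a weak cokernel of some morphism. Its *Freyd category* $\hat{\mathcal C}$ is the category of morphisms of $\mathcal C$ modulo the full subcategory of zero morphisms; $\mathcal C$ embeds by $X\mapsto 1_X$. A commutative quadrangle in $\mathcal C$ is a *weak square* if the first morphism of its diagonal sequence is a weak kernel of the second. Given an additive category $\mathcal A$ and a full additive subcategory $\mathcal B$, the quotient $\mathcal A/\mathcal B$ is formed by identifying morphisms whose difference factors over an object of $\mathcal B$. For $n\ge 0$, let $\bar\Delta_n$ be the linearly ordered set consisting of $\mathbb Z$ copies of $\{0,\dots,n\}$ put in a row, with the automorphism $\alpha\mapsto\alpha^{+1}$ shifting to the next copy (inverse: $\alpha\mapsto\alpha^{-1}$), that is, $\mathbb Z$ with $\alpha^{+1}=\alpha+n+1$. Its *strip* is $\bar\Delta_n^\#=\{\beta/\alpha : \alpha,\beta\in\bar\Delta_n,\ \beta^{-1}\le\alpha\le\beta\le\alpha^{+1}\}$, ordered by $\beta/\alpha\le\delta/\gamma\iff\alpha\le\gamma$ and $\beta\le\delta$,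 with shift $(\beta/\alpha)^{+1}=\alpha^{+1}/\beta$. Let $\mathcal C^+(\bar\Delta_n^\#)$ be the category of *$n$-pretriangles*, the full subcategory of those diagrams $X:\bar\Delta_n^\#\to\mathcal C$ such that $X_{\alpha/\alpha}=0=X_{\alpha^{+1}/\alpha}$ for all $\alpha$, and such that for $\delta^{-1}\le\alpha\le\beta\le\gamma\le\delta\le\alpha^{+1}$ the quadrangle $(X_{\gamma/\alpha},X_{\delta/\alpha},X_{\gamma/\beta},X_{\delta/\beta})$ is a weak square. Let $\mathcal C^{+,\mathrm{spl}}(\bar\Delta_n^\#)$ be its full subcategory of *split* pretriangles: those all of whose diagram morphisms are split in $\hat{\mathcal C}$, i.e. are there a retraction followed by a coretraction. Given an automorphism $Y\mapsto Y^{+1}$ of $\mathcal C$, let $\mathcal C^{+,\mathrm{per}}(\bar\Delta_n^\#)$ be the (in general not full) subcategory of $\mathcal C^+(\bar\Delta_n^\#)$ consisting of the *periodic* pretriangles and periodic morphisms, i.e. those for which applying the automorphism entrywise gives the same as shifting: $(X_\xi)^{+1}=X_{\xi^{+1}}$, likewise for diagram morphisms, and $(f_\xi)^{+1}=f_{\xi^{+1}}$,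 for all $\xi\in\bar\Delta_n^\#$. A sequence in one of these categories is *pointwise split short exact* if it is split short exact at each $\xi\in\bar\Delta_n^\#$. A *Frobenius category* $\mathcal E$ is an exact category (in the sense of Quillen, with its class of pure short exact sequences $X\rightarrowtail Y\twoheadrightarrow Z$) in which every object $X$ admits a diagram $P\twoheadrightarrow X\rightarrowtail I$ with $P$ and $I$ *bijective*, i.e. both projective and injective relative to the pure short exact sequences. It is *additively functorial* if there are additive endofunctors $I,P$ of $\mathcal E$ and natural transformations $\iota:1_{\mathcal E}\to I$, $\pi:P\to 1_{\mathcal E}$ such that for every object $X$, $\iota_X$ is a pure monomorphism, $\pi_X$ is a pure epimorphism, and $I(X)$ and $P(X)$ are bijective. If $\mathcal B\subseteq\mathcal E$ is a full additive subcategory consisting of bijective objects that is sufficiently big (every $X$ admits $B\twoheadrightarrow X\rightarrowtail B'$ with $B,B'\in\mathcal B$), the *stable category* of $\mathcal E$, formed by means of $\mathcal B$, is the quotient $\mathcal B^{\mathrm{ac}}/\mathcal B^{\mathrm{sp\,ac}}$ of the category of complexes indexed by $\mathbb Z$ with entries in $\mathcal B$ that decompose in $\mathcal E$ into pure short exact sequences,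 by the full subcategory of complexes isomorphic to one with entries $T^i\oplus T^{i+1}$, $T^i\in\mathcal B$, and differentials $T^i\oplus T^{i+1}\to T^{i+1}\to T^{i+1}\oplus T^{i+2}$ (projection followed by inclusion). **Proposition.** Let $\mathcal C$ be a weakly abelian category, and let $n\ge 0$. 1. The category $\mathcal C^+(\bar\Delta_n^\#)$, equipped with the pointwise split short exact sequences as pure short exact sequences, is a Frobenius category, and its bijective objects are exactly the objects of $\mathcal C^{+,\mathrm{spl}}(\bar\Delta_n^\#)$. For every sufficiently big full additive subcategory $\mathcal B$ of bijective objects, the stable category of $\mathcal C^+(\bar\Delta_n^\#)$ formed by means of $\mathcal B$ is equivalent to the classical stable category $\mathcal C^+(\bar\Delta_n^\#)/\mathcal C^{+,\mathrm{spl}}(\bar\Delta_n^\#)$. Both the stable category and the classical stable category are weakly abelian. 2. Suppose $\mathcal C$ to be equipped with an automorphism $Y\mapsto Y^{+1}$. Then $\mathcal C^{+,\mathrm{per}}(\bar\Delta_n^\#)$, equipped with the pointwise split short exact sequences, is an additively functorial Frobenius category, and its bijective objects are exactly the periodic pretriangles that lie in $\mathcal C^{+,\mathrm{spl}}(\bar\Delta_n^\#)$.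 -/

import Mathlib

open CategoryTheory CategoryTheory.Limits

universe w v u

/-! ### Weakly abelian categories -/

section WeaklyAbelian

variable {A : Type u} [Category.{v} A] [HasZeroMorphisms A]

/-- `i : K ⟶ X` is a weak kernel of `f : X ⟶ Y`: for every `T`, the sequence
`(T, K) ⟶ (T, X) ⟶ (T, Y)` is exact at `(T, X)`. -/
def IsWeakKernel {K X Y : A} (i : K ⟶ X) (f : X ⟶ Y) : Prop :=
  i ≫ f = 0 ∧ ∀ ⦃T : A⦄ (t : T ⟶ X), t ≫ f = 0 → ∃ t' : T ⟶ K, t' ≫ i = t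

/-- `p : Y ⟶ Q` is a weak cokernel of `f : X ⟶ Y`. -/
def IsWeakCokernel {X Y Q : A} (p : Y ⟶ Q) (f : X ⟶ Y) : Prop :=
  f ≫ p = 0 ∧ ∀ ⦃T : A⦄ (t : Y ⟶ T), f ≫ t = 0 → ∃ t' : Q ⟶ T, p ≫ t' = t

variable (A) in
/-- The four conditions that make an additive category weakly abelian. -/
structure WeaklyAbelian : Prop where
  exists_weakKernel : ∀ ⦃X Y : A⦄ (f : X ⟶ Y), ∃ (K : A) (i : K ⟶ X), IsWeakKernel i f
  exists_weakCokernel : ∀ ⦃X Y : A⦄ (f : X ⟶ Y), ∃ (Q : A) (p : Y ⟶ Q), IsWeakCokernel p f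
  isWeakKernel : ∀ ⦃X Y : A⦄ (f : X ⟶ Y), ∃ (Z : A) (g : Y ⟶ Z), IsWeakKernel f g
  isWeakCokernel : ∀ ⦃X Y : A⦄ (f : X ⟶ Y), ∃ (W : A) (g : W ⟶ X), IsWeakCokernel f g

end WeaklyAbelian

/-- A commutative quadrangle `a ≫ c = b ≫ d` is a weak square if the first morphism of its diagonal
sequence is a weak kernel of the second. -/
def IsWeakSquare {A : Type u} [Category.{v} A] [Preadditive A] [HasFiniteBiproducts A]
    {X Y Y' Z : A} (a : X ⟶ Y) (b : X ⟶ Y') (c : Y ⟶ Z) (d : Y' ⟶ Z) : Prop :=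
  haveI : HasBinaryBiproducts A := hasBinaryBiproducts_of_finite_biproducts A
  IsWeakKernel (biprod.lift a b) (biprod.desc c (-d))

/-! ### The Freyd category, and split morphisms -/

section Freyd

variable (A : Type u) [Category.{v} A] [Preadditive A]

/-- Two morphisms of arrows `x` and `y` are identified if their difference factors through an arrow
that is a zero morphism. -/
def freydRel : HomRel (Arrow A) := fun x y f g =>
  ∃ (z : Arrow A) (a : x ⟶ z) (b : z ⟶ y), z.hom = 0 ∧
    f.left - g.left = a.left ≫ b.left ∧ f.right - g.right = a.right ≫ b.right

/-- The Freyd category: the arrow category modulo the zero arrows. -/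
abbrev Freyd := CategoryTheory.Quotient (freydRel A)

/-- The functor `X ↦ (𝟙 X : X ⟶ X)`. -/
def idArrow : A ⥤ Arrow A where
  obj X := Arrow.mk (𝟙 X)
  map f := Arrow.homMk (u := f) (v := f) (by simp)

/-- The embedding of a category into its Freyd category. -/
abbrev freydEmbedding : A ⥤ Freyd A := idArrow A ⋙ CategoryTheory.Quotient.functor (freydRel A)

variable {A}

/-- A morphism is split in the Freyd category if there it is a retraction followed by a
coretraction. -/
def IsSplitInFreyd {X Y : A} (f : X ⟶ Y) : Prop :=
  ∃ (Z : Freyd A) (r : (freydEmbedding A).obj X ⟶ Z) (s : Z ⟶ (freydEmbedding A).obj Y),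
    IsSplitEpi r ∧ IsSplitMono s ∧ r ≫ s = (freydEmbedding A).map f

end Freyd

/-! ### Quotients of additive categories -/

section AdditiveQuotient

variable {A : Type u} [Category.{v} A] [Preadditive A]

/-- Two morphisms are identified if their difference factors through an object of `B`. -/
def factorRel (B : ObjectProperty A) : HomRel A := fun X Y f g =>
  ∃ (Z : A) (a : X ⟶ Z) (b : Z ⟶ Y), B Z ∧ f - g = a ≫ b

/-- The quotient of an additive category by the full additive subcategory given by `B`. -/
abbrev AdditiveQuotient (B : ObjectProperty A) := CategoryTheory.Quotient (factorRel B)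

/-- `A / B`, with the addition induced from `A`, is an additive category that is weakly abelian. -/
def QuotientWeaklyAbelian (B : ObjectProperty A) : Prop :=
  ∃ _ : Preadditive (AdditiveQuotient B),
    (CategoryTheory.Quotient.functor (factorRel B)).Additive ∧
      HasFiniteBiproducts (AdditiveQuotient B) ∧ WeaklyAbelian (AdditiveQuotient B)

/-- `B` is a full additive subcategory (not necessarily closed under isomorphisms). -/
def IsAdditiveSubcategory (B : ObjectProperty A) : Prop :=
  (∃ Z : A, IsZero Z ∧ B Z) ∧
    ∀ X Y : A, B X → B Y → ∃ b : BinaryBicone X Y, Nonempty b.IsBilimit ∧ B b.pt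

end AdditiveQuotient

/-! ### Exact categories and Frobenius categories -/

section Exact

variable {E : Type u} [Category.{v} E] [Preadditive E] (S : ObjectProperty (ShortComplex E))

/-- `f` is a pure monomorphism: it fits into a pure short exact sequence `(f, g)`. -/
def IsPureMono {X Y : E} (f : X ⟶ Y) : Prop :=
  ∃ (Z : E) (g : Y ⟶ Z) (h : f ≫ g = 0), S (ShortComplex.mk f g h)

/-- `g` is a pure epimorphism: it fits into a pure short exact sequence `(f, g)`. -/
def IsPureEpi {Y Z : E} (g : Y ⟶ Z) : Prop :=
  ∃ (X : E) (f : X ⟶ Y) (h : f ≫ g = 0), S (ShortComplex.mk f g h)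

/-- The additive category `E` together with the set `S` of pure short exact sequences is an
exact category. -/
structure IsExactCategory : Prop where
  hasFiniteBiproducts : HasFiniteBiproducts E
  closed_under_iso : S.IsClosedUnderIsomorphisms
  isKernel : ∀ s, S s → Nonempty (IsLimit (KernelFork.ofι s.f s.zero))
  isCokernel : ∀ s, S s → Nonempty (IsColimit (CokernelCofork.ofπ s.g s.zero))
  /-- Split monomorphisms, i.e. first morphisms of split short exact sequences, are pure. -/
  ex1 : ∀ s : ShortComplex E, Nonempty s.Splitting → IsPureMono S s.f
  /-- Split epimorphisms, i.e. second morphisms of split short exact sequences, are pure. -/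
  ex1_op : ∀ s : ShortComplex E, Nonempty s.Splitting → IsPureEpi S s.g
  ex2 : ∀ ⦃X Y Z : E⦄ (f : X ⟶ Y) (g : Y ⟶ Z),
    IsPureMono S f → IsPureMono S g → IsPureMono S (f ≫ g)
  ex2_op : ∀ ⦃X Y Z : E⦄ (f : X ⟶ Y) (g : Y ⟶ Z),
    IsPureEpi S f → IsPureEpi S g → IsPureEpi S (f ≫ g)
  ex3 : ∀ ⦃X Y Z : E⦄ (f : X ⟶ Y) (g : Y ⟶ Z), IsPureEpi S g → IsPureMono S (f ≫ g) →
    ∃ (A B : E) (a : A ⟶ Y) (b : Y ⟶ B) (hb : f ≫ b = 0) (ha : a ≫ g = 0),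
      S (ShortComplex.mk f b hb) ∧ S (ShortComplex.mk a g ha) ∧ IsPureMono S (a ≫ b)
  ex3_op : ∀ ⦃X Y Z : E⦄ (f : X ⟶ Y) (g : Y ⟶ Z), IsPureMono S f → IsPureEpi S (f ≫ g) →
    ∃ (A B : E) (a : A ⟶ Y) (b : Y ⟶ B) (hb : f ≫ b = 0) (ha : a ≫ g = 0),
      S (ShortComplex.mk f b hb) ∧ S (ShortComplex.mk a g ha) ∧ IsPureEpi S (a ≫ b)

/-- `P` is bijective, i.e. projective and injective relative to the pure short exact sequences. -/
def IsBijective : ObjectProperty E := fun P =>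
  (∀ ⦃Y Z : E⦄ (g : Y ⟶ Z), IsPureEpi S g → ∀ f : P ⟶ Z, ∃ f' : P ⟶ Y, f' ≫ g = f) ∧
    ∀ ⦃X Y : E⦄ (i : X ⟶ Y), IsPureMono S i → ∀ f : X ⟶ P, ∃ f' : Y ⟶ P, i ≫ f' = f

/-- Each object `X` allows for a diagram `P ↠ X ↣ I` with `P` and `I` in `B`. -/
def IsSufficientlyBig (B : ObjectProperty E) : Prop :=
  ∀ X : E, (∃ (P : E) (p : P ⟶ X), B P ∧ IsPureEpi S p) ∧
    ∃ (I : E) (i : X ⟶ I), B I ∧ IsPureMono S i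

/-- `(E, S)` is a Frobenius category. -/
structure IsFrobeniusCategory : Prop where
  isExactCategory : IsExactCategory S
  isSufficientlyBig : IsSufficientlyBig S (IsBijective S)

/-- `(E, S)` is a Frobenius category in which embeddings into and covers by bijective objects may be
chosen functorially, by means of additive functors. -/
structure IsAdditivelyFunctorialFrobeniusCategory : Prop where
  isFrobeniusCategory : IsFrobeniusCategory S
  functorial_embedding : ∃ (I : E ⥤ E) (ι : 𝟭 E ⟶ I), I.Additive ∧
    ∀ X : E, IsPureMono S (ι.app X) ∧ IsBijective S (I.obj X)
  functorial_cover : ∃ (P : E ⥤ E) (π : P ⟶ 𝟭 E), P.Additive ∧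
    ∀ X : E, IsPureEpi S (π.app X) ∧ IsBijective S (P.obj X)

/-- A complex is purely acyclic if it decomposes into pure short exact sequences
`(Z i ⟶ K (i + 1) ⟶ Z (i + 1))`. -/
def IsPurelyAcyclic (K : CochainComplex E ℤ) : Prop :=
  ∃ (Z : ℤ → E) (p : ∀ i, K.X i ⟶ Z i) (m : ∀ i, Z i ⟶ K.X (i + 1)),
    (∀ i, K.d i (i + 1) = p i ≫ m i) ∧
      ∀ i, ∃ h : m i ≫ p (i + 1) = 0, S (ShortComplex.mk (m i) (p (i + 1)) h)

/-- The category of purely acyclic complexes with entries in `B`. -/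
abbrev AcyclicComplexes (B : ObjectProperty E) :=
  ObjectProperty.FullSubcategory
    (fun K : CochainComplex E ℤ => (∀ i, B (K.X i)) ∧ IsPurelyAcyclic S K)

/-- A complex with entries in `B` is split acyclic if it is isomorphic to a complex with entries
`T i ⊕ T (i + 1)`, each differential of which is the projection to, followed by the inclusion of, the
common summand `T (i + 1)`; here, the `T i` are in `B`. -/
def IsSplitAcyclic (B : ObjectProperty E) : ObjectProperty (AcyclicComplexes S B) := fun K =>
  ∃ (T : ℤ → E) (b : ∀ i, BinaryBicone (T i) (T (i + 1))) (e : ∀ i, K.obj.X i ≅ (b i).pt),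
    (∀ i, B (T i) ∧ Nonempty (b i).IsBilimit) ∧
      ∀ i, K.obj.d i (i + 1) ≫ (e (i + 1)).hom = (e i).hom ≫ (b i).snd ≫ (b (i + 1)).inl

/-- The stable category of the Frobenius category `(E, S)`, formed by means of a sufficiently big
full additive subcategory `B` of bijective objects. -/
abbrev StableCategory (B : ObjectProperty E) := AdditiveQuotient (IsSplitAcyclic S B)

end Exact

/-- Given evaluation functors `ev ξ` on `E`, a sequence in `E` is pointwise split short exact if its
image under each of them is split short exact. -/
def PointwiseSplit {E : Type u} [Category.{v} E] [Preadditive E] {A : Type*} [Category* A]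
    [Preadditive A] {Ξ : Type w} (ev : Ξ → E ⥤ A) [∀ ξ, (ev ξ).PreservesZeroMorphisms] :
    ObjectProperty (ShortComplex E) :=
  fun s => ∀ ξ, Nonempty (s.map (ev ξ)).Splitting

/-! ### The strip of a periodic poset -/

section Strip

/-- The strip of a poset `P` with automorphism `α ↦ α⁺¹ = T α`: it consists of the `β/α` such that
`β⁻¹ ≤ α ≤ β ≤ α⁺¹`, where `β⁻¹ ≤ α` amounts to `β ≤ α⁺¹`. -/
@[ext]
structure Strip {P : Type} [PartialOrder P] (T : P ≃o P) where
  /-- The element `α` of `β/α`. -/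
  bot : P
  /-- The element `β` of `β/α`. -/
  top : P
  bot_le_top : bot ≤ top
  top_le : top ≤ T bot

variable {P : Type} [PartialOrder P] (T : P ≃o P)

instance : PartialOrder (Strip T) where
  le x y := x.bot ≤ y.bot ∧ x.top ≤ y.top
  le_refl x := ⟨le_refl _, le_refl _⟩
  le_trans x y z h k := ⟨h.1.trans k.1, h.2.trans k.2⟩
  le_antisymm x y h k := Strip.ext (le_antisymm h.1 k.1) (le_antisymm h.2 k.2)

/-- The shift `β/α ↦ (β/α)⁺¹ = α⁺¹/β`, as a functor on the strip. -/
def Strip.shift : Strip T ⥤ Strip T :=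
  Monotone.functor
    (f := fun x : Strip T => (⟨x.top, T x.bot, x.top_le, T.monotone x.bot_le_top⟩ : Strip T))
    (fun _ _ h => ⟨h.2, T.monotone h.1⟩)

/-- The shift automorphism of the periodic repetition of `{0, …, n}`. The latter is identified with
`ℤ` by letting the `z`-th copy of `α` correspond to `α + (n + 1) z`. -/
def periodShift (n : ℕ) : ℤ ≃o ℤ := OrderIso.addRight ((n : ℤ) + 1)

end Strip

/-! ### Pretriangles -/

section Pretriangle

variable {P : Type} [PartialOrder P] {T : P ≃o P}
variable {C : Type u} [Category.{v} C] [Preadditive C] [HasFiniteBiproducts C]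

/-- A diagram on the strip is a pretriangle if it has zeroes on the boundaries, i.e. at `α/α` and at
`α⁺¹/α`, and if, for `δ⁻¹ ≤ α ≤ β ≤ γ ≤ δ ≤ α⁺¹`, the quadrangle on `γ/α, δ/α, γ/β, δ/β` is a
weak square. -/
structure IsPretriangle (X : Strip T ⥤ C) : Prop where
  isZero_bot : ∀ x : Strip T, x.top = x.bot → IsZero (X.obj x)
  isZero_top : ∀ x : Strip T, x.top = T x.bot → IsZero (X.obj x)
  isWeakSquare : ∀ (α β γ δ : P) (hαβ : α ≤ β) (hβγ : β ≤ γ) (hγδ : γ ≤ δ) (hδα : δ ≤ T α),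
    let x : Strip T := ⟨α, γ, hαβ.trans hβγ, hγδ.trans hδα⟩
    let y : Strip T := ⟨α, δ, (hαβ.trans hβγ).trans hγδ, hδα⟩
    let y' : Strip T := ⟨β, γ, hβγ, (hγδ.trans hδα).trans (T.monotone hαβ)⟩
    let z : Strip T := ⟨β, δ, hβγ.trans hγδ, hδα.trans (T.monotone hαβ)⟩
    have hxy : x ≤ y := ⟨le_refl _, hγδ⟩
    have hxy' : x ≤ y' := ⟨hαβ, le_refl _⟩
    have hyz : y ≤ z := ⟨hαβ, le_refl _⟩
    have hyz' : y' ≤ z := ⟨le_refl _, hγδ⟩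
    IsWeakSquare (X.map (homOfLE hxy)) (X.map (homOfLE hxy')) (X.map (homOfLE hyz))
      (X.map (homOfLE hyz'))

variable (T C) in
/-- The category of pretriangles, a full subcategory of the category of diagrams on the strip. -/
abbrev Pretriangle := ObjectProperty.FullSubcategory (fun X : Strip T ⥤ C => IsPretriangle X)

/-- Evaluation of pretriangles at an element of the strip. -/
abbrev Pretriangle.ev (ξ : Strip T) : Pretriangle T C ⥤ C :=
  ObjectProperty.ι _ ⋙ (evaluation (Strip T) C).obj ξ

instance (ξ : Strip T) : (Pretriangle.ev (T := T) (C := C) ξ).PreservesZeroMorphisms where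
  map_zero _ _ := rfl

variable (T C) in
/-- The pointwise split short exact sequences of pretriangles. -/
abbrev Pretriangle.pure : ObjectProperty (ShortComplex (Pretriangle T C)) :=
  PointwiseSplit (Pretriangle.ev (T := T) (C := C))

variable (T C) in
/-- A pretriangle is split if all of its diagram morphisms are split in the Freyd category. -/
def IsSplitPretriangle : ObjectProperty (Pretriangle T C) := fun X =>
  ∀ ⦃ξ η : Strip T⦄ (f : ξ ⟶ η), IsSplitInFreyd (X.obj.map f)

/-! ### Periodic pretriangles -/



/-- An automorphism of an additive category is an additive functor. -/
theorem IsoCat_functor_additive (Sh : IsoCat C C) : Sh.functor.Additive := by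
  have : HasBinaryBiproducts C := hasBinaryBiproducts_of_finite_biproducts C
  have : Sh.functor.IsEquivalence := Sh.toEquivalence.isEquivalence_functor
  have : Sh.functor.PreservesZeroMorphisms := inferInstance
  exact Functor.additive_of_preserves_binary_products Sh.functor

variable (T) in
/-- A pretriangle `X` is periodic with respect to the automorphism `Sh`, `Y ↦ Y⁺¹`, of the category
of its entries, if applying `Sh` entrywise to `X` yields the same diagram as shifting `X`,
i.e. `(X_ξ)⁺¹ = X_{ξ⁺¹}` for all `ξ`, and similarly on morphisms. -/
structure PeriodicPretriangle (Sh : IsoCat C C) where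
  /-- The underlying pretriangle. -/
  pre : Pretriangle T C
  periodic : pre.obj ⋙ Sh.functor = Strip.shift T ⋙ pre.obj

namespace PeriodicPretriangle

variable {Sh : IsoCat C C}

theorem obj_shift (X : PeriodicPretriangle T Sh) (ξ : Strip T) :
    Sh.functor.obj (X.pre.obj.obj ξ) = X.pre.obj.obj ((Strip.shift T).obj ξ) :=
  Functor.congr_obj X.periodic ξ

/-- The group of periodic morphisms, i.e. of those `f` such that `(f_ξ)⁺¹ = f_{ξ⁺¹}` for all `ξ`. -/
def periodicHom (X Y : PeriodicPretriangle T Sh) : AddSubgroup (X.pre ⟶ Y.pre) where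
  carrier := { f | ∀ ξ : Strip T, Sh.functor.map (f.hom.app ξ) =
    eqToHom (X.obj_shift ξ) ≫ f.hom.app ((Strip.shift T).obj ξ) ≫ eqToHom (Y.obj_shift ξ).symm }
  zero_mem' ξ := by
    have := IsoCat_functor_additive Sh
    simp
  add_mem' := by
    have := IsoCat_functor_additive Sh
    intro f g hf hg ξ
    have h : ∀ η, (f + g).hom.app η = f.hom.app η + g.hom.app η := fun _ => rfl
    rw [h, h, Functor.map_add, hf ξ, hg ξ, Preadditive.add_comp, Preadditive.comp_add]
  neg_mem' := by
    have := IsoCat_functor_additive Sh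
    intro f hf ξ
    have h : ∀ η, (-f).hom.app η = -f.hom.app η := fun _ => rfl
    rw [h, h, Functor.map_neg, hf ξ, Preadditive.neg_comp, Preadditive.comp_neg]

theorem id_mem (X : PeriodicPretriangle T Sh) : 𝟙 X.pre ∈ periodicHom X X := by
  intro ξ
  simp

theorem comp_mem {X Y Z : PeriodicPretriangle T Sh} {f : X.pre ⟶ Y.pre} {g : Y.pre ⟶ Z.pre}
    (hf : f ∈ periodicHom X Y) (hg : g ∈ periodicHom Y Z) : f ≫ g ∈ periodicHom X Z := by
  intro ξ
  simp [hf ξ, hg ξ]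

instance : Category.{max v 0} (PeriodicPretriangle T Sh) where
  Hom X Y := periodicHom X Y
  id X := ⟨𝟙 X.pre, id_mem X⟩
  comp f g := ⟨f.1 ≫ g.1, comp_mem f.2 g.2⟩

instance : Preadditive (PeriodicPretriangle T Sh) where
  homGroup X Y := inferInstanceAs (AddCommGroup (periodicHom X Y))
  add_comp X Y Z f f' g := Subtype.ext (Preadditive.add_comp X.pre Y.pre Z.pre f.1 f'.1 g.1)
  comp_add X Y Z f g g' := Subtype.ext (Preadditive.comp_add X.pre Y.pre Z.pre f.1 g.1 g'.1)

/-- The inclusion of the category of periodic pretriangles; in general, it is not full. -/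
def incl : PeriodicPretriangle T Sh ⥤ Pretriangle T C where
  obj X := X.pre
  map f := f.1

/-- Evaluation of periodic pretriangles at an element of the strip. -/
abbrev ev (ξ : Strip T) : PeriodicPretriangle T Sh ⥤ C := incl ⋙ Pretriangle.ev ξ

instance (ξ : Strip T) : (ev (Sh := Sh) ξ).PreservesZeroMorphisms where
  map_zero _ _ := rfl

variable (T Sh) in
/-- The pointwise split short exact sequences of periodic pretriangles. -/
abbrev pure : ObjectProperty (ShortComplex (PeriodicPretriangle T Sh)) :=
  PointwiseSplit (ev (T := T) (Sh := Sh))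

end PeriodicPretriangle

variable (T) in
/-- The periodic pretriangles that are split as pretriangles. -/
def IsSplitPeriodicPretriangle (Sh : IsoCat C C) : ObjectProperty (PeriodicPretriangle T Sh) :=
  fun X => IsSplitPretriangle T C X.pre

end Pretriangle

/-!
**Reduction to long exact sequences.** A diagram on the strip that vanishes on the boundary is a
pretriangle if and only if two kinds of three-term sequences of diagram morphisms are exact
(`HasLongExactSequences`); for a pointwise split short exact sequence of diagrams, the three
diagrams satisfy this as soon as two of them do. So pointwise kernels and cokernels of pointwise
split morphisms remain pretriangles, and the axioms of an exact category reduce to those for split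
short exact sequences in `C` (`isExactCategory_pointwiseSplit`).

**Bijective objects.** For `x` in the strip, let `corner x` be the upper right corner of the
largest rectangle with lower left corner `x` that avoids the boundary. Given objects `A x`, the
sum over `x` of the diagrams with constant value `A x` on this rectangle is a pretriangle,
`RectangleSum.diagram A`. It is both free and cofree: a morphism from it to a pretriangle `Y`
amounts to morphisms `A x ⟶ Y.obj x`, and a morphism from `Y` to it amounts to morphisms
`Y.obj (corner x) ⟶ A x`. Hence it is bijective, and every pretriangle `X` is covered by the sum
with values `X.obj x` and embeds into the sum with values `X.obj (corner x)`, pointwise split.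
This is the Frobenius property.

A morphism is split in the Freyd category if and only if it is von Neumann regular
(`isSplitInFreyd_iff`), a property that holds in sums of rectangles and passes to retracts; so
bijective pretriangles are split. Conversely, quasi-inverses of the diagram morphisms
`X.obj x ⟶ X.obj (corner x)` define a morphism from `X` to the sum with values `X.obj x`. Its
composite `c` with the cover acts as the identity on the images of these diagram morphisms. By
exactness, `1 - c` factors entrywise through diagram morphisms, and its powers through longer and
longer ones, which eventually meet the boundary and vanish. Thus `1 - c` is nilpotent, and `c` is
an isomorphism (`HasLongExactSequences.isIso_toDiagram_comp_counit`). So `X` is a retract of a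
bijective object.

**Stable categories.** In any Frobenius category, every morphism is isomorphic, modulo bijective
objects, to a pure monomorphism and to a pure epimorphism, and a pure short exact sequence yields
a weak kernel and a weak cokernel in the quotient. So the classical stable category is weakly
abelian. Taking cycles in a fixed degree is an equivalence from the stable category to it, because
complexes, morphisms and null-homotopies can be constructed from this degree in both directions
(`IsFrobeniusCategory.exists_stableEquivalence`).

**Periodicity.** The shift acts freely on the strip, so choices that are to be periodic can be
made on a fundamental domain and propagated along the orbits (`exists_orbitFamily`). This shows
that a diagram that is periodic up to a natural isomorphism is isomorphic to a strictly periodic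
one (`exists_strictification`), and that the choices of morphisms made above can be made periodic
(`exists_periodicFamily`). Kernels, cokernels and sums of rectangles formed from periodic data are
periodic up to isomorphism, so the arguments carry over; and since the sums with values `X.obj x`
and `X.obj (corner x)` are functorial and additive in `X`, so are the covers and embeddings.
-/

/-! ### Additive quotients -/

section AdditiveQuotients

variable {A : Type u} [Category.{v} A] [Preadditive A] {B : ObjectProperty A}

theorem factorRel_iff_sub {X Y : A} (f g : X ⟶ Y) :
    factorRel B f g ↔ factorRel B (f - g) 0 := by
  simp [factorRel]

theorem factorRel_congruence
    (hzero : ∀ X Y : A, factorRel B (0 : X ⟶ Y) 0)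
    (hadd : ∀ ⦃X Y : A⦄ (f g : X ⟶ Y), factorRel B f 0 → factorRel B g 0 →
      factorRel B (f + g) 0) : Congruence (factorRel B) where
  equivalence := by
    refine ⟨fun f => ?_, fun {f g} h => ?_, fun {f g k} h h' => ?_⟩
    · rw [factorRel_iff_sub, sub_self]
      exact hzero _ _
    · obtain ⟨Z, a, b, hZ, e⟩ := h
      exact ⟨Z, -a, b, hZ, by rw [Preadditive.neg_comp, ← e, neg_sub]⟩
    · rw [factorRel_iff_sub] at h h' ⊢
      rw [← sub_add_sub_cancel f g k]
      exact hadd _ _ h h'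
  comp_left := by
    rintro X Y Z f g g' ⟨W, a, b, hW, e⟩
    exact ⟨W, f ≫ a, b, hW, by rw [← Preadditive.comp_sub, e, Category.assoc]⟩
  comp_right := by
    rintro X Y Z f f' g ⟨W, a, b, hW, e⟩
    exact ⟨W, a, b ≫ g, hW, by rw [← Preadditive.sub_comp, e, Category.assoc]⟩

theorem factorRel_add [Congruence (factorRel B)] ⦃X Y : A⦄ (f₁ f₂ g₁ g₂ : X ⟶ Y)
    (hf : factorRel B f₁ f₂) (hg : factorRel B g₁ g₂) : factorRel B (f₁ + g₁) (f₂ + g₂) := by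
  have h₁ : factorRel B (f₁ + g₁) (f₂ + g₁) := by
    rw [factorRel_iff_sub, add_sub_add_right_eq_sub, ← factorRel_iff_sub]
    exact hf
  have h₂ : factorRel B (f₂ + g₁) (f₂ + g₂) := by
    rw [factorRel_iff_sub, add_sub_add_left_eq_sub, ← factorRel_iff_sub]
    exact hg
  exact Congruence.equivalence.trans h₁ h₂

theorem factorRel_functor_map_eq_zero_iff [Congruence (factorRel B)]
    [Preadditive (AdditiveQuotient B)] [(Quotient.functor (factorRel B)).Additive] {X Y : A}
    (f : X ⟶ Y) :
    (Quotient.functor (factorRel B)).map f = 0 ↔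
      ∃ (Z : A) (a : X ⟶ Z) (b : Z ⟶ Y), B Z ∧ f = a ≫ b := by
  rw [← (Quotient.functor (factorRel B)).map_zero, Quotient.functor_map_eq_iff]
  simp [factorRel]

/-- An additive functor that is surjective on objects carries finite biproducts along. -/
theorem hasFiniteBiproducts_additiveQuotient [HasFiniteBiproducts A]
    [Preadditive (AdditiveQuotient B)] [(Quotient.functor (factorRel B)).Additive] :
    HasFiniteBiproducts (AdditiveQuotient B) := by
  refine ⟨fun n => ⟨fun F => ?_⟩⟩
  exact HasBiproduct.mk ⟨(Quotient.functor (factorRel B)).mapBicone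
    (biproduct.bicone fun j => (F j).as), isBilimitOfPreserves _ (biproduct.isBilimit _)⟩

end AdditiveQuotients

section WeakKernels

variable {A : Type u} [Category.{v} A] [HasZeroMorphisms A]

theorem IsWeakKernel.comp_iso {K X X' Y : A} {i : K ⟶ X} {f : X ⟶ Y} (h : IsWeakKernel i f)
    (e : X ≅ X') : IsWeakKernel (i ≫ e.hom) (e.inv ≫ f) := by
  refine ⟨by simp [h.1], fun T t ht => ?_⟩
  obtain ⟨t', h'⟩ := h.2 (t ≫ e.inv) (by simpa using ht)
  exact ⟨t', by simp [reassoc_of% h']⟩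

theorem IsWeakCokernel.comp_iso {X Y Y' Q : A} {p : Y ⟶ Q} {f : X ⟶ Y} (h : IsWeakCokernel p f)
    (e : Y ≅ Y') : IsWeakCokernel (e.inv ≫ p) (f ≫ e.hom) := by
  refine ⟨by simp [h.1], fun T t ht => ?_⟩
  obtain ⟨t', h'⟩ := h.2 (e.hom ≫ t) (by simpa using ht)
  exact ⟨t', by simp [h']⟩

/-- Being weakly abelian is invariant under equivalence. -/
theorem WeaklyAbelian.of_equivalence {D : Type*} [Category* D] [HasZeroMorphisms D]
    (F : D ⥤ A) [F.IsEquivalence] [F.PreservesZeroMorphisms] (h : WeaklyAbelian A) :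
    WeaklyAbelian D := by
  have reflK : ∀ {K X Y : D} (i : K ⟶ X) (f : X ⟶ Y), IsWeakKernel (F.map i) (F.map f) →
      IsWeakKernel i f := by
    intro K X Y i f ⟨h₀, h₁⟩
    refine ⟨F.map_injective (by simpa using h₀), fun T t ht => ?_⟩
    obtain ⟨t', h'⟩ := h₁ (F.map t) (by rw [← F.map_comp, ht, F.map_zero])
    exact ⟨F.preimage t', F.map_injective (by simpa using h')⟩
  have reflC : ∀ {X Y Q : D} (p : Y ⟶ Q) (f : X ⟶ Y), IsWeakCokernel (F.map p) (F.map f) →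
      IsWeakCokernel p f := by
    intro X Y Q p f ⟨h₀, h₁⟩
    refine ⟨F.map_injective (by simpa using h₀), fun T t ht => ?_⟩
    obtain ⟨t', h'⟩ := h₁ (F.map t) (by rw [← F.map_comp, ht, F.map_zero])
    exact ⟨F.preimage t', F.map_injective (by simpa using h')⟩
  refine ⟨fun X Y f => ?_, fun X Y f => ?_, fun X Y f => ?_, fun X Y f => ?_⟩
  · obtain ⟨K, i, h₀, h₁⟩ := h.exists_weakKernel (F.map f)
    let e := F.objObjPreimageIso K
    refine ⟨F.objPreimage K, F.preimage (e.hom ≫ i), reflK _ _ ⟨by simp [h₀], fun T t ht => ?_⟩⟩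
    obtain ⟨t', h'⟩ := h₁ t ht
    exact ⟨t' ≫ e.inv, by simp [h']⟩
  · obtain ⟨K, i, h₀, h₁⟩ := h.exists_weakCokernel (F.map f)
    let e := F.objObjPreimageIso K
    refine ⟨F.objPreimage K, F.preimage (i ≫ e.inv), reflC _ _
      ⟨by simp [reassoc_of% h₀], fun T t ht => ?_⟩⟩
    obtain ⟨t', h'⟩ := h₁ t ht
    exact ⟨e.hom ≫ t', by simp [h']⟩
  · obtain ⟨K, i, h₀, h₁⟩ := h.isWeakKernel (F.map f)
    let e := F.objObjPreimageIso K
    refine ⟨F.objPreimage K, F.preimage (i ≫ e.inv), reflK _ _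
      ⟨by simp [reassoc_of% h₀], fun T t ht => h₁ t ?_⟩⟩
    rw [← cancel_mono e.inv]
    simpa using ht
  · obtain ⟨K, i, h₀, h₁⟩ := h.isWeakCokernel (F.map f)
    let e := F.objObjPreimageIso K
    refine ⟨F.objPreimage K, F.preimage (e.hom ≫ i), reflC _ _
      ⟨by simp [h₀], fun T t ht => h₁ t ?_⟩⟩
    rw [← cancel_epi e.hom]
    simpa using ht

end WeakKernels

/-! ### The classical stable category of a Frobenius category -/

section Frobenius

variable {E : Type u} [Category.{v} E] [Preadditive E] {S : ObjectProperty (ShortComplex E)}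

namespace IsExactCategory

theorem mono_f (hE : IsExactCategory S) {s : ShortComplex E} (hs : S s) : Mono s.f :=
  Fork.IsLimit.mono (hE.isKernel s hs).some

theorem epi_g (hE : IsExactCategory S) {s : ShortComplex E} (hs : S s) : Epi s.g :=
  Cofork.IsColimit.epi (hE.isCokernel s hs).some

theorem exists_lift (hE : IsExactCategory S) {s : ShortComplex E} (hs : S s) {T : E}
    (t : T ⟶ s.X₂) (ht : t ≫ s.g = 0) : ∃ t' : T ⟶ s.X₁, t' ≫ s.f = t :=
  ⟨_, (KernelFork.IsLimit.lift' (hE.isKernel s hs).some t ht).2⟩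

theorem exists_desc (hE : IsExactCategory S) {s : ShortComplex E} (hs : S s) {T : E}
    (t : s.X₂ ⟶ T) (ht : s.f ≫ t = 0) : ∃ t' : s.X₃ ⟶ T, s.g ≫ t' = t :=
  ⟨_, (CokernelCofork.IsColimit.desc' (hE.isCokernel s hs).some t ht).2⟩

theorem of_splitting (hE : IsExactCategory S) {s : ShortComplex E} (hs : s.Splitting) : S s := by
  obtain ⟨Z, g, h, hS⟩ := hE.ex1 s ⟨hs⟩
  have := hE.closed_under_iso
  have := hE.hasFiniteBiproducts
  let e : Z ≅ s.X₃ := (hE.isCokernel _ hS).some.coconePointUniqueUpToIso hs.gIsCokernel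
  have he : g ≫ e.hom = s.g :=
    (hE.isCokernel _ hS).some.comp_coconePointUniqueUpToIso_hom hs.gIsCokernel
      WalkingParallelPair.one
  exact S.prop_of_iso
    (ShortComplex.isoMk (S₁ := ShortComplex.mk s.f g h) (Iso.refl _) (Iso.refl _) e (by simp)
      (by simp [he])) hS

end IsExactCategory

theorem IsBijective.biprod [HasBinaryBiproducts E] {X Y : E} (hX : IsBijective S X)
    (hY : IsBijective S Y) : IsBijective S (X ⊞ Y) := by
  refine ⟨fun U V g hg f => ?_, fun U V i hi f => ?_⟩
  · obtain ⟨a, ha⟩ := hX.1 g hg (biprod.inl ≫ f)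
    obtain ⟨b, hb⟩ := hY.1 g hg (biprod.inr ≫ f)
    exact ⟨biprod.desc a b, by ext <;> simp [ha, hb]⟩
  · obtain ⟨a, ha⟩ := hX.2 i hi (f ≫ biprod.fst)
    obtain ⟨b, hb⟩ := hY.2 i hi (f ≫ biprod.snd)
    exact ⟨biprod.lift a b, by ext <;> simp [ha, hb]⟩

theorem IsBijective.of_retract {X Y : E} (hY : IsBijective S Y) (i : X ⟶ Y) (r : Y ⟶ X)
    (hir : i ≫ r = 𝟙 X) : IsBijective S X := by
  refine ⟨fun U V g hg f => ?_, fun U V j hj f => ?_⟩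
  · obtain ⟨a, ha⟩ := hY.1 g hg (r ≫ f)
    exact ⟨i ≫ a, by rw [Category.assoc, ha, reassoc_of% hir]⟩
  · obtain ⟨a, ha⟩ := hY.2 j hj (f ≫ i)
    exact ⟨a ≫ r, by rw [reassoc_of% ha, hir, Category.comp_id]⟩

theorem IsFrobeniusCategory.congruence (hF : IsFrobeniusCategory S) :
    Congruence (factorRel (IsBijective S)) := by
  have := hF.isExactCategory.hasFiniteBiproducts
  have := hasBinaryBiproducts_of_finite_biproducts E
  refine factorRel_congruence (fun X Y => ?_) (fun X Y f g => ?_)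
  · obtain ⟨P, p, hP, -⟩ := (hF.isSufficientlyBig X).1
    exact ⟨P, 0, 0, hP, by simp⟩
  · rintro ⟨Z, a, b, hZ, e⟩ ⟨Z', a', b', hZ', e'⟩
    exact ⟨Z ⊞ Z', biprod.lift a a', biprod.desc b b', hZ.biprod hZ', by
      rw [sub_zero] at *; rw [e, e', biprod.lift_desc]⟩

section

variable [Congruence (factorRel (IsBijective S))]
  [Preadditive (AdditiveQuotient (IsBijective S))]
  [(Quotient.functor (factorRel (IsBijective S))).Additive]

/-- In the classical stable category, the first morphism of a pure short exact sequence becomes a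
weak kernel of the second. -/
theorem IsFrobeniusCategory.isWeakKernel (hF : IsFrobeniusCategory S)
    {s : ShortComplex E} (hs : S s) :
    IsWeakKernel ((Quotient.functor (factorRel (IsBijective S))).map s.f)
      ((Quotient.functor (factorRel (IsBijective S))).map s.g) := by
  refine ⟨by rw [← Functor.map_comp, s.zero, Functor.map_zero], fun T t ht => ?_⟩
  obtain ⟨T⟩ := T
  obtain ⟨t, rfl⟩ := (Quotient.functor (factorRel (IsBijective S))).map_surjective t
  rw [← Functor.map_comp, factorRel_functor_map_eq_zero_iff] at ht
  obtain ⟨N, a, b, hN, e⟩ := ht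
  obtain ⟨b', hb'⟩ := hN.1 s.g ⟨_, s.f, s.zero, hs⟩ b
  obtain ⟨t', ht'⟩ := hF.isExactCategory.exists_lift hs (t - a ≫ b')
    (by rw [Preadditive.sub_comp, e, Category.assoc, hb', sub_self])
  refine ⟨(Quotient.functor _).map t', ?_⟩
  rw [← Functor.map_comp, ht', ← sub_eq_zero, ← Functor.map_sub, factorRel_functor_map_eq_zero_iff]
  exact ⟨N, -a, b', hN, by simp⟩

theorem IsFrobeniusCategory.isWeakCokernel (hF : IsFrobeniusCategory S)
    {s : ShortComplex E} (hs : S s) :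
    IsWeakCokernel ((Quotient.functor (factorRel (IsBijective S))).map s.g)
      ((Quotient.functor (factorRel (IsBijective S))).map s.f) := by
  refine ⟨by rw [← Functor.map_comp, s.zero, Functor.map_zero], fun T t ht => ?_⟩
  obtain ⟨T⟩ := T
  obtain ⟨t, rfl⟩ := (Quotient.functor (factorRel (IsBijective S))).map_surjective t
  rw [← Functor.map_comp, factorRel_functor_map_eq_zero_iff] at ht
  obtain ⟨N, a, b, hN, e⟩ := ht
  obtain ⟨a', ha'⟩ := hN.2 s.f ⟨_, s.g, s.zero, hs⟩ a
  obtain ⟨t', ht'⟩ := hF.isExactCategory.exists_desc hs (t - a' ≫ b)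
    (by rw [Preadditive.comp_sub, e, reassoc_of% ha', sub_self])
  refine ⟨(Quotient.functor _).map t', ?_⟩
  rw [← Functor.map_comp, ht', ← sub_eq_zero, ← Functor.map_sub, factorRel_functor_map_eq_zero_iff]
  exact ⟨N, -a', b, hN, by simp⟩

/-- Up to an isomorphism, every morphism of the classical stable category is represented by a pure
monomorphism: enlarge the target by a bijective object into which the source embeds purely. -/
theorem IsFrobeniusCategory.exists_pureMono (hF : IsFrobeniusCategory S)
    {X Y : AdditiveQuotient (IsBijective S)} (f : X ⟶ Y) :
    ∃ (s : ShortComplex E) (hX : X = (Quotient.functor (factorRel (IsBijective S))).obj s.X₁)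
      (e : (Quotient.functor _).obj s.X₂ ≅ Y), S s ∧
        f = eqToHom hX ≫ (Quotient.functor _).map s.f ≫ e.hom := by
  have := hF.isExactCategory.hasFiniteBiproducts
  have := hasBinaryBiproducts_of_finite_biproducts E
  obtain ⟨X⟩ := X
  obtain ⟨Y⟩ := Y
  obtain ⟨f, rfl⟩ := (Quotient.functor (factorRel (IsBijective S))).map_surjective f
  obtain ⟨I, i, hI, hi⟩ := (hF.isSufficientlyBig X).2
  have hsnd : IsPureEpi S (biprod.snd : Y ⊞ I ⟶ I) :=
    ⟨Y, biprod.inl, by simp, hF.isExactCategory.of_splitting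
      { r := biprod.fst, s := biprod.inr }⟩
  obtain ⟨-, Z, -, g, h, -, hS, -⟩ := hF.isExactCategory.ex3 (biprod.lift f i) biprod.snd hsnd
    (by simpa using hi)
  refine ⟨ShortComplex.mk (biprod.lift f i) g h, rfl,
    ⟨(Quotient.functor _).map biprod.fst, (Quotient.functor _).map biprod.inl, ?_, ?_⟩, hS, ?_⟩
  · rw [← Functor.map_comp, ← CategoryTheory.Functor.map_id, ← sub_eq_zero, ← Functor.map_sub,
      factorRel_functor_map_eq_zero_iff]
    exact ⟨I, -biprod.snd, biprod.inr, hI, by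
      rw [← biprod.total, Preadditive.neg_comp]; abel⟩
  · rw [← Functor.map_comp, biprod.inl_fst, CategoryTheory.Functor.map_id]; rfl
  · simp [← Functor.map_comp]

theorem IsFrobeniusCategory.exists_pureEpi (hF : IsFrobeniusCategory S)
    {X Y : AdditiveQuotient (IsBijective S)} (f : X ⟶ Y) :
    ∃ (s : ShortComplex E) (hY : (Quotient.functor (factorRel (IsBijective S))).obj s.X₃ = Y)
      (e : X ≅ (Quotient.functor _).obj s.X₂), S s ∧
        f = e.hom ≫ (Quotient.functor _).map s.g ≫ eqToHom hY := by
  have := hF.isExactCategory.hasFiniteBiproducts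
  have := hasBinaryBiproducts_of_finite_biproducts E
  obtain ⟨X⟩ := X
  obtain ⟨Y⟩ := Y
  obtain ⟨f, rfl⟩ := (Quotient.functor (factorRel (IsBijective S))).map_surjective f
  obtain ⟨P, p, hP, hp⟩ := (hF.isSufficientlyBig Y).1
  have hinr : IsPureMono S (biprod.inr : P ⟶ X ⊞ P) :=
    ⟨X, biprod.fst, by simp, hF.isExactCategory.of_splitting
      { r := biprod.snd, s := biprod.inl, id := by simp [add_comm] }⟩
  obtain ⟨Z, -, g, -, -, h, -, hS, -⟩ := hF.isExactCategory.ex3_op biprod.inr (biprod.desc f p) hinr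
    (by simpa using hp)
  refine ⟨ShortComplex.mk g _ h, rfl,
    ⟨(Quotient.functor _).map biprod.inl, (Quotient.functor _).map biprod.fst, ?_, ?_⟩, hS, ?_⟩
  · rw [← Functor.map_comp, biprod.inl_fst, CategoryTheory.Functor.map_id]; rfl
  · rw [← Functor.map_comp, ← CategoryTheory.Functor.map_id, ← sub_eq_zero, ← Functor.map_sub,
      factorRel_functor_map_eq_zero_iff]
    exact ⟨P, -biprod.snd, biprod.inr, hP, by
      rw [← biprod.total, Preadditive.neg_comp]; abel⟩
  · simp [← Functor.map_comp]

theorem IsFrobeniusCategory.weaklyAbelian (hF : IsFrobeniusCategory S) :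
    WeaklyAbelian (AdditiveQuotient (IsBijective S)) := by
  refine ⟨fun X Y f => ?_, fun X Y f => ?_, fun X Y f => ?_, fun X Y f => ?_⟩
  · obtain ⟨s, rfl, e, hs, rfl⟩ := hF.exists_pureEpi f
    exact ⟨_, _, by simpa using (hF.isWeakKernel hs).comp_iso e.symm⟩
  · obtain ⟨s, rfl, e, hs, rfl⟩ := hF.exists_pureMono f
    exact ⟨_, _, by simpa using (hF.isWeakCokernel hs).comp_iso e⟩
  · obtain ⟨s, rfl, e, hs, rfl⟩ := hF.exists_pureMono f
    exact ⟨_, _, by simpa using (hF.isWeakKernel hs).comp_iso e⟩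
  · obtain ⟨s, rfl, e, hs, rfl⟩ := hF.exists_pureEpi f
    exact ⟨_, _, by simpa using (hF.isWeakCokernel hs).comp_iso e.symm⟩

end

theorem IsFrobeniusCategory.quotientWeaklyAbelian (hF : IsFrobeniusCategory S) :
    QuotientWeaklyAbelian (IsBijective S) := by
  have := hF.congruence
  have := hF.isExactCategory.hasFiniteBiproducts
  let _ := Quotient.preadditive (factorRel (IsBijective S)) factorRel_add
  have := Quotient.functor_additive (factorRel (IsBijective S)) factorRel_add
  exact ⟨inferInstance, inferInstance, hasFiniteBiproducts_additiveQuotient, hF.weaklyAbelian⟩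

end Frobenius

/-! ### Dependent choice along the orbits of a free ℤ-action -/

section Orbits

variable {Ξ : Type*} (σ : Ξ ≃ Ξ) (q : Ξ → ℤ) {α : Ξ → Type*} (R : ∀ ξ, α ξ → α (σ ξ) → Prop)

/-- The family obtained from its members on level zero, with respect to `q`, by propagating them
along the orbits of `σ`, upwards by means of `up` and downwards by means of `down`. -/
noncomputable def orbitFamily (hq : ∀ ξ, q (σ ξ) = q ξ + 1)
    (up : ∀ ξ a, ∃ b, R ξ a b) (down : ∀ ξ b, ∃ a, R ξ a b) (a₀ : ∀ ξ, q ξ = 0 → α ξ)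
    (ξ : Ξ) : α ξ :=
  if h₀ : q ξ = 0 then a₀ ξ h₀
  else if _h₁ : 0 < q ξ then
    (σ.apply_symm_apply ξ) ▸ (up (σ.symm ξ) (orbitFamily hq up down a₀ (σ.symm ξ))).choose
  else (down ξ (orbitFamily hq up down a₀ (σ ξ))).choose
termination_by (q ξ).natAbs
decreasing_by
  · have := hq (σ.symm ξ)
    rw [σ.apply_symm_apply] at this
    omega
  · have := hq ξ
    omega

/-- If a relation between neighbours on the orbits of `σ` can be satisfied one step upwards and one
step downwards, then it can be satisfied everywhere, starting from given values on level zero. -/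
theorem exists_orbitFamily (hq : ∀ ξ, q (σ ξ) = q ξ + 1)
    (up : ∀ ξ a, ∃ b, R ξ a b) (down : ∀ ξ b, ∃ a, R ξ a b) (a₀ : ∀ ξ, q ξ = 0 → α ξ) :
    ∃ x : ∀ ξ, α ξ, (∀ ξ h, x ξ = a₀ ξ h) ∧ ∀ ξ, R ξ (x ξ) (x (σ ξ)) := by
  refine ⟨orbitFamily σ q R hq up down a₀, fun ξ h => by rw [orbitFamily, dif_pos h], fun ξ => ?_⟩
  have key : ∀ ζ, 0 < q ζ → ∀ ξ (h : ζ = σ ξ), R ξ (orbitFamily σ q R hq up down a₀ ξ)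
      (h ▸ orbitFamily σ q R hq up down a₀ ζ) := by
    intro ζ hζ ξ h
    obtain rfl : ξ = σ.symm ζ := by simp [h]
    rw [orbitFamily.eq_1 σ q R hq up down a₀ ζ, dif_neg hζ.ne', dif_pos hζ]
    have cast : ∀ {a b : Ξ} (h : a = b) (h' : b = a) (y : α a), h' ▸ (h ▸ y) = y := by
      rintro a _ rfl _ y
      rfl
    rw [cast]
    exact (up (σ.symm ζ) _).choose_spec
  rcases lt_or_ge (q ξ) 0 with h | h
  · rw [orbitFamily.eq_1 σ q R hq up down a₀ ξ, dif_neg h.ne, dif_neg h.not_gt]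
    exact (down ξ _).choose_spec
  · exact key (σ ξ) (by rw [hq]; omega) ξ rfl

end Orbits

/-- Dependent choice in both directions along the integers. -/
theorem exists_intFamily {α : ℤ → Type*} (R : ∀ i, α i → α (i + 1) → Prop)
    (up : ∀ i a, ∃ b, R i a b) (down : ∀ i b, ∃ a, R i a b) (i₀ : ℤ) (a₀ : α i₀) :
    ∃ x : ∀ i, α i, x i₀ = a₀ ∧ ∀ i, R i (x i) (x (i + 1)) := by
  obtain ⟨x, hx, hR⟩ := exists_orbitFamily (Equiv.addRight (1 : ℤ)) (fun i => i - i₀)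
    R (fun i => by simp only [Equiv.coe_addRight]; ring) up down
    (fun i h => (show i₀ = i by omega) ▸ a₀)
  exact ⟨x, hx i₀ (by simp), hR⟩

/-! ### The stable category of a Frobenius category -/

section Stable

variable {E : Type u} [Category.{v} E] [Preadditive E] {S : ObjectProperty (ShortComplex E)}
  {B : ObjectProperty E}

namespace AcyclicComplexes

/-- The cycles of a purely acyclic complex: `K.obj.d i (i + 1)` factors as the pure epimorphism
`toCyc K i` onto `cyc K i`, followed by the pure monomorphism `fromCyc K i`. -/
noncomputable def cyc (K : AcyclicComplexes S B) (i : ℤ) : E := K.property.2.choose i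

/-- The projection to the cycles. -/
noncomputable def toCyc (K : AcyclicComplexes S B) (i : ℤ) : K.obj.X i ⟶ cyc K i :=
  K.property.2.choose_spec.choose i

/-- The inclusion of the cycles. -/
noncomputable def fromCyc (K : AcyclicComplexes S B) (i : ℤ) : cyc K i ⟶ K.obj.X (i + 1) :=
  K.property.2.choose_spec.choose_spec.choose i

variable (K L M : AcyclicComplexes S B)

theorem d_eq (i : ℤ) : K.obj.d i (i + 1) = toCyc K i ≫ fromCyc K i :=
  K.property.2.choose_spec.choose_spec.choose_spec.1 i

theorem fromCyc_toCyc (i : ℤ) : fromCyc K i ≫ toCyc K (i + 1) = 0 :=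
  (K.property.2.choose_spec.choose_spec.choose_spec.2 i).choose

theorem pure_cyc (i : ℤ) : S (ShortComplex.mk _ _ (fromCyc_toCyc K i)) :=
  (K.property.2.choose_spec.choose_spec.choose_spec.2 i).choose_spec

theorem isPureMono_fromCyc (i : ℤ) : IsPureMono S (fromCyc K i) := ⟨_, _, _, pure_cyc K i⟩

theorem isPureEpi_toCyc (i : ℤ) : IsPureEpi S (toCyc K i) := by
  obtain ⟨j, rfl⟩ : ∃ j, i = j + 1 := ⟨i - 1, by simp⟩
  exact ⟨_, _, _, pure_cyc K j⟩

theorem mono_fromCyc (hE : IsExactCategory S) (i : ℤ) : Mono (fromCyc K i) :=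
  hE.mono_f (pure_cyc K i)

theorem epi_toCyc (hE : IsExactCategory S) (i : ℤ) : Epi (toCyc K i) := by
  obtain ⟨j, rfl⟩ : ∃ j, i = j + 1 := ⟨i - 1, by simp⟩
  exact hE.epi_g (pure_cyc K j)

theorem d_toCyc (i : ℤ) : K.obj.d i (i + 1) ≫ toCyc K (i + 1) = 0 := by
  rw [d_eq, Category.assoc, fromCyc_toCyc, comp_zero]

variable {K L M}

theorem exists_cycMap (hE : IsExactCategory S) (f : K ⟶ L) (i : ℤ) :
    ∃ z : cyc K i ⟶ cyc L i, toCyc K i ≫ z = f.hom.f i ≫ toCyc L i := by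
  obtain ⟨j, rfl⟩ : ∃ j, i = j + 1 := ⟨i - 1, by simp⟩
  refine hE.exists_desc (pure_cyc K j) _ ?_
  have := epi_toCyc K hE j
  rw [← cancel_epi (toCyc K j)]
  change toCyc K j ≫ fromCyc K j ≫ _ = _
  rw [← Category.assoc, ← d_eq, ← HomologicalComplex.Hom.comm_assoc, d_toCyc, comp_zero, comp_zero]

/-- The morphism induced on the cycles. -/
noncomputable def cycMap (hE : IsExactCategory S) (f : K ⟶ L) (i : ℤ) : cyc K i ⟶ cyc L i :=
  (exists_cycMap hE f i).choose

theorem toCyc_cycMap (hE : IsExactCategory S) (f : K ⟶ L) (i : ℤ) :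
    toCyc K i ≫ cycMap hE f i = f.hom.f i ≫ toCyc L i :=
  (exists_cycMap hE f i).choose_spec

theorem cycMap_unique (hE : IsExactCategory S) (f : K ⟶ L) (i : ℤ) (z : cyc K i ⟶ cyc L i)
    (hz : toCyc K i ≫ z = f.hom.f i ≫ toCyc L i) : cycMap hE f i = z := by
  have := epi_toCyc K hE i
  rw [← cancel_epi (toCyc K i), hz, toCyc_cycMap]

theorem cycMap_sub (hE : IsExactCategory S) (f g : K ⟶ L) (i : ℤ) :
    cycMap hE (f - g) i = cycMap hE f i - cycMap hE g i := by
  refine cycMap_unique hE _ i _ ?_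
  rw [Preadditive.comp_sub, toCyc_cycMap, toCyc_cycMap, ← Preadditive.sub_comp]
  rfl

variable (B) in
/-- Taking the cycles in a fixed degree, as a functor. -/
noncomputable def cycFunctor (hE : IsExactCategory S) (i : ℤ) : AcyclicComplexes S B ⥤ E where
  obj K := cyc K i
  map f := cycMap hE f i
  map_id K := cycMap_unique hE _ i _ (by simp)
  map_comp f g := cycMap_unique hE _ i _ (by
    rw [← Category.assoc, toCyc_cycMap, Category.assoc, toCyc_cycMap]; simp)

/-- A morphism of complexes is null-homotopic; here, the homotopy `h` is indexed so that `h i` has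
target in degree `i`. -/
def IsNullHomotopic (f : K ⟶ L) : Prop :=
  ∃ h : ∀ i, K.obj.X (i + 1) ⟶ L.obj.X i, ∀ i,
    f.hom.f (i + 1) = K.obj.d (i + 1) (i + 1 + 1) ≫ h (i + 1) + h i ≫ L.obj.d i (i + 1)

theorem IsNullHomotopic.zero : IsNullHomotopic (0 : K ⟶ L) :=
  ⟨fun _ => 0, fun i => by simp⟩

theorem IsNullHomotopic.add {f g : K ⟶ L} (hf : IsNullHomotopic f) (hg : IsNullHomotopic g) :
    IsNullHomotopic (f + g) := by
  obtain ⟨h, hh⟩ := hf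
  obtain ⟨k, hk⟩ := hg
  refine ⟨fun i => h i + k i, fun i => ?_⟩
  change f.hom.f (i + 1) + g.hom.f (i + 1) = _
  rw [hh, hk, Preadditive.comp_add, Preadditive.add_comp]
  abel

theorem IsNullHomotopic.comp {f : K ⟶ L} (hf : IsNullHomotopic f) (g : L ⟶ M) :
    IsNullHomotopic (f ≫ g) := by
  obtain ⟨h, hh⟩ := hf
  refine ⟨fun i => h i ≫ g.hom.f i, fun i => ?_⟩
  change f.hom.f (i + 1) ≫ g.hom.f (i + 1) = _
  rw [hh]
  simp

theorem IsNullHomotopic.precomp {g : L ⟶ M} (hg : IsNullHomotopic g) (f : K ⟶ L) :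
    IsNullHomotopic (f ≫ g) := by
  obtain ⟨h, hh⟩ := hg
  refine ⟨fun i => f.hom.f (i + 1) ≫ h i, fun i => ?_⟩
  change f.hom.f (i + 1) ≫ g.hom.f (i + 1) = _
  rw [hh]
  simp

theorem isNullHomotopic_id_of_isSplitAcyclic (hK : IsSplitAcyclic S B K) :
    IsNullHomotopic (𝟙 K) := by
  obtain ⟨T, b, e, hb, hd⟩ := hK
  refine ⟨fun i => (e (i + 1)).hom ≫ (b (i + 1)).fst ≫ (b i).inr ≫ (e i).inv, fun i => ?_⟩
  have h₁ := hd i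
  have h₂ := hd (i + 1)
  rw [← Iso.eq_comp_inv] at h₁ h₂
  rw [h₁, h₂]
  have := IsBilimit.binary_total (hb (i + 1)).2.some
  rw [← cancel_epi (e (i + 1)).inv, ← cancel_mono (e (i + 1)).hom]
  simp [← this, add_comm]

/-- A null-homotopic morphism factors through the cone on the identity of its source. -/
theorem IsNullHomotopic.factorRel (hE : IsExactCategory S) (hB : IsAdditiveSubcategory B)
    {f : K ⟶ L} (hf : IsNullHomotopic f) : factorRel (IsSplitAcyclic S B) f 0 := by
  obtain ⟨h, hh⟩ := hf
  choose b hb hbB using fun i : ℤ =>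
    hB.2 (K.obj.X i) (K.obj.X (i + 1)) (K.property.1 i) (K.property.1 (i + 1))
  let C : CochainComplex E ℤ := CochainComplex.of (fun i => (b i).pt)
    (fun i => (b i).snd ≫ (b (i + 1)).inl) (fun i => by simp)
  have hCd : ∀ i, C.d i (i + 1) = (b i).snd ≫ (b (i + 1)).inl := CochainComplex.of_d _ _
  have hC : (∀ i, B (C.X i)) ∧ IsPurelyAcyclic S C := by
    refine ⟨hbB, fun i => K.obj.X (i + 1), fun i => (b i).snd, fun i => (b (i + 1)).inl, hCd,
      fun i => ⟨(b (i + 1)).inl_snd, hE.of_splitting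
        { r := (b (i + 1)).fst
          s := (b (i + 1)).inr
          id := IsBilimit.binary_total (hb (i + 1)).some }⟩⟩
  let u : K.obj ⟶ C :=
    { f := fun i => (b i).inl + K.obj.d i (i + 1) ≫ (b i).inr
      comm' := by
        rintro i _ rfl
        rw [hCd]
        simp }
  let w : C ⟶ L.obj :=
    { f := fun i => (b i).fst ≫ (f.hom.f i - K.obj.d i (i + 1) ≫ h i) + (b i).snd ≫ h i
      comm' := by
        rintro i _ rfl
        rw [hCd]
        have h₁ : h i ≫ L.obj.d i (i + 1) =
            f.hom.f (i + 1) - K.obj.d (i + 1) (i + 1 + 1) ≫ h (i + 1) := by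
          rw [hh, add_sub_cancel_left]
        simp [h₁] }
  refine ⟨⟨C, hC⟩, ObjectProperty.homMk u, ObjectProperty.homMk w, ?_, ?_⟩
  · exact ⟨fun i => K.obj.X i, b, fun i => Iso.refl _, fun i => ⟨K.property.1 i, hb i⟩,
      fun i => by simpa using hCd i⟩
  · ext i
    change f.hom.f i - 0 = ((b i).inl + K.obj.d i (i + 1) ≫ (b i).inr) ≫
      ((b i).fst ≫ (f.hom.f i - K.obj.d i (i + 1) ≫ h i) + (b i).snd ≫ h i)
    simp

theorem factorRel_isSplitAcyclic_iff (hE : IsExactCategory S) (hB : IsAdditiveSubcategory B)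
    (f : K ⟶ L) : _root_.factorRel (IsSplitAcyclic S B) f 0 ↔ IsNullHomotopic f := by
  refine ⟨?_, fun hf => hf.factorRel hE hB⟩
  rintro ⟨M, a, b, hM, e⟩
  rw [sub_zero] at e
  rw [e, ← Category.id_comp b]
  exact ((isNullHomotopic_id_of_isSplitAcyclic hM).comp b).precomp a

theorem congruence_factorRel (hE : IsExactCategory S) (hB : IsAdditiveSubcategory B) :
    Congruence (_root_.factorRel (IsSplitAcyclic S B)) := by
  refine factorRel_congruence (fun K L => ?_) (fun K L f g hf hg => ?_)
  · exact IsNullHomotopic.zero.factorRel hE hB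
  · rw [factorRel_isSplitAcyclic_iff hE hB] at *
    exact hf.add hg

theorem IsNullHomotopic.factorRel_cycMap (hE : IsExactCategory S) (hBb : B ≤ IsBijective S)
    {f : K ⟶ L} (hf : IsNullHomotopic f) (i : ℤ) :
    _root_.factorRel (IsBijective S) (cycMap hE f i) 0 := by
  obtain ⟨h, hh⟩ := hf
  obtain ⟨j, rfl⟩ : ∃ j, i = j + 1 := ⟨i - 1, by simp⟩
  refine ⟨_, fromCyc K (j + 1), h (j + 1) ≫ toCyc L (j + 1), hBb _ (K.property.1 _), ?_⟩
  rw [sub_zero]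
  refine cycMap_unique hE f _ _ ?_
  rw [hh, ← Category.assoc, ← d_eq, Preadditive.add_comp, Category.assoc (h j), d_toCyc, comp_zero,
    add_zero, Category.assoc]

/-- A morphism of complexes is null-homotopic as soon as the morphism induced on the cycles in a
single degree factors through a bijective object. -/
theorem isNullHomotopic_of_factorRel (hE : IsExactCategory S) (hBb : B ≤ IsBijective S)
    {f : K ⟶ L} (i₀ : ℤ)
    (hf : _root_.factorRel (IsBijective S) (cycMap hE f (i₀ + 1)) 0) : IsNullHomotopic f := by
  have hK : ∀ i, IsBijective S (K.obj.X i) := fun i => hBb _ (K.property.1 i)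
  have hL : ∀ i, IsBijective S (L.obj.X i) := fun i => hBb _ (L.property.1 i)
  obtain ⟨N, a, b, hN, e⟩ := hf
  rw [sub_zero] at e
  -- The two homotopies adjacent to the given degree.
  obtain ⟨a', ha'⟩ := hN.2 _ (isPureMono_fromCyc K (i₀ + 1)) a
  obtain ⟨b', hb'⟩ := hN.1 _ (isPureEpi_toCyc L (i₀ + 1)) b
  obtain ⟨g, hg⟩ := hE.exists_lift (pure_cyc L i₀)
    (f.hom.f (i₀ + 1) - K.obj.d (i₀ + 1) (i₀ + 1 + 1) ≫ a' ≫ b') (by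
      change _ ≫ toCyc L (i₀ + 1) = 0
      rw [Preadditive.sub_comp, ← toCyc_cycMap hE, e, d_eq]
      simp only [Category.assoc, hb', reassoc_of% ha', sub_self])
  change g ≫ fromCyc L i₀ = _ at hg
  obtain ⟨g', hg'⟩ := (hK (i₀ + 1)).1 _ (isPureEpi_toCyc L i₀) g
  let α (i : ℤ) : Type v := { p : (K.obj.X (i + 1) ⟶ L.obj.X i) ×
    (K.obj.X (i + 1 + 1) ⟶ L.obj.X (i + 1)) //
      f.hom.f (i + 1) = K.obj.d (i + 1) (i + 1 + 1) ≫ p.2 + p.1 ≫ L.obj.d i (i + 1) }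
  have up : ∀ (i : ℤ) (p : α i), ∃ p' : α (i + 1), p'.1.1 = p.1.2 := by
    rintro i ⟨⟨h₁, h₂⟩, hh⟩
    have := epi_toCyc K hE (i + 1)
    obtain ⟨k, hk⟩ := hE.exists_desc (pure_cyc K (i + 1))
      (f.hom.f (i + 1 + 1) - h₂ ≫ L.obj.d (i + 1) (i + 1 + 1)) (by
        change fromCyc K (i + 1) ≫ _ = 0
        rw [← cancel_epi (toCyc K (i + 1)), ← Category.assoc, ← d_eq, Preadditive.comp_sub,
          ← HomologicalComplex.Hom.comm, hh]
        simp)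
    change toCyc K _ ≫ k = _ at hk
    obtain ⟨k', hk'⟩ := (hL (i + 1 + 1)).2 _ (isPureMono_fromCyc K (i + 1 + 1)) k
    exact ⟨⟨(h₂, k'), by rw [d_eq K, Category.assoc, hk', hk, sub_add_cancel]⟩, rfl⟩
  have down : ∀ (i : ℤ) (p' : α (i + 1)), ∃ p : α i, p'.1.1 = p.1.2 := by
    rintro i ⟨⟨h₂, h₃⟩, hh⟩
    have := mono_fromCyc L hE (i + 1)
    obtain ⟨k, hk⟩ := hE.exists_lift (pure_cyc L i)
      (f.hom.f (i + 1) - K.obj.d (i + 1) (i + 1 + 1) ≫ h₂) (by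
        change _ ≫ toCyc L (i + 1) = 0
        rw [← cancel_mono (fromCyc L (i + 1)), Category.assoc, ← d_eq, Preadditive.sub_comp,
          HomologicalComplex.Hom.comm, hh]
        simp)
    change k ≫ fromCyc L i = _ at hk
    obtain ⟨k', hk'⟩ := (hK (i + 1)).1 _ (isPureEpi_toCyc L i) k
    exact ⟨⟨(k', h₂), by rw [d_eq L, reassoc_of% hk', hk, add_sub_cancel]⟩, rfl⟩
  obtain ⟨x, -, hx⟩ := exists_intFamily (α := α) (fun i p p' => p'.1.1 = p.1.2) up down i₀
    ⟨(g', a' ≫ b'), by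
      rw [d_eq L, reassoc_of% hg', hg, add_sub_cancel]⟩
  refine ⟨fun i => (x i).1.1, fun i => ?_⟩
  change _ = _ ≫ (x (i + 1)).1.1 + _
  rw [hx]
  exact (x i).2

/-- Every morphism between the cycles in a given degree is induced by a morphism of complexes. -/
theorem exists_cycMap_eq (hE : IsExactCategory S) (hBb : B ≤ IsBijective S) (i₀ : ℤ)
    (z : cyc K i₀ ⟶ cyc L i₀) : ∃ f : K ⟶ L, cycMap hE f i₀ = z := by
  have hK : ∀ i, IsBijective S (K.obj.X i) := fun i => hBb _ (K.property.1 i)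
  have hL : ∀ i, IsBijective S (L.obj.X i) := fun i => hBb _ (L.property.1 i)
  let R (i : ℤ) (z : cyc K i ⟶ cyc L i) (z' : cyc K (i + 1) ⟶ cyc L (i + 1)) : Prop :=
    ∃ φ : K.obj.X (i + 1) ⟶ L.obj.X (i + 1),
      fromCyc K i ≫ φ = z ≫ fromCyc L i ∧ toCyc K (i + 1) ≫ z' = φ ≫ toCyc L (i + 1)
  have up : ∀ i z, ∃ z', R i z z' := by
    intro i z
    obtain ⟨φ, hφ⟩ := (hL (i + 1)).2 _ (isPureMono_fromCyc K i) (z ≫ fromCyc L i)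
    obtain ⟨z', hz'⟩ := hE.exists_desc (pure_cyc K i) (φ ≫ toCyc L (i + 1)) (by
      change fromCyc K i ≫ _ = 0
      rw [reassoc_of% hφ, fromCyc_toCyc, comp_zero])
    exact ⟨z', φ, hφ, hz'⟩
  have down : ∀ i z', ∃ z, R i z z' := by
    intro i z'
    obtain ⟨φ, hφ⟩ := (hK (i + 1)).1 _ (isPureEpi_toCyc L (i + 1)) (toCyc K (i + 1) ≫ z')
    obtain ⟨z, hz⟩ := hE.exists_lift (pure_cyc L i) (fromCyc K i ≫ φ) (by
      change _ ≫ toCyc L (i + 1) = 0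
      rw [Category.assoc, hφ, ← Category.assoc, fromCyc_toCyc, zero_comp])
    exact ⟨z, φ, hz.symm, hφ.symm⟩
  obtain ⟨x, rfl, hx⟩ := exists_intFamily (α := fun i => cyc K i ⟶ cyc L i) R up down i₀ z
  have hφ : ∀ i, ∃ φ : K.obj.X i ⟶ L.obj.X i, toCyc K i ≫ x i = φ ≫ toCyc L i ∧
      ∀ j (h : j + 1 = i), fromCyc K j ≫ eqToHom (by rw [h]) ≫ φ =
        x j ≫ fromCyc L j ≫ eqToHom (by rw [h]) := by
    intro i
    obtain ⟨j, rfl⟩ : ∃ j, i = j + 1 := ⟨i - 1, by simp⟩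
    obtain ⟨φ, h₁, h₂⟩ := hx j
    refine ⟨φ, h₂, fun j' h => ?_⟩
    obtain rfl : j' = j := by omega
    simpa using h₁
  choose φ h₁ h₂ using hφ
  refine ⟨ObjectProperty.homMk { f := φ, comm' := ?_ }, cycMap_unique hE _ _ _ (h₁ _)⟩
  rintro i _ rfl
  have := h₂ _ i rfl
  simp only [eqToHom_refl, Category.id_comp, Category.comp_id] at this
  rw [d_eq, d_eq, Category.assoc, this, ← Category.assoc, ← h₁, Category.assoc]

/-- Every object is isomorphic to the cycles, in a given degree, of a complex obtained from
resolutions in both directions. -/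
theorem exists_cyc_iso (hE : IsExactCategory S) (hBbig : IsSufficientlyBig S B) (i₀ : ℤ) (X : E) :
    ∃ K : AcyclicComplexes S B, Nonempty (cyc K i₀ ≅ X) := by
  obtain ⟨x, rfl, hx⟩ := exists_intFamily (α := fun _ => E)
    (fun _ Z Z' => ∃ (P : E) (i : Z ⟶ P) (p : P ⟶ Z') (h : i ≫ p = 0), B P ∧
      S (ShortComplex.mk i p h))
    (fun _ Z => by
      obtain ⟨P, i, hP, Z', p, h, hS⟩ := (hBbig Z).2
      exact ⟨Z', P, i, p, h, hP, hS⟩)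
    (fun _ Z' => by
      obtain ⟨P, p, hP, Z, i, h, hS⟩ := (hBbig Z').1
      exact ⟨Z, P, i, p, h, hP, hS⟩) (i₀ + 1) X
  choose P m p h hP hS using hx
  -- In degree `i`, the complex has the entry `P i` and the cycles `x (i + 1)`.
  let C : CochainComplex E ℤ := CochainComplex.of P (fun i => p i ≫ m (i + 1))
    (fun i => by simp [reassoc_of% h])
  let K : AcyclicComplexes S B := ⟨C, hP, fun i => x (i + 1), p, fun i => m (i + 1),
    CochainComplex.of_d _ _, fun i => ⟨h _, hS _⟩⟩
  have hd : toCyc K i₀ ≫ fromCyc K i₀ = p i₀ ≫ m (i₀ + 1) :=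
    (d_eq K i₀).symm.trans (CochainComplex.of_d P (fun i => p i ≫ m (i + 1)) i₀)
  have := epi_toCyc K hE i₀
  have := mono_fromCyc K hE i₀
  have : Epi (p i₀) := hE.epi_g (hS i₀)
  have : Mono (m (i₀ + 1)) := hE.mono_f (hS (i₀ + 1))
  obtain ⟨Z, k, hk, hZ⟩ := isPureEpi_toCyc K i₀
  obtain ⟨z, hz⟩ := hE.exists_desc hZ (p i₀) (by
    rw [← cancel_mono (m (i₀ + 1)), Category.assoc, ← hd]
    simp [reassoc_of% hk])
  obtain ⟨z', hz'⟩ := hE.exists_desc (hS i₀) (toCyc K i₀) (by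
    rw [← cancel_mono (fromCyc K i₀), Category.assoc, hd]
    simp [reassoc_of% h])
  change toCyc K i₀ ≫ z = _ at hz
  change p i₀ ≫ z' = _ at hz'
  refine ⟨K, ⟨z, z', ?_, ?_⟩⟩
  · rw [← cancel_epi (toCyc K i₀), reassoc_of% hz, hz', Category.comp_id]
  · rw [← cancel_epi (p i₀), reassoc_of% hz', hz, Category.comp_id]

end AcyclicComplexes

open AcyclicComplexes

/-- Taking cycles is an equivalence from the stable category to the classical stable category. -/
theorem IsFrobeniusCategory.exists_stableEquivalence (hF : IsFrobeniusCategory S)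
    (hB : IsAdditiveSubcategory B) (hBb : B ≤ IsBijective S) (hBbig : IsSufficientlyBig S B) :
    Nonempty (StableCategory S B ≌ AdditiveQuotient (IsBijective S)) := by
  have hE := hF.isExactCategory
  have := congruence_factorRel hE hB
  have := hF.congruence
  let G := cycFunctor B hE (0 + 1) ⋙ Quotient.functor (factorRel (IsBijective S))
  have hG : ∀ (K L : AcyclicComplexes S B) (f g : K ⟶ L),
      factorRel (IsSplitAcyclic S B) f g ↔ G.map f = G.map g := by
    intro K L f g
    change _ ↔ (Quotient.functor (factorRel (IsBijective S))).map (cycMap hE f (0 + 1)) =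
      (Quotient.functor (factorRel (IsBijective S))).map (cycMap hE g (0 + 1))
    rw [Quotient.functor_map_eq_iff, factorRel_iff_sub, factorRel_iff_sub (cycMap hE f _),
      factorRel_isSplitAcyclic_iff hE hB, ← cycMap_sub]
    exact ⟨fun h => h.factorRel_cycMap hE hBb _, isNullHomotopic_of_factorRel hE hBb 0⟩
  let F : StableCategory S B ⥤ AdditiveQuotient (IsBijective S) :=
    CategoryTheory.Quotient.lift _ G fun K L f g h => (hG K L f g).1 h
  have : F.Faithful := ⟨by
    rintro ⟨K⟩ ⟨L⟩ f g h
    obtain ⟨f, rfl⟩ := (Quotient.functor (factorRel (IsSplitAcyclic S B))).map_surjective f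
    obtain ⟨g, rfl⟩ := (Quotient.functor (factorRel (IsSplitAcyclic S B))).map_surjective g
    rw [Quotient.functor_map_eq_iff]
    exact (hG K L f g).2 h⟩
  have : F.Full := ⟨by
    rintro ⟨K⟩ ⟨L⟩ z
    obtain ⟨z, rfl⟩ := (Quotient.functor (factorRel (IsBijective S))).map_surjective z
    obtain ⟨f, rfl⟩ := exists_cycMap_eq hE hBb (0 + 1) z
    exact ⟨(Quotient.functor _).map f, rfl⟩⟩
  have : F.EssSurj := ⟨by
    rintro ⟨X⟩
    obtain ⟨K, ⟨e⟩⟩ := exists_cyc_iso hE hBbig (0 + 1) X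
    exact ⟨⟨K⟩, ⟨(Quotient.functor (factorRel (IsBijective S))).mapIso e⟩⟩⟩
  have : F.IsEquivalence := {}
  exact ⟨F.asEquivalence⟩

theorem IsFrobeniusCategory.quotientWeaklyAbelian_isSplitAcyclic (hF : IsFrobeniusCategory S)
    (hB : IsAdditiveSubcategory B) (hBb : B ≤ IsBijective S) (hBbig : IsSufficientlyBig S B) :
    QuotientWeaklyAbelian (IsSplitAcyclic S B) := by
  have := congruence_factorRel hF.isExactCategory hB
  let _ := Quotient.preadditive (factorRel (IsSplitAcyclic S B)) factorRel_add
  have := Quotient.functor_additive (factorRel (IsSplitAcyclic S B)) factorRel_add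
  obtain ⟨e⟩ := hF.exists_stableEquivalence hB hBb hBbig
  obtain ⟨_, _, _, h⟩ := hF.quotientWeaklyAbelian
  have : HasFiniteProducts (StableCategory S B) :=
    ⟨fun n => Adjunction.hasLimitsOfShape_of_equivalence e.functor⟩
  exact ⟨inferInstance, inferInstance, HasFiniteBiproducts.of_hasFiniteProducts,
    h.of_equivalence e.functor⟩

end Stable

/-! ### Split and pointwise split short exact sequences -/

section Split

variable {A : Type u} [Category.{v} A] [Preadditive A]

variable (A) in
/-- The split short exact sequences. A pure monomorphism with respect to these is the inclusion of a
direct summand that has a complement. -/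
abbrev splitSequences : ObjectProperty (ShortComplex A) := fun s => Nonempty s.Splitting

theorem isPureEpi_op {X Y : A} {f : X ⟶ Y} (hf : IsPureMono (splitSequences A) f) :
    IsPureEpi (splitSequences Aᵒᵖ) f.op := by
  obtain ⟨Z, g, h, ⟨hs⟩⟩ := hf
  exact ⟨_, g.op, by rw [← op_comp, h, op_zero], ⟨hs.op⟩⟩

theorem isPureMono_op {X Y : A} {f : X ⟶ Y} (hf : IsPureEpi (splitSequences A) f) :
    IsPureMono (splitSequences Aᵒᵖ) f.op := by
  obtain ⟨Z, g, h, ⟨hs⟩⟩ := hf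
  exact ⟨_, g.op, by rw [← op_comp, h, op_zero], ⟨hs.op⟩⟩

theorem isPureMono_of_op {X Y : A} {f : X ⟶ Y} (hf : IsPureEpi (splitSequences Aᵒᵖ) f.op) :
    IsPureMono (splitSequences A) f := by
  obtain ⟨Z, g, h, ⟨hs⟩⟩ := hf
  exact ⟨_, g.unop, Quiver.Hom.op_inj (by simpa using h), ⟨hs.unop⟩⟩

theorem isPureEpi_of_op {X Y : A} {f : X ⟶ Y} (hf : IsPureMono (splitSequences Aᵒᵖ) f.op) :
    IsPureEpi (splitSequences A) f := by
  obtain ⟨Z, g, h, ⟨hs⟩⟩ := hf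
  exact ⟨_, g.unop, Quiver.Hom.op_inj (by simpa using h), ⟨hs.unop⟩⟩

theorem isPureMono_split_of_isIso {X Y : A} (f : X ⟶ Y) [IsIso f] {Z : A} (hZ : IsZero Z) :
    IsPureMono (splitSequences A) f :=
  ⟨Z, 0, by simp, ⟨{ r := inv f, s := 0, s_g := hZ.eq_of_src _ _ }⟩⟩

section

variable [HasBinaryBiproducts A]

theorem isPureMono_split_comp {X Y Z : A} {f : X ⟶ Y} {g : Y ⟶ Z}
    (hf : IsPureMono (splitSequences A) f) (hg : IsPureMono (splitSequences A) g) :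
    IsPureMono (splitSequences A) (f ≫ g) := by
  obtain ⟨U, p, hp, ⟨⟨r, s, fr, sp, e⟩⟩⟩ := hf
  obtain ⟨V, q, hq, ⟨⟨r', s', fr', sp', e'⟩⟩⟩ := hg
  dsimp only at *
  have sr' : s' ≫ r' = 0 := (ShortComplex.Splitting.mk (S := ShortComplex.mk g q hq) r' s').s_r
  refine ⟨U ⊞ V, biprod.lift (r' ≫ p) q, ?_, ⟨⟨r' ≫ r, biprod.desc (s ≫ g) s', ?_, ?_, ?_⟩⟩⟩
  · ext <;> simp [reassoc_of% fr', hp, hq]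
  · simp [reassoc_of% fr', fr]
  · ext <;> simp [reassoc_of% fr', reassoc_of% sr', hq, sp, sp']
  · dsimp only
    have h : p ≫ s = 𝟙 Y - r ≫ f := by rw [← e]; abel
    rw [biprod.lift_desc, ← e', Category.assoc r' p, ← Category.assoc p, h]
    simp only [Preadditive.sub_comp, Preadditive.comp_sub, Category.assoc, Category.id_comp]
    abel

/-- If `f ≫ g` is the inclusion of a direct summand and `g` is the projection onto one, with kernel
`a`, then `f` is the inclusion of a direct summand, too. A complement is the direct sum of the kernel
of `g` with a complement of `f ≫ g`. -/
theorem isPureMono_split_of_comp {X Y Z : A} {f : X ⟶ Y} {g : Y ⟶ Z}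
    (hg : IsPureEpi (splitSequences A) g) (hfg : IsPureMono (splitSequences A) (f ≫ g)) :
    IsPureMono (splitSequences A) f := by
  obtain ⟨K, a, ha, ⟨σ⟩⟩ := hg
  obtain ⟨D, q, hq, ⟨τ⟩⟩ := hfg
  have sr := σ.s_r
  have vt := τ.s_r
  obtain ⟨r, s, ar, sg, e⟩ := σ
  obtain ⟨t, v, ft, vq, e'⟩ := τ
  dsimp only at *
  simp only [Category.assoc] at *
  have hq' : f ≫ g ≫ q = 0 := by simpa using hq
  refine ⟨K ⊞ D, biprod.lift (r - g ≫ t ≫ f ≫ r) (g ≫ q), ?_,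
    ⟨⟨g ≫ t, biprod.desc a (v ≫ s), ?_, ?_, ?_⟩⟩⟩
  · ext
    · simp [reassoc_of% ft]
    · simp [hq']
  · simpa using ft
  · ext <;> simp [reassoc_of% ha, ar, sr, reassoc_of% sg, reassoc_of% vt, vq]
  · dsimp only
    rw [biprod.lift_desc]
    have h₁ : r ≫ a = 𝟙 Y - g ≫ s := by rw [← e]; abel
    have h₂ : q ≫ v ≫ s = s - t ≫ f ≫ g ≫ s := by
      rw [← Category.assoc, show q ≫ v = 𝟙 Z - t ≫ f ≫ g by rw [← e']; abel]
      simp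
    simp only [Preadditive.sub_comp, Preadditive.comp_sub, Category.assoc, h₁, h₂,
      Category.comp_id]
    abel

end

/-- In the situation of `isPureMono_split_of_comp`, the kernel of `g` maps to a direct summand of the
cokernel of `f`. -/
theorem isPureMono_split_kernel_cokernel {X Y Z K B : A} {f : X ⟶ Y} {g : Y ⟶ Z} {a : K ⟶ Y}
    {b : Y ⟶ B} {ha : a ≫ g = 0} {hb : f ≫ b = 0} (σ : (ShortComplex.mk a g ha).Splitting)
    (ρ : (ShortComplex.mk f b hb).Splitting) (hfg : IsPureMono (splitSequences A) (f ≫ g)) :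
    IsPureMono (splitSequences A) (a ≫ b) := by
  obtain ⟨D, q, hq, ⟨τ⟩⟩ := hfg
  have sr := σ.s_r
  have vt := τ.s_r
  obtain ⟨r, s, ar, sg, e⟩ := σ
  obtain ⟨t, v, ft, vq, e'⟩ := τ
  obtain ⟨r', w, fr', wb, e''⟩ := ρ
  dsimp only at *
  simp only [Category.assoc] at *
  have hq' : f ≫ g ≫ q = 0 := by simpa using hq
  have bw : b ≫ w = 𝟙 Y - r' ≫ f := by rw [← e'']; abel
  have bw' : ∀ {T : A} (x : Y ⟶ T), b ≫ w ≫ x = x - r' ≫ f ≫ x := fun x => by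
    rw [← Category.assoc, bw]; simp
  refine ⟨D, w ≫ g ≫ q, ?_, ⟨⟨w ≫ (r - g ≫ t ≫ f ≫ r), v ≫ s ≫ b, ?_, ?_, ?_⟩⟩⟩
  · simp [bw', hq', reassoc_of% ha]
  · simp [bw', ar, reassoc_of% ha, reassoc_of% ft]
  · simp [bw', hq', reassoc_of% sg, vq]
  · dsimp only
    have h₁ : ∀ {T : A} (x : Y ⟶ T), r ≫ a ≫ x = x - g ≫ s ≫ x := fun x => by
      rw [← Category.assoc, show r ≫ a = 𝟙 Y - g ≫ s by rw [← e]; abel]; simp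
    have h₂ : ∀ {T : A} (x : Z ⟶ T), q ≫ v ≫ x = x - t ≫ f ≫ g ≫ x := fun x => by
      rw [← Category.assoc, show q ≫ v = 𝟙 Z - t ≫ f ≫ g by rw [← e']; abel]; simp
    simp [h₁, h₂, hb, wb]

end Split

section PointwiseSplit

variable {E : Type u} [Category.{v} E] [Preadditive E] {A : Type*} [Category* A]
    [Preadditive A] {Ξ : Type w} (ev : Ξ → E ⥤ A) [∀ ξ, (ev ξ).PreservesZeroMorphisms]

theorem IsPureMono.map {X Y : E} {f : X ⟶ Y} (hf : IsPureMono (PointwiseSplit ev) f) (ξ : Ξ) :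
    IsPureMono (splitSequences A) ((ev ξ).map f) := by
  obtain ⟨Z, g, h, hS⟩ := hf
  exact ⟨_, (ev ξ).map g, by rw [← Functor.map_comp, h, Functor.map_zero], hS ξ⟩

theorem IsPureEpi.map {X Y : E} {f : X ⟶ Y} (hf : IsPureEpi (PointwiseSplit ev) f) (ξ : Ξ) :
    IsPureEpi (splitSequences A) ((ev ξ).map f) := by
  obtain ⟨Z, g, h, hS⟩ := hf
  exact ⟨_, (ev ξ).map g, by rw [← Functor.map_comp, h, Functor.map_zero], hS ξ⟩

/-- A criterion for the pointwise split short exact sequences to define an exact structure: it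
suffices that kernels and cokernels can be formed pointwise. The remaining axioms are then reduced
to the split short exact sequences. -/
theorem isExactCategory_pointwiseSplit [HasBinaryBiproducts A] [∀ ξ, (ev ξ).Additive]
    (hE : HasFiniteBiproducts E)
    (hker : ∀ s, PointwiseSplit ev s → Nonempty (IsLimit (KernelFork.ofι s.f s.zero)))
    (hcoker : ∀ s, PointwiseSplit ev s → Nonempty (IsColimit (CokernelCofork.ofπ s.g s.zero)))
    (hmono : ∀ ⦃X Y : E⦄ (f : X ⟶ Y), (∀ ξ, IsPureMono (splitSequences A) ((ev ξ).map f)) →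
      IsPureMono (PointwiseSplit ev) f)
    (hepi : ∀ ⦃X Y : E⦄ (f : X ⟶ Y), (∀ ξ, IsPureEpi (splitSequences A) ((ev ξ).map f)) →
      IsPureEpi (PointwiseSplit ev) f) :
    IsExactCategory (PointwiseSplit ev) where
  hasFiniteBiproducts := hE
  closed_under_iso := ⟨fun {s t} e hs ξ =>
    ⟨(hs ξ).some.ofIso ((ev ξ).mapShortComplex.mapIso e)⟩⟩
  isKernel := hker
  isCokernel := hcoker
  ex1 s hs := ⟨_, _, s.zero, fun ξ => ⟨hs.some.map (ev ξ)⟩⟩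
  ex1_op s hs := ⟨_, _, s.zero, fun ξ => ⟨hs.some.map (ev ξ)⟩⟩
  ex2 X Y Z f g hf hg := hmono _ fun ξ => by
    rw [Functor.map_comp]
    exact isPureMono_split_comp (hf.map ev ξ) (hg.map ev ξ)
  ex2_op X Y Z f g hf hg := hepi _ fun ξ => by
    rw [Functor.map_comp]
    exact isPureEpi_of_op (by
      rw [op_comp]
      exact isPureMono_split_comp (isPureMono_op (hg.map ev ξ)) (isPureMono_op (hf.map ev ξ)))
  ex3 X Y Z f g hg hfg := by
    have hfg' : ∀ ξ, IsPureMono (splitSequences A) ((ev ξ).map f ≫ (ev ξ).map g) := fun ξ => by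
      rw [← Functor.map_comp]
      exact hfg.map ev ξ
    obtain ⟨B, b, hb, hB⟩ := hmono f fun ξ => isPureMono_split_of_comp (hg.map ev ξ) (hfg' ξ)
    obtain ⟨K, a, ha, hK⟩ := hg
    refine ⟨K, B, a, b, hb, ha, hB, hK, hmono _ fun ξ => ?_⟩
    rw [Functor.map_comp]
    exact isPureMono_split_kernel_cokernel (hK ξ).some (hB ξ).some (hfg' ξ)
  ex3_op X Y Z f g hf hfg := by
    have hfg' : ∀ ξ, IsPureMono (splitSequences Aᵒᵖ) (((ev ξ).map g).op ≫ ((ev ξ).map f).op) :=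
      fun ξ => by
        rw [← op_comp, ← Functor.map_comp]
        exact isPureMono_op (hfg.map ev ξ)
    obtain ⟨K, a, ha, hK⟩ := hepi g fun ξ =>
      isPureEpi_of_op (isPureMono_split_of_comp (isPureEpi_op (hf.map ev ξ)) (hfg' ξ))
    obtain ⟨B, b, hb, hB⟩ := hf
    refine ⟨K, B, a, b, hb, ha, hB, hK, hepi _ fun ξ => ?_⟩
    rw [Functor.map_comp]
    refine isPureEpi_of_op ?_
    rw [op_comp]
    exact isPureMono_split_kernel_cokernel (hB ξ).some.op (hK ξ).some.op (hfg' ξ)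

end PointwiseSplit

/-! ### Pretriangles via exact sequences -/

section Exactness

variable {P : Type} [PartialOrder P] {T : P ≃o P}
variable {C : Type u} [Category.{v} C] [Preadditive C]

/-- A diagram on the strip has zeroes on the two boundaries. -/
structure VanishesOnBoundary (X : Strip T ⥤ C) : Prop where
  isZero_bot : ∀ x : Strip T, x.top = x.bot → IsZero (X.obj x)
  isZero_top : ∀ x : Strip T, x.top = T x.bot → IsZero (X.obj x)

/-- A diagram morphism whose source and target are too far apart factors over the boundary. -/
theorem VanishesOnBoundary.map_eq_zero {X : Strip T ⥤ C} (hX : VanishesOnBoundary X)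
    {x y : Strip T} (f : x ⟶ y) (h : x.top ≤ y.bot ∨ T x.bot ≤ y.top) : X.map f = 0 := by
  have key : ∀ z : Strip T, IsZero (X.obj z) → x ≤ z → z ≤ y → X.map f = 0 := by
    intro z hz hxz hzy
    rw [Subsingleton.elim f (homOfLE hxz ≫ homOfLE hzy), X.map_comp,
      hz.eq_of_tgt (X.map (homOfLE hxz)) 0, zero_comp]
  have hxy : x ≤ y := leOfHom f
  rcases h with h | h
  · exact key ⟨x.top, x.top, le_rfl, x.top_le.trans (T.monotone x.bot_le_top)⟩
      (hX.isZero_bot _ rfl) ⟨x.bot_le_top, le_rfl⟩ ⟨h, hxy.2⟩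
  · exact key ⟨x.bot, T x.bot, x.bot_le_top.trans x.top_le, le_rfl⟩
      (hX.isZero_top _ rfl) ⟨le_rfl, x.top_le⟩ ⟨hxy.1, h⟩

/-- The long exact sequences of a pretriangle, i.e. for `α ≤ β ≤ γ ≤ α⁺¹` the exactness of
`β/α ⟶ γ/α ⟶ γ/β` and of `γ/α ⟶ γ/β ⟶ α⁺¹/β` at the respective middle term. -/
structure HasLongExactSequences (X : Strip T ⥤ C) : Prop extends VanishesOnBoundary X where
  exact₁ : ∀ {x y z : Strip T} (f : x ⟶ y) (g : y ⟶ z), x.bot = y.bot → x.top = z.bot →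
    y.top = z.top → IsWeakKernel (X.map f) (X.map g)
  exact₂ : ∀ {x y z : Strip T} (f : x ⟶ y) (g : y ⟶ z), x.top = y.top → y.bot = z.bot →
    z.top = T x.bot → IsWeakKernel (X.map f) (X.map g)

/-- Conversely to `IsPretriangle.hasLongExactSequences`, the weak squares of a pretriangle are
obtained from the exact sequences by a diagram chase. -/
theorem HasLongExactSequences.isPretriangle [HasFiniteBiproducts C] {X : Strip T ⥤ C}
    (hX : HasLongExactSequences X) : IsPretriangle X where
  isZero_bot := hX.isZero_bot
  isZero_top := hX.isZero_top
  isWeakSquare α β γ δ hαβ hβγ hγδ hδα := by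
    intro x y y' z hxy hxy' hyz hyz'
    have : HasBinaryBiproducts C := hasBinaryBiproducts_of_finite_biproducts C
    let v : Strip T := ⟨α, β, hαβ, (hβγ.trans hγδ).trans hδα⟩
    let u : Strip T := ⟨β, T α, (hβγ.trans hγδ).trans hδα, T.monotone hαβ⟩
    have hvx : v ≤ x := ⟨le_rfl, hβγ⟩
    have hzu : z ≤ u := ⟨le_rfl, hδα⟩
    refine ⟨?_, fun S t ht => ?_⟩
    · rw [biprod.lift_desc, Preadditive.comp_neg, ← X.map_comp, ← X.map_comp]
      exact (sub_eq_add_neg _ _).symm.trans (sub_self _)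
    · have h₀ : t ≫ biprod.fst ≫ X.map (homOfLE hyz) = t ≫ biprod.snd ≫ X.map (homOfLE hyz') := by
        rw [← sub_eq_zero, ← ht, biprod.desc_eq]
        simp [sub_eq_add_neg]
      obtain ⟨a, ha⟩ := (hX.exact₂ (homOfLE hxy') (homOfLE (hyz'.trans hzu)) rfl rfl rfl).2
        (t ≫ biprod.snd) (by
          rw [← homOfLE_comp hyz' hzu, X.map_comp, Category.assoc, ← reassoc_of% h₀, ← X.map_comp,
            hX.map_eq_zero _ (Or.inr le_rfl), comp_zero, comp_zero])
      obtain ⟨b, hb⟩ := (hX.exact₁ (homOfLE (hvx.trans hxy)) (homOfLE hyz) rfl rfl rfl).2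
        (t ≫ biprod.fst - a ≫ X.map (homOfLE hxy)) (by
          rw [Preadditive.sub_comp, Category.assoc, Category.assoc, h₀, ← X.map_comp,
            ← Category.assoc, ← ha, Category.assoc, ← X.map_comp]
          exact sub_self _)
      refine ⟨a + b ≫ X.map (homOfLE hvx), ?_⟩
      ext
      · rw [Category.assoc, biprod.lift_fst, Preadditive.add_comp, Category.assoc, ← X.map_comp]
        exact (congrArg _ hb).trans (add_sub_cancel _ _)
      · rw [Category.assoc, biprod.lift_snd, Preadditive.add_comp, ha, Category.assoc,
          ← X.map_comp, hX.map_eq_zero _ (Or.inl le_rfl), comp_zero, add_zero]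

/-- Both kinds of exact sequences are weak squares in which one of the objects lies on the
boundary. -/
theorem IsPretriangle.hasLongExactSequences [HasFiniteBiproducts C] {X : Strip T ⥤ C}
    (hX : IsPretriangle X) : HasLongExactSequences X := by
  have : HasBinaryBiproducts C := hasBinaryBiproducts_of_finite_biproducts C
  have hX₀ : VanishesOnBoundary X := ⟨hX.isZero_bot, hX.isZero_top⟩
  refine ⟨hX₀, ?_, ?_⟩
  · rintro ⟨α, β, hαβ, -⟩ ⟨_, γ, -, hγα⟩ ⟨_, _, hβγ, -⟩ f g (rfl : α = _) (rfl : β = _)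
      (rfl : γ = _)
    refine ⟨?_, fun S t ht => ?_⟩
    · rw [← X.map_comp, hX₀.map_eq_zero _ (Or.inl le_rfl)]
    · obtain ⟨s, hs⟩ := (hX.isWeakSquare α β β γ hαβ le_rfl hβγ hγα).2 (biprod.lift t 0) (by
        rw [biprod.lift_desc, zero_comp, add_zero]
        exact ht)
      exact ⟨s, (by simpa using congrArg (· ≫ biprod.fst) hs :
        s ≫ X.map (homOfLE (leOfHom f)) = t)⟩
  · rintro ⟨α, γ, -, hγα⟩ ⟨β, _, hβγ, -⟩ ⟨_, _, -, -⟩ f g (rfl : γ = _) (rfl : β = _) rfl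
    refine ⟨?_, fun S t ht => ?_⟩
    · rw [← X.map_comp, hX₀.map_eq_zero _ (Or.inr le_rfl)]
    · obtain ⟨s, hs⟩ := (hX.isWeakSquare α β γ (T α) (leOfHom f).1 hβγ hγα le_rfl).2
        (biprod.lift 0 t) (by
          rw [biprod.lift_desc, zero_comp, zero_add, Preadditive.comp_neg, neg_eq_zero]
          exact ht)
      exact ⟨s, (by simpa using congrArg (· ≫ biprod.snd) hs :
        s ≫ X.map (homOfLE (leOfHom f)) = t)⟩

/-- For `α ≤ β ≤ γ ≤ δ ≤ α⁺¹`, the sequence `γ/β ⊕ δ/α ⟶ δ/β ⟶ α⁺¹/γ` is exact at `δ/β`. -/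
theorem HasLongExactSequences.exists_of_comp_eq_zero {X : Strip T ⥤ C}
    (hX : HasLongExactSequences X) {y y' z w : Strip T} (f : y ⟶ z) (f' : y' ⟶ z) (g : z ⟶ w)
    (h₁ : y.top = z.top) (h₂ : y'.bot = z.bot) (h₃ : w.bot = y'.top) (h₄ : w.top = T y.bot)
    {S : C} (t : S ⟶ X.obj z) (ht : t ≫ X.map g = 0) :
    ∃ (a : S ⟶ X.obj y) (b : S ⟶ X.obj y'), t = a ≫ X.map f + b ≫ X.map f' := by
  let m : Strip T := ⟨w.bot, z.top, h₃ ▸ (leOfHom f').2, z.top_le.trans (T.monotone (leOfHom g).1)⟩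
  have hzm : z ≤ m := ⟨(leOfHom g).1, le_rfl⟩
  have hmw : m ≤ w := ⟨le_rfl, (leOfHom g).2⟩
  obtain ⟨a, ha⟩ := (hX.exact₂ (f ≫ homOfLE hzm) (homOfLE hmw) h₁ rfl h₄).2
    (t ≫ X.map (homOfLE hzm)) (by
      rw [Category.assoc, ← X.map_comp, ← ht]
      rfl)
  obtain ⟨b, hb⟩ := (hX.exact₁ f' (homOfLE hzm) h₂ h₃.symm rfl).2 (t - a ≫ X.map f) (by
    rw [Preadditive.sub_comp, ← ha, X.map_comp, Category.assoc, sub_self])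
  exact ⟨a, b, by rw [hb, add_sub_cancel]⟩

section TwoOutOfThree

variable {F G H : Strip T ⥤ C} {f : F ⟶ G} {g : G ⟶ H} {hfg : ∀ x, f.app x ≫ g.app x = 0}

/-- Given a pointwise split short exact sequence of complexes `F ⟶ G ⟶ H`, exactness of `G` and,
one step to the left, of `H` implies exactness of `F`. -/
theorem isWeakKernel_of_right (σ : ∀ x, (ShortComplex.mk _ _ (hfg x)).Splitting)
    {w x y z : Strip T} (a : w ⟶ x) (b : x ⟶ y) (c : y ⟶ z) (hF : F.map b ≫ F.map c = 0)
    (hG₀ : G.map a ≫ G.map b = 0)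
    (hG : IsWeakKernel (G.map b) (G.map c)) (hH : IsWeakKernel (H.map a) (H.map b)) :
    IsWeakKernel (F.map b) (F.map c) := by
  refine ⟨hF, fun S t ht => ?_⟩
  obtain ⟨p, hp⟩ := hG.2 (t ≫ f.app y) (by
    rw [Category.assoc, ← f.naturality, reassoc_of% ht, zero_comp])
  obtain ⟨q, hq⟩ := hH.2 (p ≫ g.app x) (by
    rw [Category.assoc, ← g.naturality, reassoc_of% hp, hfg, comp_zero])
  have hs : ∀ v, (σ v).s ≫ g.app v = 𝟙 _ := fun v => (σ v).s_g
  obtain ⟨r, hr⟩ : ∃ r, r ≫ f.app x = p - q ≫ (σ w).s ≫ G.map a :=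
    ⟨(p - q ≫ (σ w).s ≫ G.map a) ≫ (σ x).r, by
      have := (σ x).r_f
      dsimp only at this
      rw [Category.assoc, this, Preadditive.comp_sub, Category.comp_id, sub_eq_self]
      simp [reassoc_of% hq, reassoc_of% hs]⟩
  refine ⟨r, ?_⟩
  have : Mono (f.app y) := (σ y).mono_f
  rw [← cancel_mono (f.app y), Category.assoc, f.naturality, reassoc_of% hr, ← hp]
  simp [hG₀]

/-- Given a pointwise split short exact sequence of complexes `F ⟶ G ⟶ H`, exactness of `G` and,
one step to the right, of `F` implies exactness of `H`. -/
theorem isWeakKernel_of_left (σ : ∀ x, (ShortComplex.mk _ _ (hfg x)).Splitting)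
    {w x y z : Strip T} (a : w ⟶ x) (b : x ⟶ y) (c : y ⟶ z) (hH : H.map a ≫ H.map b = 0)
    (hG₀ : G.map b ≫ G.map c = 0)
    (hG : IsWeakKernel (G.map a) (G.map b)) (hF : IsWeakKernel (F.map b) (F.map c)) :
    IsWeakKernel (H.map a) (H.map b) := by
  refine ⟨hH, fun S t ht => ?_⟩
  have hs : ∀ v, (σ v).s ≫ g.app v = 𝟙 _ := fun v => (σ v).s_g
  obtain ⟨r, hr⟩ : ∃ r, r ≫ f.app y = t ≫ (σ x).s ≫ G.map b :=
    ⟨(t ≫ (σ x).s ≫ G.map b) ≫ (σ y).r, by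
      have := (σ y).r_f
      dsimp only at this
      rw [Category.assoc, this, Preadditive.comp_sub, Category.comp_id, sub_eq_self]
      simp [reassoc_of% hs, reassoc_of% ht]⟩
  have : Mono (f.app z) := (σ z).mono_f
  obtain ⟨q, hq⟩ := hF.2 r (by
    rw [← cancel_mono (f.app z), Category.assoc, f.naturality, reassoc_of% hr, hG₀]
    simp)
  obtain ⟨p, hp⟩ := hG.2 (t ≫ (σ x).s - q ≫ f.app x) (by
    rw [Preadditive.sub_comp, Category.assoc, Category.assoc, ← f.naturality, reassoc_of% hq, hr,
      sub_self])
  refine ⟨p ≫ g.app w, ?_⟩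
  rw [Category.assoc, ← g.naturality, reassoc_of% hp]
  simp [hs, hfg]

theorem isWeakKernel_of_extension (σ : ∀ x, (ShortComplex.mk _ _ (hfg x)).Splitting)
    {x y z : Strip T} (b : x ⟶ y) (c : y ⟶ z) (hG : G.map b ≫ G.map c = 0)
    (hF : IsWeakKernel (F.map b) (F.map c)) (hH : IsWeakKernel (H.map b) (H.map c)) :
    IsWeakKernel (G.map b) (G.map c) := by
  refine ⟨hG, fun S t ht => ?_⟩
  have hs : ∀ v, (σ v).s ≫ g.app v = 𝟙 _ := fun v => (σ v).s_g
  obtain ⟨q, hq⟩ := hH.2 (t ≫ g.app y) (by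
    rw [Category.assoc, ← g.naturality, reassoc_of% ht, zero_comp])
  obtain ⟨r, hr⟩ : ∃ r, r ≫ f.app y = t - q ≫ (σ x).s ≫ G.map b :=
    ⟨(t - q ≫ (σ x).s ≫ G.map b) ≫ (σ y).r, by
      have := (σ y).r_f
      dsimp only at this
      rw [Category.assoc, this, Preadditive.comp_sub, Category.comp_id, sub_eq_self]
      simp [reassoc_of% hs, reassoc_of% hq]⟩
  have : Mono (f.app z) := (σ z).mono_f
  obtain ⟨p, hp⟩ := hF.2 r (by
    rw [← cancel_mono (f.app z), Category.assoc, f.naturality, reassoc_of% hr]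
    simp [ht, hG])
  exact ⟨p ≫ f.app x + q ≫ (σ x).s, by
    rw [Preadditive.add_comp, Category.assoc, ← f.naturality, reassoc_of% hp, hr, Category.assoc,
      sub_add_cancel]⟩

theorem HasLongExactSequences.of_right (σ : ∀ x, (ShortComplex.mk _ _ (hfg x)).Splitting)
    (hG : HasLongExactSequences G) (hH : HasLongExactSequences H) : HasLongExactSequences F := by
  have hF₀ : VanishesOnBoundary F := by
    have : ∀ x, Mono (f.app x) := fun x => (σ x).mono_f
    exact ⟨fun x hx => IsZero.of_mono (f.app x) (hG.isZero_bot x hx),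
      fun x hx => IsZero.of_mono (f.app x) (hG.isZero_top x hx)⟩
  refine ⟨hF₀, fun {x y z} b c h₁ h₂ h₃ => ?_, fun {x y z} b c h₁ h₂ h₃ => ?_⟩
  · let w : Strip T := ⟨T.symm y.top, x.top, by
      rw [OrderIso.symm_apply_le, h₂, h₃]
      exact z.top_le, by
      rw [OrderIso.apply_symm_apply]
      exact (leOfHom b).2⟩
    have hwx : w ≤ x := ⟨by
      rw [h₁]
      exact (OrderIso.symm_apply_le _).2 y.top_le, le_rfl⟩
    refine isWeakKernel_of_right σ (homOfLE hwx) b c ?_ ?_ (hG.exact₁ b c h₁ h₂ h₃)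
      (hH.exact₂ _ b rfl h₁ (by simp [w]))
    · rw [← F.map_comp, hF₀.map_eq_zero _ (Or.inl h₂.le)]
    · rw [← G.map_comp, hG.map_eq_zero _ (Or.inr (by simp [w]))]
  · let w : Strip T := ⟨x.bot, y.bot, (leOfHom b).1, (y.bot_le_top.trans h₁.ge).trans x.top_le⟩
    have hwx : w ≤ x := ⟨le_rfl, y.bot_le_top.trans h₁.ge⟩
    refine isWeakKernel_of_right σ (homOfLE hwx) b c ?_ ?_ (hG.exact₂ b c h₁ h₂ h₃)
      (hH.exact₁ _ b rfl rfl h₁)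
    · rw [← F.map_comp, hF₀.map_eq_zero _ (Or.inr h₃.ge)]
    · rw [← G.map_comp, hG.map_eq_zero _ (Or.inl le_rfl)]

theorem HasLongExactSequences.of_left (σ : ∀ x, (ShortComplex.mk _ _ (hfg x)).Splitting)
    (hF : HasLongExactSequences F) (hG : HasLongExactSequences G) : HasLongExactSequences H := by
  have hH₀ : VanishesOnBoundary H := by
    have : ∀ x, Epi (g.app x) := fun x => (σ x).epi_g
    exact ⟨fun x hx => IsZero.of_epi (g.app x) (hG.isZero_bot x hx),
      fun x hx => IsZero.of_epi (g.app x) (hG.isZero_top x hx)⟩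
  refine ⟨hH₀, fun {x y z} b c h₁ h₂ h₃ => ?_, fun {x y z} b c h₁ h₂ h₃ => ?_⟩
  · let w : Strip T := ⟨z.bot, T x.bot, by
      rw [← h₂]
      exact x.top_le, T.monotone (h₁.le.trans (leOfHom c).1)⟩
    have hzw : z ≤ w := ⟨le_rfl, h₃.ge.trans (y.top_le.trans (congrArg T h₁.symm).le)⟩
    refine isWeakKernel_of_left σ b c (homOfLE hzw) ?_ ?_ (hG.exact₁ b c h₁ h₂ h₃)
      (hF.exact₂ c _ h₃ rfl (by simp [w, h₁]))
    · rw [← H.map_comp, hH₀.map_eq_zero _ (Or.inl h₂.le)]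
    · rw [← G.map_comp, hG.map_eq_zero _ (Or.inr (by simp [w, h₁]))]
  · let w : Strip T := ⟨y.top, z.top, h₁ ▸ h₃ ▸ x.top_le,
      z.top_le.trans (T.monotone (h₂ ▸ y.bot_le_top))⟩
    have hzw : z ≤ w := ⟨h₂ ▸ y.bot_le_top, le_rfl⟩
    refine isWeakKernel_of_left σ b c (homOfLE hzw) ?_ ?_ (hG.exact₂ b c h₁ h₂ h₃)
      (hF.exact₁ c _ h₂ rfl rfl)
    · rw [← H.map_comp, hH₀.map_eq_zero _ (Or.inr h₃.ge)]
    · rw [← G.map_comp, hG.map_eq_zero _ (Or.inl le_rfl)]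

theorem HasLongExactSequences.of_extension (σ : ∀ x, (ShortComplex.mk _ _ (hfg x)).Splitting)
    (hF : HasLongExactSequences F) (hH : HasLongExactSequences H) : HasLongExactSequences G := by
  have key : ∀ x, IsZero (F.obj x) → IsZero (H.obj x) → IsZero (G.obj x) := fun x h h' => by
    rw [IsZero.iff_id_eq_zero]
    have e : (σ x).r ≫ f.app x + g.app x ≫ (σ x).s = 𝟙 (G.obj x) := (σ x).id
    rw [← e, h.eq_of_tgt (σ x).r 0, h'.eq_of_src (σ x).s 0, zero_comp, comp_zero, add_zero]
  have hG₀ : VanishesOnBoundary G :=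
    ⟨fun x hx => key x (hF.isZero_bot x hx) (hH.isZero_bot x hx),
      fun x hx => key x (hF.isZero_top x hx) (hH.isZero_top x hx)⟩
  refine ⟨hG₀, fun {x y z} b c h₁ h₂ h₃ => ?_, fun {x y z} b c h₁ h₂ h₃ => ?_⟩
  · exact isWeakKernel_of_extension σ b c
      (by rw [← G.map_comp, hG₀.map_eq_zero _ (Or.inl h₂.le)])
      (hF.exact₁ b c h₁ h₂ h₃) (hH.exact₁ b c h₁ h₂ h₃)
  · exact isWeakKernel_of_extension σ b c
      (by rw [← G.map_comp, hG₀.map_eq_zero _ (Or.inr h₃.ge)])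
      (hF.exact₂ b c h₁ h₂ h₃) (hH.exact₂ b c h₁ h₂ h₃)

end TwoOutOfThree

end Exactness

/-! ### The exact category of pretriangles -/

theorem hasFiniteBiproducts_of_binaryBicone {E : Type u} [Category.{v} E] [Preadditive E]
    (hz : ∃ Z : E, IsZero Z)
    (hb : ∀ X Y : E, ∃ b : BinaryBicone X Y, b.fst ≫ b.inl + b.snd ≫ b.inr = 𝟙 b.pt) :
    HasFiniteBiproducts E := by
  obtain ⟨Z, hZ⟩ := hz
  have := hZ.hasZeroObject
  have : HasBinaryBiproducts E := ⟨fun X Y => by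
    obtain ⟨b, hb⟩ := hb X Y
    exact HasBinaryBiproduct.mk ⟨b, isBinaryBilimitOfTotal b hb⟩⟩
  have : HasFiniteProducts E := hasFiniteProducts_of_has_binary_and_terminal
  exact HasFiniteBiproducts.of_hasFiniteProducts

section FunctorCategory

variable {J : Type w} [Category* J] {C : Type u} [Category.{v} C] [Preadditive C] {F G : J ⥤ C}

/-- Cokernels of pointwise split monomorphisms of diagrams can be formed pointwise. -/
theorem exists_pointwise_cokernel (f : F ⟶ G)
    (hf : ∀ x, IsPureMono (splitSequences C) (f.app x)) :
    ∃ (H : J ⥤ C) (g : G ⟶ H) (h : ∀ x, f.app x ≫ g.app x = 0),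
      ∀ x, Nonempty (ShortComplex.mk _ _ (h x)).Splitting := by
  choose Z g h σ using hf
  have hs : ∀ x, (σ x).some.s ≫ g x = 𝟙 (Z x) := fun x => (σ x).some.s_g
  have hr : ∀ {x y} (a : x ⟶ y), g x ≫ (σ x).some.s ≫ G.map a ≫ g y = G.map a ≫ g y := by
    intro x y a
    have e : g x ≫ (σ x).some.s = 𝟙 _ - (σ x).some.r ≫ f.app x := (σ x).some.g_s
    rw [← Category.assoc, e, Preadditive.sub_comp, Category.id_comp, Category.assoc,
      ← f.naturality_assoc, h, comp_zero, comp_zero, sub_zero]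
  let H : J ⥤ C :=
    { obj := Z
      map := fun {x y} a => (σ x).some.s ≫ G.map a ≫ g y
      map_id := fun x => by simp [hs]
      map_comp := fun {x y z} a b => by simp [hr] }
  exact ⟨H, { app := g, naturality := fun x y a => (hr a).symm }, h, σ⟩

/-- Kernels of pointwise split epimorphisms of diagrams can be formed pointwise. -/
theorem exists_pointwise_kernel (g : F ⟶ G)
    (hg : ∀ x, IsPureEpi (splitSequences C) (g.app x)) :
    ∃ (H : J ⥤ C) (f : H ⟶ F) (h : ∀ x, f.app x ≫ g.app x = 0),
      ∀ x, Nonempty (ShortComplex.mk _ _ (h x)).Splitting := by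
  choose Z f h σ using hg
  have hs : ∀ x, f x ≫ (σ x).some.r = 𝟙 (Z x) := fun x => (σ x).some.f_r
  have hr : ∀ {x y} (a : x ⟶ y), f x ≫ F.map a ≫ (σ y).some.r ≫ f y = f x ≫ F.map a := by
    intro x y a
    have e : (σ y).some.r ≫ f y = 𝟙 _ - g.app y ≫ (σ y).some.s := (σ y).some.r_f
    rw [e, Preadditive.comp_sub, Category.comp_id, Preadditive.comp_sub, g.naturality_assoc,
      reassoc_of% h, zero_comp, sub_zero]
  let H : J ⥤ C :=
    { obj := Z
      map := fun {x y} a => f x ≫ F.map a ≫ (σ y).some.r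
      map_id := fun x => by simp [hs]
      map_comp := fun {x y z} a b => by simp [reassoc_of% hr] }
  exact ⟨H, { app := f, naturality := fun x y a => by simp [H, hr] }, h, σ⟩

variable {H : J ⥤ C} {f : F ⟶ G} {g : G ⟶ H} {hfg : ∀ x, f.app x ≫ g.app x = 0}

theorem exists_lift_of_pointwise_splitting (σ : ∀ x, (ShortComplex.mk _ _ (hfg x)).Splitting)
    {K : J ⥤ C} (t : K ⟶ G) (ht : ∀ x, t.app x ≫ g.app x = 0) :
    ∃ t' : K ⟶ F, t' ≫ f = t := by
  have : ∀ x, Mono (f.app x) := fun x => (σ x).mono_f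
  have h : ∀ x, (t.app x ≫ (σ x).r) ≫ f.app x = t.app x := fun x => by
    have e : (σ x).r ≫ f.app x = 𝟙 _ - g.app x ≫ (σ x).s := (σ x).r_f
    rw [Category.assoc, e, Preadditive.comp_sub, reassoc_of% ht, zero_comp, sub_zero,
      Category.comp_id]
  refine ⟨{ app := fun x => t.app x ≫ (σ x).r, naturality := fun x y a => ?_ }, ?_⟩
  · rw [← cancel_mono (f.app y), Category.assoc, h, Category.assoc, f.naturality, ← Category.assoc,
      h, t.naturality]
  · ext x
    exact h x

theorem exists_desc_of_pointwise_splitting (σ : ∀ x, (ShortComplex.mk _ _ (hfg x)).Splitting)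
    {K : J ⥤ C} (t : G ⟶ K) (ht : ∀ x, f.app x ≫ t.app x = 0) :
    ∃ t' : H ⟶ K, g ≫ t' = t := by
  have : ∀ x, Epi (g.app x) := fun x => (σ x).epi_g
  have h : ∀ x, g.app x ≫ (σ x).s ≫ t.app x = t.app x := fun x => by
    have e : g.app x ≫ (σ x).s = 𝟙 _ - (σ x).r ≫ f.app x := (σ x).g_s
    rw [← Category.assoc, e, Preadditive.sub_comp, Category.assoc, ht, comp_zero, sub_zero,
      Category.id_comp]
  refine ⟨{ app := fun x => (σ x).s ≫ t.app x, naturality := fun x y a => ?_ }, ?_⟩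
  · rw [← cancel_epi (g.app x), ← g.naturality_assoc, h, ← Category.assoc (g.app x),
      ← Category.assoc,
      Category.assoc (g.app x), h, t.naturality]
  · ext x
    exact h x

end FunctorCategory

namespace Pretriangle

variable {P : Type} [PartialOrder P] {T : P ≃o P}
variable {C : Type u} [Category.{v} C] [Preadditive C] [HasFiniteBiproducts C]

theorem hasLongExactSequences (X : Pretriangle T C) : HasLongExactSequences X.obj :=
  X.property.hasLongExactSequences

instance (ξ : Strip T) : (ev (T := T) (C := C) ξ).Additive where
  map_add := rfl

theorem hasFiniteBiproducts : HasFiniteBiproducts (Pretriangle T C) := by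
  have := hasBinaryBiproducts_of_finite_biproducts C
  obtain ⟨Z, hZ⟩ := (inferInstance : HasZeroObject C)
  have hz : ∀ x : Strip T, IsZero (((Functor.const (Strip T)).obj Z).obj x) := fun _ => hZ
  refine hasFiniteBiproducts_of_binaryBicone
    ⟨⟨(Functor.const _).obj Z, HasLongExactSequences.isPretriangle
      ⟨⟨fun x _ => hz x, fun x _ => hz x⟩, fun {x y z} f g _ _ _ => ?_,
        fun {x y z} f g _ _ _ => ?_⟩⟩, ?_⟩
    fun X Y => ?_
  · exact ⟨(hz _).eq_of_tgt _ _, fun S t _ => ⟨0, (hz _).eq_of_tgt _ _⟩⟩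
  · exact ⟨(hz _).eq_of_tgt _ _, fun S t _ => ⟨0, (hz _).eq_of_tgt _ _⟩⟩
  · rw [IsZero.iff_id_eq_zero]
    ext x
    exact (hz x).eq_of_src _ _
  · have hZ : IsPretriangle (X.obj ⊞ Y.obj) := by
      refine (HasLongExactSequences.of_extension (f := (biprod.inl : X.obj ⟶ X.obj ⊞ Y.obj))
        (g := biprod.snd)
        (hfg := fun x => congrArg (fun t : X.obj ⟶ Y.obj => t.app x) biprod.inl_snd) (fun x =>
            { r := (biprod.fst : X.obj ⊞ Y.obj ⟶ X.obj).app x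
              s := (biprod.inr : Y.obj ⟶ X.obj ⊞ Y.obj).app x
              f_r := congrArg (fun t : X.obj ⟶ X.obj => t.app x) biprod.inl_fst
              s_g := congrArg (fun t : Y.obj ⟶ Y.obj => t.app x) biprod.inr_snd
              id := congrArg (fun t : X.obj ⊞ Y.obj ⟶ X.obj ⊞ Y.obj => t.app x) biprod.total })
        X.hasLongExactSequences Y.hasLongExactSequences).isPretriangle
    exact ⟨{  pt := ⟨_, hZ⟩
              fst := ObjectProperty.homMk biprod.fst
              snd := ObjectProperty.homMk biprod.snd
              inl := ObjectProperty.homMk biprod.inl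
              inr := ObjectProperty.homMk biprod.inr
              inl_fst := by ext1; exact biprod.inl_fst
              inl_snd := by ext1; exact biprod.inl_snd
              inr_fst := by ext1; exact biprod.inr_fst
              inr_snd := by ext1; exact biprod.inr_snd }, by ext1; exact biprod.total⟩

/-- The pointwise splittings of a pointwise split short exact sequence, on the underlying
diagrams. -/
noncomputable def splitting {s : ShortComplex (Pretriangle T C)} (hs : pure T C s) (x : Strip T) :
    (ShortComplex.mk (s.f.hom.app x) (s.g.hom.app x)
      (by rw [← NatTrans.comp_app, ← ObjectProperty.FullSubcategory.comp_hom, s.zero]; rfl)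
      ).Splitting :=
  (hs x).some

theorem exists_lift {s : ShortComplex (Pretriangle T C)} (hs : pure T C s) {K : Pretriangle T C}
    (t : K ⟶ s.X₂) (ht : t ≫ s.g = 0) : ∃ t' : K ⟶ s.X₁, t' ≫ s.f = t := by
  obtain ⟨t', h⟩ := exists_lift_of_pointwise_splitting (splitting hs) t.hom fun x => by
    rw [← NatTrans.comp_app, ← ObjectProperty.FullSubcategory.comp_hom, ht]; rfl
  exact ⟨ObjectProperty.homMk t', by ext1; exact h⟩

theorem exists_desc {s : ShortComplex (Pretriangle T C)} (hs : pure T C s) {K : Pretriangle T C}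
    (t : s.X₂ ⟶ K) (ht : s.f ≫ t = 0) : ∃ t' : s.X₃ ⟶ K, s.g ≫ t' = t := by
  obtain ⟨t', h⟩ := exists_desc_of_pointwise_splitting (splitting hs) t.hom fun x => by
    rw [← NatTrans.comp_app, ← ObjectProperty.FullSubcategory.comp_hom, ht]; rfl
  exact ⟨ObjectProperty.homMk t', by ext1; exact h⟩

theorem mono_f {s : ShortComplex (Pretriangle T C)} (hs : pure T C s) : Mono s.f := by
  have : ∀ x, Mono (s.f.hom.app x) := fun x => (splitting hs x).mono_f
  refine ⟨fun a b h => ?_⟩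
  ext x
  rw [← cancel_mono (s.f.hom.app x)]
  exact congrArg (fun t => t.hom.app x) h

theorem epi_g {s : ShortComplex (Pretriangle T C)} (hs : pure T C s) : Epi s.g := by
  have : ∀ x, Epi (s.g.hom.app x) := fun x => (splitting hs x).epi_g
  refine ⟨fun a b h => ?_⟩
  ext x
  rw [← cancel_epi (s.g.hom.app x)]
  exact congrArg (fun t => t.hom.app x) h

theorem isPureMono_of_pointwise {X Y : Pretriangle T C} (f : X ⟶ Y)
    (hf : ∀ x, IsPureMono (splitSequences C) (f.hom.app x)) : IsPureMono (pure T C) f := by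
  obtain ⟨H, g, h, σ⟩ := exists_pointwise_cokernel f.hom hf
  exact ⟨⟨H, (HasLongExactSequences.of_left (fun x => (σ x).some) X.hasLongExactSequences
    Y.hasLongExactSequences).isPretriangle⟩, ObjectProperty.homMk g,
    by ext x; exact h x, σ⟩

theorem isPureEpi_of_pointwise {X Y : Pretriangle T C} (g : X ⟶ Y)
    (hg : ∀ x, IsPureEpi (splitSequences C) (g.hom.app x)) : IsPureEpi (pure T C) g := by
  obtain ⟨H, f, h, σ⟩ := exists_pointwise_kernel g.hom hg
  exact ⟨⟨H, (HasLongExactSequences.of_right (fun x => (σ x).some) X.hasLongExactSequences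
    Y.hasLongExactSequences).isPretriangle⟩, ObjectProperty.homMk f,
    by ext x; exact h x, σ⟩

variable (T C) in
theorem isExactCategory : IsExactCategory (pure T C) := by
  have := hasBinaryBiproducts_of_finite_biproducts C
  refine isExactCategory_pointwiseSplit _ hasFiniteBiproducts (fun s hs => ?_) (fun s hs => ?_)
    (fun X Y f hf => isPureMono_of_pointwise f hf) (fun X Y f hf => isPureEpi_of_pointwise f hf)
  · have := mono_f hs
    exact ⟨KernelFork.IsLimit.ofι' _ _ fun t ht =>
      ⟨(exists_lift hs t ht).choose, (exists_lift hs t ht).choose_spec⟩⟩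
  · have := epi_g hs
    exact ⟨CokernelCofork.IsColimit.ofπ' _ _ fun t ht =>
      ⟨(exists_desc hs t ht).choose, (exists_desc hs t ht).choose_spec⟩⟩

end Pretriangle

/-! ### Sums of rectangles -/

section Corner

variable {n : ℕ}

theorem Strip.le_def {P : Type} [PartialOrder P] {T : P ≃o P} {x y : Strip T} :
    x ≤ y ↔ x.bot ≤ y.bot ∧ x.top ≤ y.top :=
  Iff.rfl

theorem periodShift_apply (a : ℤ) : periodShift n a = a + (n + 1) := rfl

/-- The upper right corner of the largest rectangle in the strip that has `x` as its lower left
corner and does not meet the boundary. If `x` lies on the boundary, then `¬ x ≤ corner x`. -/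
def corner (x : Strip (periodShift n)) : Strip (periodShift n) :=
  ⟨x.top - 1, x.bot + n, by have := x.top_le; rw [periodShift_apply] at this; omega, by
    have := x.bot_le_top; rw [periodShift_apply]; omega⟩

theorem corner_surjective : Function.Surjective (corner (n := n)) := fun y =>
  ⟨⟨y.top - n, y.bot + 1, by have := y.top_le; rw [periodShift_apply] at this; omega, by
    have := y.bot_le_top; rw [periodShift_apply]; omega⟩, by
    simp only [corner]
    ext <;> simp⟩

theorem le_corner_iff {x y : Strip (periodShift n)} :
    y ≤ corner x ↔ y.bot < x.top ∧ y.top < x.bot + (n + 1) := by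
  change y.bot ≤ x.top - 1 ∧ y.top ≤ x.bot + n ↔ _
  omega

instance (y : Strip (periodShift n)) :
    Finite { x : Strip (periodShift n) // x ≤ y ∧ y ≤ corner x } :=
  Finite.of_injective
    (β := Set.Icc (y.top - n) y.bot × Set.Icc (y.bot + 1) y.top)
    (fun x => (⟨x.1.bot, by
        have := (le_corner_iff.1 x.2.2).2
        exact ⟨by omega, x.2.1.1⟩⟩,
      ⟨x.1.top, by
        have := (le_corner_iff.1 x.2.2).1
        exact ⟨by omega, x.2.1.2⟩⟩))
    (fun x x' h => by
      exact Subtype.ext (Strip.ext (congrArg (fun p => p.1.1) h) (congrArg (fun p => p.2.1) h)))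

variable {C : Type u} [Category.{v} C] [Preadditive C]

theorem VanishesOnBoundary.map_eq_zero_of_not_le_corner {X : Strip (periodShift n) ⥤ C}
    (hX : VanishesOnBoundary X) {x y : Strip (periodShift n)} (f : x ⟶ y) (h : ¬ y ≤ corner x) :
    X.map f = 0 := by
  refine hX.map_eq_zero f ?_
  rw [le_corner_iff] at h
  rw [periodShift_apply]
  omega

theorem VanishesOnBoundary.isZero_of_not_le_corner {X : Strip (periodShift n) ⥤ C}
    (hX : VanishesOnBoundary X) {x : Strip (periodShift n)} (h : ¬ x ≤ corner x) :
    IsZero (X.obj x) := by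
  rw [IsZero.iff_id_eq_zero, ← X.map_id]
  exact hX.map_eq_zero_of_not_le_corner _ h

end Corner

section Biproduct

variable {C : Type u} [Category.{v} C] [Preadditive C] [HasFiniteBiproducts C]
  {J : Type*} [Finite J] (F : J → C) (i : J)

open Classical in
/-- The complement is the direct sum of the other summands. -/
theorem biproduct_total_subtype :
    biproduct.π F i ≫ biproduct.ι F i +
      biproduct.toSubtype F (· ≠ i) ≫ biproduct.fromSubtype F (· ≠ i) = 𝟙 (⨁ F) := by
  rw [biproduct.toSubtype_fromSubtype]
  refine biproduct.hom_ext _ _ fun j => ?_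
  rw [Preadditive.add_comp, biproduct.map_π, Category.assoc]
  by_cases hj : j = i
  · subst hj
    rw [biproduct.ι_π_self]
    simp
  · rw [biproduct.ι_π_ne _ (Ne.symm hj)]
    simp [hj]

theorem biproduct_ι_toSubtype : biproduct.ι F i ≫ biproduct.toSubtype F (· ≠ i) = 0 := by
  refine biproduct.hom_ext _ _ fun j => ?_
  rw [Category.assoc, biproduct.toSubtype_π]
  exact (biproduct.ι_π_ne F j.2.symm).trans zero_comp.symm

theorem biproduct_fromSubtype_π : biproduct.fromSubtype F (· ≠ i) ≫ biproduct.π F i = 0 := by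
  refine biproduct.hom_ext' _ _ fun j => ?_
  rw [← Category.assoc, biproduct.ι_fromSubtype]
  exact (biproduct.ι_π_ne F j.2).trans comp_zero.symm

theorem isPureMono_biproduct_ι : IsPureMono (splitSequences C) (biproduct.ι F i) :=
  ⟨_, _, biproduct_ι_toSubtype F i, ⟨⟨biproduct.π F i, biproduct.fromSubtype F _,
    biproduct.ι_π_self _ _, biproduct.fromSubtype_toSubtype _ _, biproduct_total_subtype F i⟩⟩⟩

theorem isPureEpi_biproduct_π : IsPureEpi (splitSequences C) (biproduct.π F i) :=
  ⟨_, _, biproduct_fromSubtype_π F i, ⟨⟨biproduct.toSubtype F _, biproduct.ι F i,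
    biproduct.fromSubtype_toSubtype _ _, biproduct.ι_π_self _ _,
    (add_comm _ _).trans (biproduct_total_subtype F i)⟩⟩⟩

end Biproduct

section RectangleSum

variable {n : ℕ} {C : Type u} [Category.{v} C] [Preadditive C] [HasFiniteBiproducts C]
  (A : Strip (periodShift n) → C)

namespace RectangleSum

/-- The entry at `y` of the sum of rectangles given by the family `A`, viz. the direct sum of those
`A x` for which `y` lies in the rectangle from `x` to `corner x`. -/
noncomputable abbrev obj (y : Strip (periodShift n)) : C :=
  ⨁ fun x : { x : Strip (periodShift n) // x ≤ y ∧ y ≤ corner x } => A x.1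

open Classical in
/-- The inclusion of `A x`, defined to be zero if `A x` does not occur at `y`. -/
noncomputable def inc (y x : Strip (periodShift n)) : A x ⟶ obj A y :=
  if h : x ≤ y ∧ y ≤ corner x then
    biproduct.ι (fun x : { x : Strip (periodShift n) // x ≤ y ∧ y ≤ corner x } => A x.1) ⟨x, h⟩
  else 0

open Classical in
/-- The projection to `A x`, defined to be zero if `A x` does not occur at `y`. -/
noncomputable def prj (y x : Strip (periodShift n)) : obj A y ⟶ A x :=
  if h : x ≤ y ∧ y ≤ corner x then
    biproduct.π (fun x : { x : Strip (periodShift n) // x ≤ y ∧ y ≤ corner x } => A x.1) ⟨x, h⟩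
  else 0

variable {A}

theorem inc_of_mem {y x : Strip (periodShift n)} (h : x ≤ y ∧ y ≤ corner x) :
    inc A y x = biproduct.ι
      (fun x : { x : Strip (periodShift n) // x ≤ y ∧ y ≤ corner x } => A x.1) ⟨x, h⟩ :=
  dif_pos h

theorem prj_of_mem {y x : Strip (periodShift n)} (h : x ≤ y ∧ y ≤ corner x) :
    prj A y x = biproduct.π
      (fun x : { x : Strip (periodShift n) // x ≤ y ∧ y ≤ corner x } => A x.1) ⟨x, h⟩ :=
  dif_pos h

theorem inc_of_not_mem {y x : Strip (periodShift n)} (h : ¬ (x ≤ y ∧ y ≤ corner x)) :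
    inc A y x = 0 :=
  dif_neg h

theorem prj_of_not_mem {y x : Strip (periodShift n)} (h : ¬ (x ≤ y ∧ y ≤ corner x)) :
    prj A y x = 0 :=
  dif_neg h

theorem hom_ext {y : Strip (periodShift n)} {Z : C} {u v : obj A y ⟶ Z}
    (h : ∀ x, x ≤ y ∧ y ≤ corner x → inc A y x ≫ u = inc A y x ≫ v) : u = v := by
  refine biproduct.hom_ext' _ _ fun x => ?_
  have := h x.1 x.2
  rwa [inc_of_mem x.2] at this

theorem hom_ext' {y : Strip (periodShift n)} {Z : C} {u v : Z ⟶ obj A y}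
    (h : ∀ x, x ≤ y ∧ y ≤ corner x → u ≫ prj A y x = v ≫ prj A y x) : u = v := by
  refine biproduct.hom_ext _ _ fun x => ?_
  have := h x.1 x.2
  rwa [prj_of_mem x.2] at this

theorem inc_prj {y x : Strip (periodShift n)} (h : x ≤ y ∧ y ≤ corner x) :
    inc A y x ≫ prj A y x = 𝟙 _ := by
  rw [inc_of_mem h, prj_of_mem h, biproduct.ι_π_self]

theorem inc_prj_ne {y x x' : Strip (periodShift n)} (h : x ≠ x') :
    inc A y x ≫ prj A y x' = 0 := by
  by_cases hx : x ≤ y ∧ y ≤ corner x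
  · by_cases hx' : x' ≤ y ∧ y ≤ corner x'
    · rw [inc_of_mem hx, prj_of_mem hx', biproduct.ι_π_ne _ (by simpa using h)]
    · rw [prj_of_not_mem hx', comp_zero]
  · rw [inc_of_not_mem hx, zero_comp]

/-- The morphism out of a sum of rectangles with given components. -/
noncomputable def desc {y : Strip (periodShift n)} {Z : C}
    (k : ∀ x, x ≤ y ∧ y ≤ corner x → (A x ⟶ Z)) : obj A y ⟶ Z :=
  biproduct.desc fun x => k x.1 x.2

/-- The morphism into a sum of rectangles with given components. -/
noncomputable def lift {y : Strip (periodShift n)} {Z : C}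
    (k : ∀ x, x ≤ y ∧ y ≤ corner x → (Z ⟶ A x)) : Z ⟶ obj A y :=
  biproduct.lift fun x => k x.1 x.2

theorem inc_desc {y x : Strip (periodShift n)} {Z : C}
    (k : ∀ x, x ≤ y ∧ y ≤ corner x → (A x ⟶ Z)) (h : x ≤ y ∧ y ≤ corner x) :
    inc A y x ≫ desc k = k x h := by
  rw [inc_of_mem h, desc, biproduct.ι_desc]

theorem inc_desc_assoc {y x : Strip (periodShift n)} {Z Z' : C}
    (k : ∀ x, x ≤ y ∧ y ≤ corner x → (A x ⟶ Z)) (h : x ≤ y ∧ y ≤ corner x) (u : Z ⟶ Z') :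
    inc A y x ≫ desc k ≫ u = k x h ≫ u := by
  rw [← Category.assoc, inc_desc k h]

theorem lift_prj {y x : Strip (periodShift n)} {Z : C}
    (k : ∀ x, x ≤ y ∧ y ≤ corner x → (Z ⟶ A x)) (h : x ≤ y ∧ y ≤ corner x) :
    lift k ≫ prj A y x = k x h := by
  rw [prj_of_mem h, lift, biproduct.lift_π]

variable (A) in
theorem isPureMono_inc {y x : Strip (periodShift n)} (h : x ≤ y ∧ y ≤ corner x) :
    IsPureMono (splitSequences C) (inc A y x) := by
  rw [inc_of_mem h]
  exact isPureMono_biproduct_ι _ _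

variable (A) in
theorem isPureEpi_prj {y x : Strip (periodShift n)} (h : x ≤ y ∧ y ≤ corner x) :
    IsPureEpi (splitSequences C) (prj A y x) := by
  rw [prj_of_mem h]
  exact isPureEpi_biproduct_π _ _

/-- The sum of the rectangles from `x` to `corner x` with constant value `A x`. -/
noncomputable abbrev diagram (A : Strip (periodShift n) → C) : Strip (periodShift n) ⥤ C where
  obj y := obj A y
  map {_ z} _ := desc fun x _ => inc A z x
  map_id y := hom_ext fun x h => by rw [inc_desc _ h, Category.comp_id]
  map_comp {y z w} f g := hom_ext fun x h => by
    rw [inc_desc _ h, inc_desc_assoc _ h]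
    by_cases hz : x ≤ z ∧ z ≤ corner x
    · rw [inc_desc _ hz]
    · rw [inc_of_not_mem hz, zero_comp, inc_of_not_mem]
      exact fun hw => hz ⟨h.1.trans (leOfHom f), (leOfHom g).trans hw.2⟩

theorem inc_map {y z x : Strip (periodShift n)} (f : y ⟶ z) (h : x ≤ y ∧ y ≤ corner x) :
    inc A y x ≫ (diagram A).map f = inc A z x :=
  inc_desc (fun x _ => inc A z x) h

theorem inc_map_assoc {y z x : Strip (periodShift n)} (f : y ⟶ z) (h : x ≤ y ∧ y ≤ corner x)
    {Z : C} (u : obj A z ⟶ Z) : inc A y x ≫ (diagram A).map f ≫ u = inc A z x ≫ u := by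
  rw [← Category.assoc, inc_map f h]

theorem map_prj {y z x : Strip (periodShift n)} (f : y ⟶ z) (h : x ≤ z ∧ z ≤ corner x) :
    (diagram A).map f ≫ prj A z x = prj A y x :=
  hom_ext fun x' h' => by
    rw [inc_map_assoc f h']
    rcases eq_or_ne x' x with rfl | hx
    · rw [inc_prj h, inc_prj h']
    · rw [inc_prj_ne hx, inc_prj_ne hx]

theorem isWeakKernel {x y z : Strip (periodShift n)} (f : x ⟶ y) (g : y ⟶ z)
    (h : ∀ a, a ≤ y ∧ y ≤ corner a → ((a ≤ x ∧ x ≤ corner a) ↔ ¬ (a ≤ z ∧ z ≤ corner a))) :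
    IsWeakKernel ((diagram A).map f) ((diagram A).map g) := by
  refine ⟨hom_ext fun a ha => ?_, fun S t ht => ?_⟩
  · rw [inc_map_assoc f ha, comp_zero]
    by_cases hy : a ≤ y ∧ y ≤ corner a
    · rw [inc_map g hy, inc_of_not_mem ((h a hy).1 ha)]
    · rw [inc_of_not_mem hy, zero_comp]
  · refine ⟨t ≫ desc fun a _ => inc A x a, hom_ext' fun a ha => ?_⟩
    rw [Category.assoc, Category.assoc, map_prj f ha]
    by_cases hx : a ≤ x ∧ x ≤ corner a
    · congr 1
      refine hom_ext fun b hb => ?_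
      rw [inc_desc_assoc _ hb]
      rcases eq_or_ne b a with rfl | hba
      · rw [inc_prj hx, inc_prj ha]
      · rw [inc_prj_ne hba, inc_prj_ne hba]
    · rw [prj_of_not_mem hx, comp_zero, comp_zero, ← map_prj g (by
        by_contra hz
        exact hx ((h a ha).2 hz)), reassoc_of% ht, zero_comp]

variable (A) in
theorem hasLongExactSequences : HasLongExactSequences (diagram A) := by
  have hz : ∀ y : Strip (periodShift n), (∀ x, ¬ (x ≤ y ∧ y ≤ corner x)) →
      IsZero ((diagram A).obj y) := fun y hy => by
    rw [IsZero.iff_id_eq_zero]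
    exact hom_ext fun x hx => (hy x hx).elim
  refine ⟨⟨fun y hy => hz y ?_, fun y hy => hz y ?_⟩, fun {x y z} f g h₁ h₂ h₃ =>
    isWeakKernel f g fun a => ?_, fun {x y z} f g h₁ h₂ h₃ => isWeakKernel f g fun a => ?_⟩
  · rintro x ⟨h, h'⟩
    rw [le_corner_iff] at h'
    have := h.2
    omega
  · rintro x ⟨h, h'⟩
    rw [le_corner_iff] at h'
    rw [periodShift_apply] at hy
    have := h.1
    omega
  · have := (Strip.le_def.1 (leOfHom f)).2
    have := (Strip.le_def.1 (leOfHom g)).1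
    simp only [le_corner_iff]
    simp only [Strip.le_def]
    omega
  · have := (Strip.le_def.1 (leOfHom f)).1
    have := (Strip.le_def.1 (leOfHom g)).2
    rw [periodShift_apply] at h₃
    simp only [le_corner_iff]
    simp only [Strip.le_def]
    omega

/-- The sum of rectangles as a pretriangle. -/
noncomputable abbrev pre (A : Strip (periodShift n) → C) : Pretriangle (periodShift n) C :=
  ⟨diagram A, (hasLongExactSequences A).isPretriangle⟩

/-- Every diagram morphism of a sum of rectangles is the projection to, followed by the inclusion of,
the common summands. In particular, it is von Neumann regular. -/
theorem exists_map_comp_map {y z : Strip (periodShift n)} (f : y ⟶ z) :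
    ∃ h : (diagram A).obj z ⟶ (diagram A).obj y,
      (diagram A).map f ≫ h ≫ (diagram A).map f = (diagram A).map f := by
  refine ⟨desc fun x _ => inc A y x, hom_ext fun x hx => ?_⟩
  rw [inc_map_assoc f hx, inc_map f hx]
  by_cases hz : x ≤ z ∧ z ≤ corner x
  · rw [inc_desc_assoc _ hz, inc_map f hx]
  · rw [inc_of_not_mem hz, zero_comp]

section UniversalProperties

variable {X Y Z : Strip (periodShift n) ⥤ C}

/-- A sum of rectangles is free: a morphism to a diagram that vanishes on the boundary is given by
its values on the lower left corners of the rectangles. -/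
noncomputable def fromDiagram (hY : VanishesOnBoundary Y) (k : ∀ x, A x ⟶ Y.obj x) :
    diagram A ⟶ Y where
  app _ := desc fun x hx => k x ≫ Y.map (homOfLE hx.1)
  naturality y z f := hom_ext fun x hx => by
    rw [inc_map_assoc f hx, inc_desc_assoc _ hx, Category.assoc, ← Y.map_comp]
    by_cases hz : x ≤ z ∧ z ≤ corner x
    · rw [inc_desc _ hz]
      rfl
    · rw [inc_of_not_mem hz, zero_comp, hY.map_eq_zero_of_not_le_corner, comp_zero]
      exact fun h => hz ⟨hx.1.trans (leOfHom f), h⟩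

/-- A sum of rectangles is cofree: a morphism from a diagram that vanishes on the boundary is given
by its values on the upper right corners of the rectangles. -/
noncomputable def toDiagram (hY : VanishesOnBoundary Y) (k : ∀ x, Y.obj (corner x) ⟶ A x) :
    Y ⟶ diagram A where
  app _ := lift fun x hx => Y.map (homOfLE hx.2) ≫ k x
  naturality y z f := hom_ext' fun x hx => by
    rw [Category.assoc, Category.assoc, lift_prj _ hx, map_prj f hx, ← Category.assoc, ← Y.map_comp]
    by_cases hy : x ≤ y ∧ y ≤ corner x
    · rw [lift_prj _ hy]
      rfl
    · rw [prj_of_not_mem hy, comp_zero, hY.map_eq_zero, zero_comp]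
      have h₁ : ¬ x ≤ y := fun h => hy ⟨h, (leOfHom f).trans hx.2⟩
      rw [Strip.le_def] at h₁
      simp only [corner, periodShift_apply]
      omega

theorem inc_fromDiagram (hY : VanishesOnBoundary Y) (k : ∀ x, A x ⟶ Y.obj x)
    {x y : Strip (periodShift n)} (h : x ≤ y ∧ y ≤ corner x) :
    inc A y x ≫ (fromDiagram hY k).app y = k x ≫ Y.map (homOfLE h.1) :=
  inc_desc (fun x hx => k x ≫ Y.map (homOfLE hx.1)) h

theorem toDiagram_prj (hY : VanishesOnBoundary Y) (k : ∀ x, Y.obj (corner x) ⟶ A x)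
    {x y : Strip (periodShift n)} (h : x ≤ y ∧ y ≤ corner x) :
    (toDiagram hY k).app y ≫ prj A y x = Y.map (homOfLE h.2) ≫ k x :=
  lift_prj (fun x hx => Y.map (homOfLE hx.2) ≫ k x) h

theorem inc_fromDiagram_self (hY : VanishesOnBoundary Y) (k : ∀ x, A x ⟶ Y.obj x)
    {x : Strip (periodShift n)} (h : x ≤ corner x) :
    inc A x x ≫ (fromDiagram hY k).app x = k x := by
  rw [inc_fromDiagram hY k ⟨le_rfl, h⟩]
  exact (congrArg _ (Y.map_id x)).trans (Category.comp_id _)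

theorem toDiagram_prj_corner (hY : VanishesOnBoundary Y) (k : ∀ x, Y.obj (corner x) ⟶ A x)
    {x : Strip (periodShift n)} (h : x ≤ corner x) :
    (toDiagram hY k).app (corner x) ≫ prj A (corner x) x = k x := by
  rw [toDiagram_prj hY k ⟨h, le_rfl⟩]
  exact (congrArg (· ≫ k x) (Y.map_id _)).trans (Category.id_comp _)

theorem fromDiagram_ext {u w : diagram A ⟶ Y}
    (h : ∀ x, x ≤ corner x → inc A x x ≫ u.app x = inc A x x ≫ w.app x) : u = w := by
  refine NatTrans.ext (funext fun y => ?_)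
  refine hom_ext (A := A) fun x hx => ?_
  have hx' : x ≤ x ∧ x ≤ corner x := ⟨le_rfl, hx.1.trans hx.2⟩
  rw [← inc_map (homOfLE hx.1) hx', Category.assoc, Category.assoc, u.naturality, w.naturality,
    reassoc_of% h x hx'.2]

theorem toDiagram_ext {u w : Y ⟶ diagram A}
    (h : ∀ x, x ≤ corner x →
      u.app (corner x) ≫ prj A (corner x) x = w.app (corner x) ≫ prj A (corner x) x) : u = w := by
  refine NatTrans.ext (funext fun y => ?_)
  refine hom_ext' (A := A) fun x hx => ?_
  have hx' : x ≤ corner x ∧ corner x ≤ corner x := ⟨hx.1.trans hx.2, le_rfl⟩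
  rw [← map_prj (homOfLE hx.2) hx', ← u.naturality_assoc, ← w.naturality_assoc, h x hx'.1]

end UniversalProperties

end RectangleSum

end RectangleSum

/-! ### Morphisms that are split in the Freyd category -/

section FreydSplit

variable {A : Type u} [Category.{v} A] [Preadditive A]

theorem freydRel_iff {x y : Arrow A} (f g : x ⟶ y) :
    freydRel A f g ↔ (f.left - g.left) ≫ y.hom = 0 := by
  constructor
  · rintro ⟨z, a, b, hz, h, -⟩
    rw [h, Category.assoc, Arrow.w b, hz, zero_comp, comp_zero]
  · intro h
    have h' : x.hom ≫ (f.right - g.right) = 0 := by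
      rw [← h, Preadditive.comp_sub, Preadditive.sub_comp, Arrow.w, Arrow.w]
    exact ⟨Arrow.mk (0 : x.left ⟶ y.right),
      Arrow.homMk (u := 𝟙 _) (v := f.right - g.right) (by simp [h']),
      Arrow.homMk (u := f.left - g.left) (v := 𝟙 _) (by simp [h]), rfl, by simp, by simp⟩

instance : Congruence (freydRel A) where
  equivalence :=
    ⟨fun f => by simp [freydRel_iff], fun {f g} h => by
      rw [freydRel_iff] at *
      rw [← neg_sub, Preadditive.neg_comp, h, neg_zero], fun {f g k} h h' => by
      rw [freydRel_iff] at *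
      rw [← sub_add_sub_cancel f.left g.left k.left, Preadditive.add_comp, h, h', add_zero]⟩
  comp_left := by
    intro X Y Z f g g' h
    rw [freydRel_iff] at *
    rw [Arrow.comp_left, Arrow.comp_left, ← Preadditive.comp_sub, Category.assoc, h, comp_zero]
  comp_right := by
    intro X Y Z f f' g h
    rw [freydRel_iff] at *
    rw [Arrow.comp_left, Arrow.comp_left, ← Preadditive.sub_comp, Category.assoc, Arrow.w,
      reassoc_of% h, zero_comp]

theorem freydEmbedding_map_eq_iff {X Y : A} (f g : X ⟶ Y) :
    (freydEmbedding A).map f = (freydEmbedding A).map g ↔ f = g := by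
  refine ⟨fun h => ?_, fun h => h ▸ rfl⟩
  have := (Quotient.functor_map_eq_iff (freydRel A) ((idArrow A).map f) ((idArrow A).map g)).1 h
  rw [freydRel_iff] at this
  rw [← sub_eq_zero, ← Category.comp_id (f - g)]
  exact this

theorem freydEmbedding_map_surjective {X Y : A}
    (f : (freydEmbedding A).obj X ⟶ (freydEmbedding A).obj Y) :
    ∃ g : X ⟶ Y, (freydEmbedding A).map g = f := by
  obtain ⟨f, rfl⟩ := (Quotient.functor (freydRel A)).map_surjective f
  refine ⟨f.left, congrArg (Quotient.functor (freydRel A)).map ?_⟩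
  have : f.left ≫ 𝟙 Y = 𝟙 X ≫ f.right := Arrow.w f
  ext
  · rfl
  · exact (Category.comp_id f.left).symm.trans (this.trans (Category.id_comp _))

/-- A morphism is split in the Freyd category if and only if it is von Neumann regular. The image of
an idempotent `e` in the Freyd category is given by `e` itself, considered as an object. -/
theorem isSplitInFreyd_iff {X Y : A} (f : X ⟶ Y) :
    IsSplitInFreyd f ↔ ∃ h : Y ⟶ X, f ≫ h ≫ f = f := by
  constructor
  · rintro ⟨Z, r, s, hr, hs, e⟩
    obtain ⟨h, hh⟩ := freydEmbedding_map_surjective (retraction s ≫ section_ r)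
    refine ⟨h, (freydEmbedding_map_eq_iff _ _).1 ?_⟩
    rw [Functor.map_comp, Functor.map_comp, hh, ← e]
    simp
  · rintro ⟨h, hh⟩
    -- `f` factors through the image of the idempotent `f ≫ h`.
    let e := f ≫ h
    have he : e ≫ e = e := by simp [e, reassoc_of% hh]
    have hef : e ≫ f = f := by simp [e, hh]
    let Q := Quotient.functor (freydRel A)
    let r : (idArrow A).obj X ⟶ Arrow.mk e := Arrow.homMk (u := 𝟙 X) (v := e) rfl
    let r' : Arrow.mk e ⟶ (idArrow A).obj X := Arrow.homMk (u := e) (v := 𝟙 X) rfl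
    let s : Arrow.mk e ⟶ (idArrow A).obj Y :=
      Arrow.homMk (u := f) (v := f) (by simp [idArrow, hef])
    let s' : (idArrow A).obj Y ⟶ Arrow.mk e :=
      Arrow.homMk (u := h) (v := h ≫ e) (by simp [idArrow])
    refine ⟨Q.obj (Arrow.mk e), Q.map r, Q.map s, ⟨⟨⟨Q.map r', ?_⟩⟩⟩, ⟨⟨⟨Q.map s', ?_⟩⟩⟩, ?_⟩
    · rw [← Functor.map_comp, ← CategoryTheory.Functor.map_id, Quotient.functor_map_eq_iff,
        freydRel_iff]
      change (e ≫ 𝟙 X - 𝟙 X) ≫ e = 0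
      rw [Category.comp_id, Preadditive.sub_comp, Category.id_comp, he, sub_self]
    · rw [← Functor.map_comp, ← CategoryTheory.Functor.map_id, Quotient.functor_map_eq_iff,
        freydRel_iff]
      change (f ≫ h - 𝟙 X) ≫ e = 0
      rw [Preadditive.sub_comp, Category.id_comp, sub_eq_zero]
      exact he
    · rw [← Functor.map_comp]
      congr 1
      ext
      · exact Category.id_comp f
      · exact hef

end FreydSplit

/-! ### Bijective pretriangles -/

/-- A retract of a von Neumann regular morphism is von Neumann regular. -/
theorem exists_regular_of_retract {A : Type u} [Category.{v} A] {X Y X' Y' : A} {f : X ⟶ Y}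
    {g : X' ⟶ Y'} (i : X ⟶ X') (p : X' ⟶ X)
    (i' : Y ⟶ Y') (p' : Y' ⟶ Y) (hip : i ≫ p = 𝟙 X) (hi : i ≫ g = f ≫ i')
    (hp : g ≫ p' = p ≫ f) (hg : ∃ h, g ≫ h ≫ g = g) : ∃ h, f ≫ h ≫ f = f := by
  obtain ⟨h, hh⟩ := hg
  refine ⟨i' ≫ h ≫ p, ?_⟩
  simp only [Category.assoc]
  rw [← hp, ← reassoc_of% hi, reassoc_of% hh, hp, reassoc_of% hip]

section SplitSections

variable {A : Type u} [Category.{v} A] [Preadditive A]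

/-- A retraction of the inclusion of a direct summand with a complement is a projection to a direct
summand with a complement. -/
theorem isPureEpi_split_of_section {X Y : A} {i : X ⟶ Y} {g : Y ⟶ X}
    (hi : IsPureMono (splitSequences A) i) (hig : i ≫ g = 𝟙 X) :
    IsPureEpi (splitSequences A) g := by
  obtain ⟨Z, p, hp, ⟨σ⟩⟩ := hi
  have hr : p ≫ σ.s = 𝟙 _ - σ.r ≫ i := σ.g_s
  have hs : σ.s ≫ p = 𝟙 _ := σ.s_g
  refine ⟨Z, σ.s - σ.s ≫ g ≫ i, ?_, ⟨⟨p, i, ?_, hig, ?_⟩⟩⟩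
  · simp [hig]
  · simp [hs, hp]
  · dsimp only
    rw [Preadditive.comp_sub, ← Category.assoc p, hr]
    simp [reassoc_of% hig]

theorem isPureMono_split_of_retraction {X Y : A} {i : X ⟶ Y} {g : Y ⟶ X}
    (hg : IsPureEpi (splitSequences A) g) (hig : i ≫ g = 𝟙 X) :
    IsPureMono (splitSequences A) i :=
  isPureMono_of_op (isPureEpi_split_of_section (isPureMono_op hg) (by rw [← op_comp, hig]; rfl))

theorem isPureEpi_split_of_isZero {X Y : A} (hY : IsZero Y) (g : X ⟶ Y) :
    IsPureEpi (splitSequences A) g :=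
  ⟨X, 𝟙 X, hY.eq_of_tgt _ _, ⟨⟨𝟙 X, 0, by simp, hY.eq_of_src _ _, by
    dsimp only
    rw [comp_zero, add_zero, Category.comp_id]⟩⟩⟩

theorem isPureMono_split_of_isZero {X Y : A} (hX : IsZero X) (g : X ⟶ Y) :
    IsPureMono (splitSequences A) g :=
  ⟨Y, 𝟙 Y, hX.eq_of_src _ _, ⟨⟨0, 𝟙 Y, hX.eq_of_src _ _, by simp, by
    dsimp only
    rw [zero_comp, zero_add, Category.comp_id]⟩⟩⟩

end SplitSections

section Bijective

variable {n : ℕ} {C : Type u} [Category.{v} C] [Preadditive C]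

namespace RectangleSum

section Resolutions

variable [HasFiniteBiproducts C] {X : Strip (periodShift n) ⥤ C} (hX : VanishesOnBoundary X)

/-- The canonical morphism to `X` from the sum of the rectangles with values `X.obj x`. -/
noncomputable abbrev counit : diagram (fun x => X.obj x) ⟶ X :=
  fromDiagram hX fun x => 𝟙 (X.obj x)

/-- The canonical morphism from `X` to the sum of the rectangles with values `X.obj (corner x)`. -/
noncomputable abbrev unit : X ⟶ diagram (fun x => X.obj (corner x)) :=
  toDiagram hX fun x => 𝟙 (X.obj (corner x))

theorem isPureEpi_counit_app (y : Strip (periodShift n)) :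
    IsPureEpi (splitSequences C) ((counit hX).app y) := by
  by_cases hy : y ≤ corner y
  · exact isPureEpi_split_of_section (isPureMono_inc _ ⟨le_rfl, hy⟩) (inc_fromDiagram_self hX _ hy)
  · exact isPureEpi_split_of_isZero (hX.isZero_of_not_le_corner hy) _

theorem isPureMono_unit_app (y : Strip (periodShift n)) :
    IsPureMono (splitSequences C) ((unit hX).app y) := by
  obtain ⟨x, rfl⟩ := corner_surjective y
  by_cases hx : x ≤ corner x
  · exact isPureMono_split_of_retraction (isPureEpi_prj _ ⟨hx, le_rfl⟩)
      (toDiagram_prj_corner hX _ hx)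
  · refine isPureMono_split_of_isZero (hX.isZero_of_not_le_corner fun h => hx ?_) _
    rw [le_corner_iff] at h ⊢
    simp only [corner] at h
    omega

end Resolutions

variable [HasFiniteBiproducts C] {A : Strip (periodShift n) → C} {Y Z : Strip (periodShift n) ⥤ C}

theorem fromDiagram_comp (hY : VanishesOnBoundary Y) (g : Y ⟶ Z) (f : diagram A ⟶ Z)
    (k : ∀ x, A x ⟶ Y.obj x) (hk : ∀ x, k x ≫ g.app x = inc A x x ≫ f.app x) :
    fromDiagram hY k ≫ g = f :=
  fromDiagram_ext fun x hx => by
    rw [← hk, NatTrans.comp_app, ← Category.assoc, inc_fromDiagram_self hY k hx]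

theorem comp_toDiagram (hZ : VanishesOnBoundary Z) (g : Y ⟶ Z) (f : Y ⟶ diagram A)
    (k : ∀ x, Z.obj (corner x) ⟶ A x)
    (hk : ∀ x, g.app (corner x) ≫ k x = f.app (corner x) ≫ prj A (corner x) x) :
    g ≫ toDiagram hZ k = f :=
  toDiagram_ext fun x hx => by
    rw [← hk, NatTrans.comp_app, Category.assoc, toDiagram_prj_corner hZ k hx]

end RectangleSum

section Nilpotent

variable {X : Strip (periodShift n) ⥤ C}

/-- If an endomorphism `q` vanishes on the images of all `x ⟶ corner x`, then it factors locally
through the diagram morphisms that end at `x`. Iterating `q`, it thus factors through increasingly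
longer diagram morphisms, and these eventually vanish. -/
theorem HasLongExactSequences.map_comp_pow_eq_zero (hX : HasLongExactSequences X) (q : End X)
    (hq : ∀ x (h : x ≤ corner x), q.app x ≫ X.map (homOfLE h) = 0) (k : ℕ)
    {x y : Strip (periodShift n)} (f : x ⟶ y)
    (hk : (x.top - 1 - y.bot) + (x.bot + n - y.top) < k) :
    X.map f ≫ (q ^ k : End X).app y = 0 := by
  induction k generalizing x y with
  | zero =>
    rw [hX.map_eq_zero_of_not_le_corner f, zero_comp]
    rw [le_corner_iff]
    omega
  | succ k ih =>
    by_cases hy : y ≤ corner x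
    · have hx : x ≤ corner x := (leOfHom f).trans hy
      have hx' := le_corner_iff.1 hx
      let x₁ : Strip (periodShift n) := ⟨x.bot - 1, x.top, by have := x.bot_le_top; omega, by
        rw [periodShift_apply]; omega⟩
      let x₂ : Strip (periodShift n) := ⟨x.bot, x.top - 1, by omega, by
        rw [periodShift_apply]; omega⟩
      have h₁ : x₁ ≤ x := ⟨by simp [x₁], le_rfl⟩
      have h₂ : x₂ ≤ x := ⟨le_rfl, by simp [x₂]⟩
      obtain ⟨a, b, hab⟩ := hX.exists_of_comp_eq_zero (homOfLE h₁) (homOfLE h₂) (homOfLE hx) rfl rfl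
        rfl (by simp only [corner, periodShift_apply, x₁]; ring) (q.app x) (hq x hx)
      have e : (q ^ (k + 1) : End X).app y = q.app y ≫ (q ^ k : End X).app y := by
        rw [pow_succ]
        rfl
      rw [e, q.naturality_assoc, hab, Preadditive.add_comp, Category.assoc, Category.assoc,
        ← X.map_comp_assoc, ← X.map_comp_assoc, ih _ (by simp only [x₁]; push_cast at hk; omega),
        ih _ (by simp only [x₂]; push_cast at hk; omega), comp_zero, comp_zero, add_zero]
    · rw [hX.map_eq_zero_of_not_le_corner f hy, zero_comp]

/-- An endomorphism that acts as the identity on the images of all `x ⟶ corner x` differs from the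
identity by a nilpotent endomorphism. -/
theorem HasLongExactSequences.isIso_of_comp_map (hX : HasLongExactSequences X) (c : End X)
    (hc : ∀ x (h : x ≤ corner x), c.app x ≫ X.map (homOfLE h) = X.map (homOfLE h)) : IsIso c := by
  have hq : (1 - c) ^ n = 0 := by
    refine NatTrans.ext (funext fun x => ?_)
    by_cases hx : x ≤ corner x
    · have h := hX.map_comp_pow_eq_zero (1 - c) (fun x h => ?_) n (𝟙 x) (by omega)
      · rwa [X.map_id, Category.id_comp] at h
      · change (𝟙 _ - c.app x) ≫ _ = 0
        rw [Preadditive.sub_comp, hc, Category.id_comp, sub_self]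
    · exact (hX.isZero_of_not_le_corner hx).eq_of_src _ _
  have : IsUnit c := by
    have := IsNilpotent.isUnit_one_sub ⟨n, hq⟩
    rwa [sub_sub_cancel] at this
  exact (isUnit_iff_isIso c).1 this

open RectangleSum in
/-- Mapping a pretriangle to the sum of its rectangles by means of quasi-inverses `h x` to its
diagram morphisms `x ⟶ corner x`, and back by the canonical morphism, is an isomorphism. -/
theorem HasLongExactSequences.isIso_toDiagram_comp_counit [HasFiniteBiproducts C]
    (hX : HasLongExactSequences X) (h : ∀ x, X.obj (corner x) ⟶ X.obj x)
    (hh : ∀ x (hx : x ≤ corner x),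
      X.map (homOfLE hx) ≫ h x ≫ X.map (homOfLE hx) = X.map (homOfLE hx)) :
    IsIso (toDiagram hX.toVanishesOnBoundary h ≫ counit hX.toVanishesOnBoundary) := by
  refine hX.isIso_of_comp_map _ fun x hx => ?_
  have e : (counit hX.toVanishesOnBoundary).app x ≫ X.map (homOfLE hx) =
      prj (fun x => X.obj x) x x ≫ X.map (homOfLE hx) := by
    -- The summand at `y` is mapped along `y ⟶ corner x`, which vanishes unless `y = x`.
    refine RectangleSum.hom_ext fun y hy => ?_
    rw [← Category.assoc, inc_fromDiagram hX.toVanishesOnBoundary _ hy, Category.id_comp,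
      ← X.map_comp, ← Category.assoc]
    rcases eq_or_ne y x with rfl | hyx
    · rw [inc_prj hy, Category.id_comp]
      rfl
    · rw [inc_prj_ne hyx, zero_comp]
      refine hX.map_eq_zero_of_not_le_corner _ fun hxy => hyx ?_
      obtain ⟨⟨h₁, h₂⟩, -⟩ := hy
      obtain ⟨h₃, h₄⟩ := hxy
      simp only [corner] at h₃ h₄
      ext <;> omega
  rw [NatTrans.comp_app, Category.assoc, e, ← Category.assoc,
    toDiagram_prj hX.toVanishesOnBoundary h ⟨le_rfl, hx⟩, Category.assoc, hh]

end Nilpotent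

end Bijective

section BijectivePretriangles

variable {n : ℕ} {C : Type u} [Category.{v} C] [Preadditive C] [HasFiniteBiproducts C]

open RectangleSum

theorem isSplitPretriangle_of_retract {X : Pretriangle (periodShift n) C}
    {A : Strip (periodShift n) → C} (i : X.obj ⟶ diagram A) (r : diagram A ⟶ X.obj)
    (hir : i ≫ r = 𝟙 X.obj) : IsSplitPretriangle (periodShift n) C X := fun x y f =>
  (isSplitInFreyd_iff _).2 (exists_regular_of_retract (i.app x) (r.app x) (i.app y) (r.app y)
    (congrArg (fun t : X.obj ⟶ X.obj => t.app x) hir) (i.naturality f).symm (r.naturality f)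
    (exists_map_comp_map f))

namespace Pretriangle

theorem vanishesOnBoundary (X : Pretriangle (periodShift n) C) : VanishesOnBoundary X.obj :=
  X.hasLongExactSequences.toVanishesOnBoundary

/-- Lifts to, and extensions from, sums of rectangles can be chosen summand by summand, where the
pointwise splittings provide them. -/
theorem isBijective_pre (A : Strip (periodShift n) → C) :
    IsBijective (pure (periodShift n) C) (RectangleSum.pre A) := by
  refine ⟨fun Y Z g hg f => ?_, fun Y Z g hg f => ?_⟩
  · have := fun x => hg.map _ x
    choose K κ hκ σ using this
    refine ⟨ObjectProperty.homMk (fromDiagram Y.vanishesOnBoundary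
      fun x => (inc A x x ≫ f.hom.app x) ≫ (σ x).some.s), ?_⟩
    ext1
    refine fromDiagram_comp Y.vanishesOnBoundary g.hom f.hom _ fun x => ?_
    have : (σ x).some.s ≫ g.hom.app x = 𝟙 _ := (σ x).some.s_g
    exact (Category.assoc _ _ _).trans ((congrArg _ this).trans (Category.comp_id _))
  · have := fun x => hg.map _ x
    choose K κ hκ σ using this
    refine ⟨ObjectProperty.homMk (toDiagram Z.vanishesOnBoundary
      fun x => (σ (corner x)).some.r ≫ f.hom.app (corner x) ≫ prj A (corner x) x), ?_⟩
    ext1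
    refine comp_toDiagram Z.vanishesOnBoundary g.hom f.hom _ fun x => ?_
    have : g.hom.app (corner x) ≫ (σ (corner x)).some.r = 𝟙 _ := (σ (corner x)).some.f_r
    rw [reassoc_of% this]

variable (n C) in
theorem isFrobeniusCategory : IsFrobeniusCategory (pure (periodShift n) C) where
  isExactCategory := isExactCategory _ _
  isSufficientlyBig X :=
    ⟨⟨_, ObjectProperty.homMk (X := RectangleSum.pre _) (counit X.vanishesOnBoundary),
      isBijective_pre _, isPureEpi_of_pointwise _ (isPureEpi_counit_app X.vanishesOnBoundary)⟩,
    ⟨_, ObjectProperty.homMk (Y := RectangleSum.pre _) (unit X.vanishesOnBoundary),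
      isBijective_pre _, isPureMono_of_pointwise _ (isPureMono_unit_app X.vanishesOnBoundary)⟩⟩

variable (n C) in
theorem isBijective_eq :
    IsBijective (pure (periodShift n) C) = IsSplitPretriangle (periodShift n) C := by
  ext X
  constructor
  · intro hX
    obtain ⟨r, hr⟩ := hX.2 (ObjectProperty.homMk (Y := RectangleSum.pre _)
      (unit X.vanishesOnBoundary))
      (isPureMono_of_pointwise _ (isPureMono_unit_app X.vanishesOnBoundary)) (𝟙 X)
    exact isSplitPretriangle_of_retract (unit X.vanishesOnBoundary) r.hom
      (congrArg (fun t => t.hom) hr)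
  · intro hX
    choose h hh using fun x (hx : x ≤ corner x) => (isSplitInFreyd_iff _).1 (hX (homOfLE hx))
    classical
    have := X.hasLongExactSequences.isIso_toDiagram_comp_counit
      (fun x => if hx : x ≤ corner x then h x hx else 0) (fun x hx => by rw [dif_pos hx, hh])
    refine (isBijective_pre _).of_retract (ObjectProperty.homMk (Y := RectangleSum.pre _)
      (toDiagram X.vanishesOnBoundary fun x => if hx : x ≤ corner x then h x hx else 0))
      (ObjectProperty.homMk (counit X.vanishesOnBoundary ≫
        inv (toDiagram X.vanishesOnBoundary (fun x => if hx : x ≤ corner x then h x hx else 0) ≫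
          counit X.vanishesOnBoundary))) ?_
    ext1
    change toDiagram X.vanishesOnBoundary _ ≫ counit X.vanishesOnBoundary ≫ inv _ = 𝟙 X.obj
    rw [← Category.assoc, IsIso.hom_inv_id]

end Pretriangle

end BijectivePretriangles

/-! ### Periodicity up to isomorphism -/

section Equivariant

variable {P : Type} [PartialOrder P] {T : P ≃o P} {C : Type u} [Category.{v} C]
  {Sh : IsoCat C C}

instance (Sh : IsoCat C C) : Sh.functor.IsEquivalence :=
  Sh.toEquivalence.isEquivalence_functor

/-- A periodic structure on a diagram: it identifies the diagram obtained by applying the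
automorphism entrywise with the shifted diagram. A periodic pretriangle carries such a structure with
identities as components. -/
abbrev PeriodicStructure (Sh : IsoCat C C) (W : Strip T ⥤ C) :=
  W ⋙ Sh.functor ≅ Strip.shift T ⋙ W

/-- A morphism of diagrams is equivariant if it is compatible with given periodic structures. -/
def Equivariant {W W' : Strip T ⥤ C} (φ : PeriodicStructure Sh W) (φ' : PeriodicStructure Sh W')
    (f : W ⟶ W') : Prop :=
  ∀ x, Sh.functor.map (f.app x) ≫ φ'.hom.app x = φ.hom.app x ≫ f.app ((Strip.shift T).obj x)

namespace Equivariant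

variable {W W' W'' : Strip T ⥤ C} {φ : PeriodicStructure Sh W} {φ' : PeriodicStructure Sh W'}
  {φ'' : PeriodicStructure Sh W''}

theorem comp {f : W ⟶ W'} {g : W' ⟶ W''} (hf : Equivariant φ φ' f) (hg : Equivariant φ' φ'' g) :
    Equivariant φ φ'' (f ≫ g) := fun x => by
  rw [NatTrans.comp_app, NatTrans.comp_app, Functor.map_comp, Category.assoc, hg x,
    ← Category.assoc, hf x, Category.assoc]

theorem of_comp_mono {f : W ⟶ W'} {g : W' ⟶ W''} (hfg : Equivariant φ φ'' (f ≫ g))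
    (hg : Equivariant φ' φ'' g) (h : ∀ x, Mono (g.app x)) : Equivariant φ φ' f := fun x => by
  have := h ((Strip.shift T).obj x)
  rw [← cancel_mono (g.app ((Strip.shift T).obj x)), Category.assoc, ← hg x, Category.assoc,
    ← NatTrans.comp_app, ← hfg x, NatTrans.comp_app, Functor.map_comp, Category.assoc]

theorem of_epi_comp {f : W ⟶ W'} {g : W' ⟶ W''} (hfg : Equivariant φ φ'' (f ≫ g))
    (hf : Equivariant φ φ' f) (h : ∀ x, Epi (f.app x)) : Equivariant φ' φ'' g := fun x => by
  have := h x
  rw [← cancel_epi (Sh.functor.map (f.app x)), ← Category.assoc, ← Functor.map_comp,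
    ← NatTrans.comp_app, hfg x, ← Category.assoc, hf x, Category.assoc, NatTrans.comp_app]

theorem inv {e : W ≅ W'} (h : Equivariant φ φ' e.hom) : Equivariant φ' φ e.inv :=
  of_comp_mono (φ'' := φ') (by rw [e.inv_hom_id]; intro x; simp) h inferInstance

end Equivariant

end Equivariant

section Strictification

variable {n : ℕ} {C : Type u} [Category.{v} C]

/-- The shift as a permutation of the strip. -/
noncomputable def shiftPerm (n : ℕ) : Strip (periodShift n) ≃ Strip (periodShift n) where
  toFun := (Strip.shift (periodShift n)).obj
  invFun x := ⟨x.top - (n + 1), x.bot, by have := x.top_le; rw [periodShift_apply] at this; omega, by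
    have := x.bot_le_top; rw [periodShift_apply]; omega⟩
  left_inv x := Strip.ext (add_sub_cancel_right x.bot ((n : ℤ) + 1)) rfl
  right_inv x := Strip.ext rfl (sub_add_cancel x.top ((n : ℤ) + 1))

/-- Dependent choice along the orbits of the shift. The level of `x` is the rounded down quotient of
`x.bot + x.top` by `n + 1`, which the shift increases by one. -/
theorem exists_shiftFamily {α : Strip (periodShift n) → Type*}
    (R : ∀ x, α x → α ((Strip.shift _).obj x) → Prop) (up : ∀ x a, ∃ b, R x a b)
    (down : ∀ x b, ∃ a, R x a b) (a₀ : ∀ x, α x) :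
    ∃ a : ∀ x, α x, ∀ x, R x (a x) (a ((Strip.shift _).obj x)) := by
  have level : ∀ x : Strip (periodShift n),
      ((shiftPerm n x).bot + (shiftPerm n x).top) / ((n : ℤ) + 1) =
        (x.bot + x.top) / ((n : ℤ) + 1) + 1 := fun x => by
    have : (shiftPerm n x).bot + (shiftPerm n x).top = x.bot + x.top + (n + 1) := by
      change x.top + (x.bot + (n + 1)) = _
      ring
    rw [this, Int.add_ediv_of_dvd_right (dvd_refl _), Int.ediv_self (by omega)]
  obtain ⟨a, -, ha⟩ := exists_orbitFamily (shiftPerm n)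
    (fun x => (x.bot + x.top) / ((n : ℤ) + 1)) R level up down fun x _ => a₀ x
  exact ⟨a, ha⟩

variable {Sh : IsoCat C C}

/-- Every diagram with a periodic structure is isomorphic to a strictly periodic diagram. Its entries
can be chosen freely in a fundamental domain of the shift; the others are then determined, up to
equality, by applying the automorphism and its inverse. -/
theorem exists_strictification {W : Strip (periodShift n) ⥤ C} (φ : PeriodicStructure Sh W) :
    ∃ (X : Strip (periodShift n) ⥤ C) (hX : X ⋙ Sh.functor = Strip.shift _ ⋙ X) (e : X ≅ W),
      Equivariant (eqToIso hX) φ e.hom := by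
  have up : ∀ (x : Strip (periodShift n)) (a : Σ O : C, O ≅ W.obj x),
      ∃ b : (Σ O : C, O ≅ W.obj ((Strip.shift _).obj x)), ∃ h : Sh.functor.obj a.1 = b.1,
        Sh.functor.mapIso a.2 ≪≫ φ.app x = eqToIso h ≪≫ b.2 :=
    fun x a => ⟨⟨_, Sh.functor.mapIso a.2 ≪≫ φ.app x⟩, rfl, (Iso.refl_trans _).symm⟩
  have down : ∀ (x : Strip (periodShift n)) (b : Σ O : C, O ≅ W.obj ((Strip.shift _).obj x)),
      ∃ a : (Σ O : C, O ≅ W.obj x), ∃ h : Sh.functor.obj a.1 = b.1,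
        Sh.functor.mapIso a.2 ≪≫ φ.app x = eqToIso h ≪≫ b.2 := by
    rintro x ⟨O, θ⟩
    have h : Sh.functor.obj (Sh.inverse.obj O) = O :=
      Functor.congr_obj Sh.counit_eq O
    exact ⟨⟨_, Sh.functor.preimageIso (eqToIso h ≪≫ θ ≪≫ (φ.app x).symm)⟩, h, by
      ext; simp⟩
  -- Each entry is chosen together with an isomorphism to the entry of `W`; along the orbits, the
  -- entries are related by equalities, the isomorphisms by means of `φ`.
  obtain ⟨a, ha⟩ := exists_shiftFamily _ up down fun x => ⟨_, Iso.refl (W.obj x)⟩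
  choose h hh using ha
  have h₁ : ∀ x, Sh.functor.map (a x).2.hom ≫ φ.hom.app x =
      eqToHom (h x) ≫ (a ((Strip.shift _).obj x)).2.hom := fun x => congrArg Iso.hom (hh x)
  have h₂ : ∀ x, φ.inv.app x ≫ Sh.functor.map (a x).2.inv =
      (a ((Strip.shift _).obj x)).2.inv ≫ eqToHom (h x).symm := fun x => congrArg Iso.inv (hh x)
  let X : Strip (periodShift n) ⥤ C :=
    { obj := fun x => (a x).1
      map := fun {x y} f => (a x).2.hom ≫ W.map f ≫ (a y).2.inv }
  have hX : X ⋙ Sh.functor = Strip.shift _ ⋙ X := by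
    refine CategoryTheory.Functor.ext h fun x y f => ?_
    have e : Sh.functor.map (W.map f) =
        φ.hom.app x ≫ W.map ((Strip.shift _).map f) ≫ φ.inv.app y := by
      have := φ.hom.naturality f
      rw [Functor.comp_map, Functor.comp_map] at this
      rw [← reassoc_of% this, Iso.hom_inv_id_app]
      exact (Category.comp_id _).symm
    change Sh.functor.map ((a x).2.hom ≫ W.map f ≫ (a y).2.inv) = eqToHom _ ≫
      ((a ((Strip.shift _).obj x)).2.hom ≫ W.map ((Strip.shift _).map f) ≫
        (a ((Strip.shift _).obj y)).2.inv) ≫ eqToHom _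
    rw [Functor.map_comp, Functor.map_comp, e]
    simp only [Category.assoc]
    rw [h₂, reassoc_of% h₁]
  refine ⟨X, hX, NatIso.ofComponents fun x => (a x).2, fun x => ?_⟩
  simp only [eqToIso.hom, eqToHom_app]
  exact h₁ x

/-- Families of morphisms that satisfy a shift-invariant condition can be chosen to be periodic. -/
theorem exists_periodicFamily {A B : Strip (periodShift n) → C}
    (ψ : ∀ x, Sh.functor.obj (A x) ≅ A ((Strip.shift _).obj x))
    (ω : ∀ x, Sh.functor.obj (B x) ≅ B ((Strip.shift _).obj x)) (Q : ∀ x, (A x ⟶ B x) → Prop)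
    (hQ : ∀ x k k', Sh.functor.map k ≫ (ω x).hom = (ψ x).hom ≫ k' → (Q x k ↔ Q _ k'))
    (hne : ∀ x, ∃ k, Q x k) :
    ∃ k : ∀ x, A x ⟶ B x, (∀ x, Q x (k x)) ∧
      ∀ x, Sh.functor.map (k x) ≫ (ω x).hom = (ψ x).hom ≫ k ((Strip.shift _).obj x) := by
  have up : ∀ (x : Strip (periodShift n)) (k : { k // Q x k }),
      ∃ k' : { k // Q ((Strip.shift _).obj x) k },
        Sh.functor.map k.1 ≫ (ω x).hom = (ψ x).hom ≫ k'.1 := fun x k => by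
    have h : Sh.functor.map k.1 ≫ (ω x).hom =
      (ψ x).hom ≫ (ψ x).inv ≫ Sh.functor.map k.1 ≫ (ω x).hom := by simp
    exact ⟨⟨_, (hQ x k.1 _ h).1 k.2⟩, h⟩
  have down : ∀ (x : Strip (periodShift n)) (k' : { k // Q ((Strip.shift _).obj x) k }),
      ∃ k : { k // Q x k }, Sh.functor.map k.1 ≫ (ω x).hom = (ψ x).hom ≫ k'.1 := fun x k' => by
    have h : Sh.functor.map (Sh.functor.preimage ((ψ x).hom ≫ k'.1 ≫ (ω x).inv)) ≫ (ω x).hom =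
      (ψ x).hom ≫ k'.1 := by
        rw [Functor.map_preimage, Category.assoc, Category.assoc, Iso.inv_hom_id, Category.comp_id]
    exact ⟨⟨_, (hQ x _ k'.1 h).2 k'.2⟩, h⟩
  obtain ⟨k, hk⟩ := exists_shiftFamily _ up down
    fun x => ⟨(hne x).choose, (hne x).choose_spec⟩
  exact ⟨fun x => (k x).1, fun x => (k x).2, hk⟩

end Strictification

/-! ### The exact category of periodic pretriangles -/

theorem HasLongExactSequences.of_iso {P : Type} [PartialOrder P] {T : P ≃o P} {C : Type u}
    [Category.{v} C] [Preadditive C] {X Y : Strip T ⥤ C} (hX : HasLongExactSequences X)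
    (e : Y ≅ X) : HasLongExactSequences Y := by
  have key : ∀ {x y z : Strip T} (f : x ⟶ y) (g : y ⟶ z), IsWeakKernel (X.map f) (X.map g) →
      IsWeakKernel (Y.map f) (Y.map g) := fun {x y z} f g h => by
    refine ⟨?_, fun S t ht => ?_⟩
    · rw [← cancel_mono (e.hom.app z), Category.assoc, e.hom.naturality, e.hom.naturality_assoc,
        h.1, comp_zero, zero_comp]
    · obtain ⟨t', ht'⟩ := h.2 (t ≫ e.hom.app y) (by
        rw [Category.assoc, ← e.hom.naturality, ← Category.assoc, ht, zero_comp])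
      refine ⟨t' ≫ e.inv.app x, ?_⟩
      rw [Category.assoc, ← e.inv.naturality, ← Category.assoc, ht', Category.assoc,
        Iso.hom_inv_id_app, Category.comp_id]
  exact ⟨⟨fun x hx => (hX.isZero_bot x hx).of_iso (e.app x),
    fun x hx => (hX.isZero_top x hx).of_iso (e.app x)⟩,
    fun {x y z} f g h₁ h₂ h₃ => key f g (hX.exact₁ f g h₁ h₂ h₃),
    fun {x y z} f g h₁ h₂ h₃ => key f g (hX.exact₂ f g h₁ h₂ h₃)⟩

section Splittings

variable {P : Type} [PartialOrder P] {T : P ≃o P} {C : Type u} [Category.{v} C] [Preadditive C]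
  {Sh : IsoCat C C} {F G H : Strip T ⥤ C} {f : F ⟶ G} {g : G ⟶ H}
  {hfg : ∀ x, f.app x ≫ g.app x = 0}

/-- A pointwise cokernel of an equivariant morphism inherits a periodic structure. -/
theorem exists_periodicStructure_cokernel [Sh.functor.Additive]
    (σ : ∀ x, (ShortComplex.mk _ _ (hfg x)).Splitting) {φ : PeriodicStructure Sh F}
    {φ' : PeriodicStructure Sh G} (hf : Equivariant φ φ' f) :
    ∃ φ'' : PeriodicStructure Sh H, Equivariant φ' φ'' g := by
  have hε : ∀ x, Epi (g.app x) := fun x => (σ x).epi_g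
  obtain ⟨a, ha⟩ := exists_desc_of_pointwise_splitting
    (f := Functor.whiskerRight f Sh.functor) (g := Functor.whiskerRight g Sh.functor)
    (fun x => (σ x).map Sh.functor) (φ'.hom ≫ Functor.whiskerLeft (Strip.shift T) g) fun x => by
      change Sh.functor.map (f.app x) ≫ φ'.hom.app x ≫ g.app _ = 0
      rw [← Category.assoc, hf x, Category.assoc, hfg, comp_zero]
  obtain ⟨b, hb⟩ := exists_desc_of_pointwise_splitting
    (f := Functor.whiskerLeft (Strip.shift T) f) (g := Functor.whiskerLeft (Strip.shift T) g)
    (fun x => σ ((Strip.shift T).obj x)) (φ'.inv ≫ Functor.whiskerRight g Sh.functor) fun x => by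
      change f.app _ ≫ φ'.inv.app x ≫ Sh.functor.map (g.app x) = 0
      have : f.app ((Strip.shift T).obj x) ≫ φ'.inv.app x =
          φ.inv.app x ≫ Sh.functor.map (f.app x) := by
        have := hf x
        rw [← cancel_epi (φ.hom.app x), ← reassoc_of% this]
        simp
      rw [reassoc_of% this, ← Functor.map_comp, hfg, Functor.map_zero, comp_zero]
  have ha' : ∀ x, Sh.functor.map (g.app x) ≫ a.app x = φ'.hom.app x ≫ g.app _ := fun x =>
    congrArg (fun t : G ⋙ Sh.functor ⟶ Strip.shift T ⋙ H => t.app x) ha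
  have hb' : ∀ x, g.app _ ≫ b.app x = φ'.inv.app x ≫ Sh.functor.map (g.app x) := fun x =>
    congrArg (fun t : Strip.shift T ⋙ G ⟶ H ⋙ Sh.functor => t.app x) hb
  refine ⟨⟨a, b, NatTrans.ext (funext fun x => ?_), NatTrans.ext (funext fun x => ?_)⟩, ha'⟩
  · have := hε x
    rw [← cancel_epi (Sh.functor.map (g.app x)), NatTrans.comp_app, reassoc_of% ha', hb',
      Iso.hom_inv_id_app_assoc]
    exact (Category.comp_id _).symm
  · have := hε ((Strip.shift T).obj x)
    rw [← cancel_epi (g.app ((Strip.shift T).obj x)), NatTrans.comp_app, reassoc_of% hb', ha',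
      Iso.inv_hom_id_app_assoc]
    exact (Category.comp_id _).symm

/-- A pointwise kernel of an equivariant morphism inherits a periodic structure. -/
theorem exists_periodicStructure_kernel [Sh.functor.Additive]
    (σ : ∀ x, (ShortComplex.mk _ _ (hfg x)).Splitting) {φ' : PeriodicStructure Sh G}
    {φ'' : PeriodicStructure Sh H} (hg : Equivariant φ' φ'' g) :
    ∃ φ : PeriodicStructure Sh F, Equivariant φ φ' f := by
  have hμ : ∀ x, Mono (f.app x) := fun x => (σ x).mono_f
  obtain ⟨a, ha⟩ := exists_lift_of_pointwise_splitting
    (f := Functor.whiskerLeft (Strip.shift T) f) (g := Functor.whiskerLeft (Strip.shift T) g)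
    (fun x => σ ((Strip.shift T).obj x)) (Functor.whiskerRight f Sh.functor ≫ φ'.hom) fun x => by
      change (Sh.functor.map (f.app x) ≫ φ'.hom.app x) ≫ g.app _ = 0
      rw [Category.assoc, ← hg x, ← Category.assoc, ← Functor.map_comp, hfg, Functor.map_zero,
        zero_comp]
  obtain ⟨b, hb⟩ := exists_lift_of_pointwise_splitting
    (f := Functor.whiskerRight f Sh.functor) (g := Functor.whiskerRight g Sh.functor)
    (fun x => (σ x).map Sh.functor) (Functor.whiskerLeft (Strip.shift T) f ≫ φ'.inv) fun x => by
      change (f.app _ ≫ φ'.inv.app x) ≫ Sh.functor.map (g.app x) = 0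
      have : φ'.inv.app x ≫ Sh.functor.map (g.app x) = g.app _ ≫ φ''.inv.app x := by
        have := hg x
        rw [← cancel_mono (φ''.hom.app x), Category.assoc, this]
        simp
      rw [Category.assoc, this, reassoc_of% hfg, zero_comp]
  have ha' : ∀ x, a.app x ≫ f.app _ = Sh.functor.map (f.app x) ≫ φ'.hom.app x := fun x =>
    congrArg (fun t : F ⋙ Sh.functor ⟶ Strip.shift T ⋙ G => t.app x) ha
  have hb' : ∀ x, b.app x ≫ Sh.functor.map (f.app x) = f.app _ ≫ φ'.inv.app x := fun x =>
    congrArg (fun t : Strip.shift T ⋙ F ⟶ G ⋙ Sh.functor => t.app x) hb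
  refine ⟨⟨a, b, NatTrans.ext (funext fun x => ?_), NatTrans.ext (funext fun x => ?_)⟩,
    fun x => (ha' x).symm⟩
  · have := hμ x
    rw [← cancel_mono (Sh.functor.map (f.app x)), NatTrans.comp_app, Category.assoc, hb',
      reassoc_of% ha', Iso.hom_inv_id_app]
    exact (Category.comp_id _).trans (Category.id_comp _).symm
  · have := hμ ((Strip.shift T).obj x)
    rw [← cancel_mono (f.app ((Strip.shift T).obj x)), NatTrans.comp_app, Category.assoc, ha',
      reassoc_of% hb', Iso.inv_hom_id_app]
    exact (Category.comp_id _).trans (Category.id_comp _).symm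

/-- A direct sum of diagrams with periodic structures inherits a periodic structure. -/
theorem exists_periodicStructure_biprod [Sh.functor.Additive] {i₁ : F ⟶ H} {p₁ : H ⟶ F}
    {i₂ : G ⟶ H} {p₂ : H ⟶ G} (h₁₁ : ∀ x, i₁.app x ≫ p₁.app x = 𝟙 _)
    (h₁₂ : ∀ x, i₁.app x ≫ p₂.app x = 0) (h₂₁ : ∀ x, i₂.app x ≫ p₁.app x = 0)
    (h₂₂ : ∀ x, i₂.app x ≫ p₂.app x = 𝟙 _)
    (total : ∀ x, p₁.app x ≫ i₁.app x + p₂.app x ≫ i₂.app x = 𝟙 _)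
    (φ : PeriodicStructure Sh F) (φ' : PeriodicStructure Sh G) :
    ∃ φ'' : PeriodicStructure Sh H, Equivariant φ φ'' i₁ ∧ Equivariant φ'' φ p₁ ∧
      Equivariant φ' φ'' i₂ ∧ Equivariant φ'' φ' p₂ := by
  let a : H ⋙ Sh.functor ⟶ Strip.shift T ⋙ H :=
    Functor.whiskerRight p₁ Sh.functor ≫ φ.hom ≫ Functor.whiskerLeft _ i₁ +
      Functor.whiskerRight p₂ Sh.functor ≫ φ'.hom ≫ Functor.whiskerLeft _ i₂
  let b : Strip.shift T ⋙ H ⟶ H ⋙ Sh.functor :=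
    Functor.whiskerLeft _ p₁ ≫ φ.inv ≫ Functor.whiskerRight i₁ Sh.functor +
      Functor.whiskerLeft _ p₂ ≫ φ'.inv ≫ Functor.whiskerRight i₂ Sh.functor
  have ha : ∀ x, a.app x = Sh.functor.map (p₁.app x) ≫ φ.hom.app x ≫ i₁.app _ +
    Sh.functor.map (p₂.app x) ≫ φ'.hom.app x ≫ i₂.app _ := fun _ => rfl
  have hb : ∀ x, b.app x = p₁.app _ ≫ φ.inv.app x ≫ Sh.functor.map (i₁.app x) +
    p₂.app _ ≫ φ'.inv.app x ≫ Sh.functor.map (i₂.app x) := fun _ => rfl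
  refine ⟨⟨a, b, NatTrans.ext (funext fun x => ?_), NatTrans.ext (funext fun x => ?_)⟩,
    fun x => ?_, fun x => ?_, fun x => ?_, fun x => ?_⟩
  · rw [NatTrans.comp_app, ha, hb]
    simp only [Preadditive.add_comp, Preadditive.comp_add, Category.assoc, reassoc_of% h₁₁,
      reassoc_of% h₁₂, reassoc_of% h₂₁, reassoc_of% h₂₂, zero_comp, comp_zero, add_zero, zero_add,
      Iso.hom_inv_id_app_assoc, ← Functor.map_comp, ← Functor.map_add, total]
    exact Sh.functor.map_id _
  · rw [NatTrans.comp_app, ha, hb]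
    simp only [Preadditive.add_comp, Preadditive.comp_add, Category.assoc,
      ← Functor.map_comp_assoc, h₁₁, h₁₂, h₂₁, h₂₂, CategoryTheory.Functor.map_id, Functor.map_zero,
      Category.id_comp, zero_comp, comp_zero, add_zero, zero_add, Iso.inv_hom_id_app_assoc, total]
    rfl
  · change _ ≫ a.app x = _
    rw [ha, Preadditive.comp_add, ← Functor.map_comp_assoc, ← Functor.map_comp_assoc, h₁₁, h₁₂,
      CategoryTheory.Functor.map_id, Category.id_comp, Functor.map_zero, zero_comp, add_zero]
  · change _ = a.app x ≫ _
    rw [ha, Preadditive.add_comp, Category.assoc, Category.assoc, Category.assoc, Category.assoc,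
      h₁₁, h₂₁, comp_zero, comp_zero, add_zero]
    exact congrArg _ (Category.comp_id (φ.hom.app x)).symm
  · change _ ≫ a.app x = _
    rw [ha, Preadditive.comp_add, ← Functor.map_comp_assoc, ← Functor.map_comp_assoc, h₂₁, h₂₂,
      CategoryTheory.Functor.map_id, Category.id_comp, Functor.map_zero, zero_comp, zero_add]
  · change _ = a.app x ≫ _
    rw [ha, Preadditive.add_comp, Category.assoc, Category.assoc, Category.assoc, Category.assoc,
      h₁₂, h₂₂, comp_zero, comp_zero, zero_add]
    exact congrArg _ (Category.comp_id (φ'.hom.app x)).symm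

end Splittings

namespace PeriodicPretriangle

section

variable {P : Type} [PartialOrder P] {T : P ≃o P}
variable {C : Type u} [Category.{v} C] [Preadditive C] [HasFiniteBiproducts C] {Sh : IsoCat C C}

/-- The periodic structure of a periodic pretriangle. -/
def iso (X : PeriodicPretriangle T Sh) : PeriodicStructure Sh X.pre.obj := eqToIso X.periodic

theorem iso_hom_app (X : PeriodicPretriangle T Sh) (x : Strip T) :
    X.iso.hom.app x = eqToHom (X.obj_shift x) := by
  rw [iso, eqToIso.hom, eqToHom_app]

theorem mem_periodicHom_iff {X Y : PeriodicPretriangle T Sh} (f : X.pre ⟶ Y.pre) :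
    f ∈ periodicHom X Y ↔ Equivariant X.iso Y.iso f.hom := by
  refine forall_congr' fun x => ?_
  rw [iso_hom_app, iso_hom_app, ← Category.assoc, comp_eqToHom_iff]

theorem equivariant {X Y : PeriodicPretriangle T Sh} (f : X ⟶ Y) :
    Equivariant X.iso Y.iso f.1.hom :=
  (mem_periodicHom_iff f.1).1 f.2

/-- The morphism of periodic pretriangles given by an equivariant morphism of diagrams. -/
def homMk {X Y : PeriodicPretriangle T Sh} (f : X.pre.obj ⟶ Y.pre.obj)
    (hf : Equivariant X.iso Y.iso f) : X ⟶ Y :=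
  ⟨ObjectProperty.homMk f, (mem_periodicHom_iff _).2 hf⟩

theorem hom_ext {X Y : PeriodicPretriangle T Sh} {f g : X ⟶ Y} (h : f.1.hom = g.1.hom) : f = g :=
  Subtype.ext (ObjectProperty.hom_ext _ h)

instance : (incl (T := T) (Sh := Sh)).PreservesZeroMorphisms where
  map_zero _ _ := rfl

instance (ξ : Strip T) : (ev (Sh := Sh) ξ).Additive where
  map_add := rfl

end

variable {n : ℕ} {C : Type u} [Category.{v} C] [Preadditive C] [HasFiniteBiproducts C]
  {Sh : IsoCat C C}

/-- A diagram with a periodic structure that has long exact sequences is isomorphic to a periodic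
pretriangle. -/
theorem exists_iso {W : Strip (periodShift n) ⥤ C} (hW : HasLongExactSequences W)
    (φ : PeriodicStructure Sh W) :
    ∃ (X : PeriodicPretriangle (periodShift n) Sh) (e : X.pre.obj ≅ W),
      Equivariant X.iso φ e.hom := by
  obtain ⟨X, hX, e, he⟩ := exists_strictification φ
  exact ⟨⟨⟨X, (hW.of_iso e).isPretriangle⟩, hX⟩, e, he⟩

theorem hasLongExactSequences (X : PeriodicPretriangle (periodShift n) Sh) :
    HasLongExactSequences X.pre.obj :=
  X.pre.hasLongExactSequences

theorem hasFiniteBiproducts : HasFiniteBiproducts (PeriodicPretriangle (periodShift n) Sh) := by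
  have := hasBinaryBiproducts_of_finite_biproducts C
  have := IsoCat_functor_additive Sh
  have := Pretriangle.hasFiniteBiproducts (T := periodShift n) (C := C)
  have := hasBinaryBiproducts_of_finite_biproducts (Pretriangle (periodShift n) C)
  refine hasFiniteBiproducts_of_binaryBicone ?_ fun X Y => ?_
  · obtain ⟨Z, hZ⟩ := (inferInstance : HasZeroObject (Pretriangle (periodShift n) C))
    have hZ' : ∀ x, IsZero (Z.obj.obj x) := fun x => (Pretriangle.ev x).map_isZero hZ
    obtain ⟨X, e, -⟩ := exists_iso Z.hasLongExactSequences (Sh := Sh)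
      (NatIso.ofComponents (fun x => (Sh.functor.map_isZero (hZ' x)).iso (hZ' _))
        fun f => (hZ' _).eq_of_tgt _ _)
    refine ⟨X, ?_⟩
    rw [IsZero.iff_id_eq_zero]
    refine hom_ext ?_
    ext x
    exact ((hZ' x).of_iso (e.app x)).eq_of_src _ _
  · let W : Pretriangle (periodShift n) C := X.pre ⊞ Y.pre
    obtain ⟨φ, h₁, h₂, h₃, h₄⟩ := exists_periodicStructure_biprod (H := W.obj)
      (i₁ := (biprod.inl : _ ⟶ W).hom) (p₁ := (biprod.fst : W ⟶ _).hom)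
      (i₂ := (biprod.inr : _ ⟶ W).hom) (p₂ := (biprod.snd : W ⟶ _).hom)
      (fun x => congrArg (fun t : X.pre ⟶ X.pre => t.hom.app x) biprod.inl_fst)
      (fun x => congrArg (fun t : X.pre ⟶ Y.pre => t.hom.app x) biprod.inl_snd)
      (fun x => congrArg (fun t : Y.pre ⟶ X.pre => t.hom.app x) biprod.inr_fst)
      (fun x => congrArg (fun t : Y.pre ⟶ Y.pre => t.hom.app x) biprod.inr_snd)
      (fun x => congrArg (fun t : W ⟶ W => t.hom.app x) biprod.total) X.iso Y.iso
    obtain ⟨Z, e, he⟩ := exists_iso W.hasLongExactSequences φ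
    have c : ∀ {F G : Strip (periodShift n) ⥤ C} (f : F ⟶ W.obj) (g : W.obj ⟶ G),
        (f ≫ e.inv) ≫ e.hom ≫ g = f ≫ g := fun f g => by simp
    refine ⟨{ pt := Z
              fst := homMk _ (he.comp h₂)
              snd := homMk _ (he.comp h₄)
              inl := homMk _ (h₁.comp he.inv)
              inr := homMk _ (h₃.comp he.inv)
              inl_fst := hom_ext ((c _ _).trans (congrArg (fun t => t.hom)
                (biprod.inl_fst : _ = (_ : X.pre ⟶ X.pre))))
              inl_snd := hom_ext ((c _ _).trans (congrArg (fun t => t.hom)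
                (biprod.inl_snd : _ = (_ : X.pre ⟶ Y.pre))))
              inr_fst := hom_ext ((c _ _).trans (congrArg (fun t => t.hom)
                (biprod.inr_fst : _ = (_ : Y.pre ⟶ X.pre))))
              inr_snd := hom_ext ((c _ _).trans (congrArg (fun t => t.hom)
                (biprod.inr_snd : _ = (_ : Y.pre ⟶ Y.pre)))) }, hom_ext ?_⟩
    change (e.hom ≫ _) ≫ _ ≫ e.inv + (e.hom ≫ _) ≫ _ ≫ e.inv = 𝟙 _
    have total := congrArg (fun t : W ⟶ W => t.hom) biprod.total
    change (biprod.fst : W ⟶ _).hom ≫ (biprod.inl : _ ⟶ W).hom +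
      (biprod.snd : W ⟶ _).hom ≫ (biprod.inr : _ ⟶ W).hom = 𝟙 _ at total
    rw [Category.assoc, Category.assoc, ← Preadditive.comp_add, ← Category.assoc, ← Category.assoc,
      ← Preadditive.add_comp, total, Category.id_comp, Iso.hom_inv_id]

theorem isPureMono_of_pointwise {X Y : PeriodicPretriangle (periodShift n) Sh} (f : X ⟶ Y)
    (hf : ∀ x, IsPureMono (splitSequences C) (f.1.hom.app x)) :
    IsPureMono (pure (periodShift n) Sh) f := by
  have := IsoCat_functor_additive Sh
  obtain ⟨H, g, h, σ⟩ := exists_pointwise_cokernel f.1.hom hf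
  obtain ⟨φ, hφ⟩ := exists_periodicStructure_cokernel (fun x => (σ x).some) (equivariant f)
  obtain ⟨Z, e, he⟩ := exists_iso (HasLongExactSequences.of_left (fun x => (σ x).some)
    X.hasLongExactSequences Y.hasLongExactSequences) φ
  refine ⟨Z, homMk (g ≫ e.inv) (hφ.comp he.inv), hom_ext ?_, fun x => ⟨(σ x).some.ofIso ?_⟩⟩
  · ext x
    change f.1.hom.app x ≫ g.app x ≫ e.inv.app x = 0
    rw [← Category.assoc, h, zero_comp]
  · exact ShortComplex.isoMk (Iso.refl _) (Iso.refl _) (e.app x).symm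
      ((Category.id_comp _).trans (Category.comp_id _).symm) (Category.id_comp _)

theorem isPureEpi_of_pointwise {X Y : PeriodicPretriangle (periodShift n) Sh} (g : X ⟶ Y)
    (hg : ∀ x, IsPureEpi (splitSequences C) (g.1.hom.app x)) :
    IsPureEpi (pure (periodShift n) Sh) g := by
  have := IsoCat_functor_additive Sh
  obtain ⟨H, f, h, σ⟩ := exists_pointwise_kernel g.1.hom hg
  obtain ⟨φ, hφ⟩ := exists_periodicStructure_kernel (fun x => (σ x).some) (equivariant g)
  obtain ⟨Z, e, he⟩ := exists_iso (HasLongExactSequences.of_right (fun x => (σ x).some)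
    X.hasLongExactSequences Y.hasLongExactSequences) φ
  refine ⟨Z, homMk (e.hom ≫ f) (he.comp hφ), hom_ext ?_, fun x => ⟨(σ x).some.ofIso ?_⟩⟩
  · ext x
    change (e.hom.app x ≫ f.app x) ≫ g.1.hom.app x = 0
    rw [Category.assoc, h, comp_zero]
  · exact ShortComplex.isoMk (e.app x).symm (Iso.refl _) (Iso.refl _)
      ((Iso.inv_hom_id_app_assoc _ _ _).trans (Category.comp_id _).symm)
      ((Category.id_comp _).trans (Category.comp_id _).symm)

variable (n Sh) in
theorem isExactCategory : IsExactCategory (pure (periodShift n) Sh) := by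
  have := hasBinaryBiproducts_of_finite_biproducts C
  refine isExactCategory_pointwiseSplit _ hasFiniteBiproducts (fun s hs => ?_) (fun s hs => ?_)
    (fun X Y f hf => isPureMono_of_pointwise f hf) (fun X Y f hf => isPureEpi_of_pointwise f hf)
  · have hs' : Pretriangle.pure _ C (s.map incl) := hs
    have hμ : ∀ x, Mono (s.f.1.hom.app x) := fun x => (Pretriangle.splitting hs' x).mono_f
    have : Mono s.f := ⟨fun a b h => hom_ext (NatTrans.ext (funext fun x => by
      rw [← cancel_mono (s.f.1.hom.app x)]
      exact congrArg (fun t => t.1.hom.app x) h))⟩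
    have key : ∀ {K} (t : K ⟶ s.X₂), t ≫ s.g = 0 → ∃ t', t' ≫ s.f = t := fun {K} t ht => by
      obtain ⟨t', h⟩ := Pretriangle.exists_lift hs' t.1 (congrArg Subtype.val ht)
      have h' : t'.hom ≫ s.f.1.hom = t.1.hom := congrArg (fun t => t.hom) h
      exact ⟨homMk t'.hom (Equivariant.of_comp_mono (h' ▸ equivariant t) (equivariant s.f) hμ),
        hom_ext h'⟩
    exact ⟨KernelFork.IsLimit.ofι' _ _ fun t ht => ⟨(key t ht).choose, (key t ht).choose_spec⟩⟩
  · have hs' : Pretriangle.pure _ C (s.map incl) := hs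
    have hε : ∀ x, Epi (s.g.1.hom.app x) := fun x => (Pretriangle.splitting hs' x).epi_g
    have : Epi s.g := ⟨fun a b h => hom_ext (NatTrans.ext (funext fun x => by
      rw [← cancel_epi (s.g.1.hom.app x)]
      exact congrArg (fun t => t.1.hom.app x) h))⟩
    have key : ∀ {K} (t : s.X₂ ⟶ K), s.f ≫ t = 0 → ∃ t', s.g ≫ t' = t := fun {K} t ht => by
      obtain ⟨t', h⟩ := Pretriangle.exists_desc hs' t.1 (congrArg Subtype.val ht)
      have h' : s.g.1.hom ≫ t'.hom = t.1.hom := congrArg (fun t => t.hom) h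
      exact ⟨homMk t'.hom (Equivariant.of_epi_comp (h' ▸ equivariant t) (equivariant s.g) hε),
        hom_ext h'⟩
    exact ⟨CokernelCofork.IsColimit.ofπ' _ _ fun t ht =>
      ⟨(key t ht).choose, (key t ht).choose_spec⟩⟩

end PeriodicPretriangle

/-! ### Periodic sums of rectangles -/

section PeriodicRectangleSum

variable {n : ℕ} {C : Type u} [Category.{v} C] [Preadditive C] [HasFiniteBiproducts C]
  {Sh : IsoCat C C}

theorem shift_mem_iff {x y : Strip (periodShift n)} :
    (x ≤ y ∧ y ≤ corner x) ↔ ((Strip.shift _).obj x ≤ (Strip.shift _).obj y ∧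
      (Strip.shift _).obj y ≤ corner ((Strip.shift _).obj x)) := by
  rw [le_corner_iff, le_corner_iff, Strip.le_def, Strip.le_def]
  change _ ↔ (x.top ≤ y.top ∧ x.bot + (n + 1) ≤ y.bot + (n + 1)) ∧
    (y.top < x.bot + (n + 1) ∧ y.bot + (n + 1) < x.top + (n + 1))
  omega

theorem shift_corner (x : Strip (periodShift n)) :
    (Strip.shift _).obj (corner x) = corner ((Strip.shift _).obj x) := by
  ext
  · change x.bot + (n : ℤ) = x.bot + (n + 1) - 1
    ring
  · change x.top - 1 + ((n : ℤ) + 1) = x.top + n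
    ring

namespace RectangleSum

variable {A B D : Strip (periodShift n) → C}

section Map

/-- The morphism between sums of rectangles that is given by morphisms between the summands. -/
noncomputable def map (k : ∀ x, A x ⟶ B x) : diagram A ⟶ diagram B where
  app y := desc fun x _ => k x ≫ inc B y x
  naturality y z f := hom_ext fun x hx => by
    rw [inc_map_assoc f hx, inc_desc_assoc _ hx, Category.assoc, inc_map f hx]
    by_cases hz : x ≤ z ∧ z ≤ corner x
    · rw [inc_desc _ hz]
    · rw [inc_of_not_mem hz, inc_of_not_mem hz, zero_comp, comp_zero]

theorem inc_map_app (k : ∀ x, A x ⟶ B x) (y x : Strip (periodShift n)) :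
    inc A y x ≫ (map k).app y = k x ≫ inc B y x := by
  by_cases hx : x ≤ y ∧ y ≤ corner x
  · exact inc_desc (fun x _ => k x ≫ inc B y x) hx
  · rw [inc_of_not_mem hx, inc_of_not_mem hx, zero_comp, comp_zero]

theorem map_app_prj (k : ∀ x, A x ⟶ B x) (y x : Strip (periodShift n)) :
    (map k).app y ≫ prj B y x = prj A y x ≫ k x :=
  hom_ext fun x' hx' => by
    rw [← Category.assoc, inc_map_app, Category.assoc, ← Category.assoc (inc A y x')]
    rcases eq_or_ne x' x with rfl | h
    · rw [inc_prj hx', inc_prj hx', Category.comp_id, Category.id_comp]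
    · rw [inc_prj_ne h, inc_prj_ne h, comp_zero, zero_comp]

theorem map_id (A : Strip (periodShift n) → C) : map (fun x => 𝟙 (A x)) = 𝟙 (diagram A) :=
  NatTrans.ext (funext fun _ => hom_ext (A := A) fun x _ => by
    rw [inc_map_app, Category.id_comp]
    exact (Category.comp_id _).symm)

theorem map_comp (k : ∀ x, A x ⟶ B x) (l : ∀ x, B x ⟶ D x) :
    map (fun x => k x ≫ l x) = map k ≫ map l :=
  NatTrans.ext (funext fun _ => hom_ext (A := A) fun x _ => by
    rw [inc_map_app, NatTrans.comp_app, ← Category.assoc (inc A _ x), inc_map_app, Category.assoc,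
      Category.assoc, inc_map_app])

theorem map_add (k l : ∀ x, A x ⟶ B x) : map (fun x => k x + l x) = map k + map l :=
  NatTrans.ext (funext fun _ => hom_ext (A := A) fun x _ => by
    rw [inc_map_app, NatTrans.app_add, Preadditive.comp_add, inc_map_app, inc_map_app,
      Preadditive.add_comp])

end Map

variable [Sh.functor.Additive] (ψ : ∀ x, Sh.functor.obj (A x) ≅ A ((Strip.shift _).obj x))
  (ω : ∀ x, Sh.functor.obj (B x) ≅ B ((Strip.shift _).obj x))

/-- The shift permutes the index sets of the summands. -/
noncomputable def shiftIndex (y : Strip (periodShift n)) :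
    { x : Strip (periodShift n) // x ≤ y ∧ y ≤ corner x } ≃
      { x : Strip (periodShift n) //
        x ≤ (Strip.shift _).obj y ∧ (Strip.shift _).obj y ≤ corner x } :=
  (shiftPerm n).subtypeEquiv fun _ => shift_mem_iff

/-- The automorphism of the category of entries permutes the summands of the entries of a sum of
rectangles. -/
noncomputable def shiftApp (y : Strip (periodShift n)) :
    Sh.functor.obj (obj A y) ≅ obj A ((Strip.shift _).obj y) :=
  Sh.functor.mapBiproduct _ ≪≫
    biproduct.whiskerEquiv (shiftIndex y) fun x => (ψ x.1).symm

theorem inc_shiftApp (y x : Strip (periodShift n)) :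
    Sh.functor.map (inc A y x) ≫ (shiftApp ψ y).hom = (ψ x).hom ≫ inc A _ _ := by
  by_cases h : x ≤ y ∧ y ≤ corner x
  · rw [inc_of_mem h, inc_of_mem (shift_mem_iff.1 h), shiftApp, Iso.trans_hom, ← Category.assoc]
    have h' : Sh.functor.map (biproduct.ι (fun x : { x // x ≤ y ∧ y ≤ corner x } => A x.1) ⟨x, h⟩) ≫
        (Sh.functor.mapBiproduct _).hom = biproduct.ι (Sh.functor.obj ∘
          fun x : { x // x ≤ y ∧ y ≤ corner x } => A x.1) ⟨x, h⟩ := by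
      rw [← Iso.eq_comp_inv, Functor.mapBiproduct_inv, biproduct.ι_desc]
    rw [h']
    exact biproduct.ι_desc _ _
  · rw [inc_of_not_mem h, inc_of_not_mem (mt shift_mem_iff.2 h), Functor.map_zero, zero_comp,
      comp_zero]

theorem inc_shiftApp_assoc (y x : Strip (periodShift n)) {Z : C}
    (u : obj A ((Strip.shift _).obj y) ⟶ Z) :
    Sh.functor.map (inc A y x) ≫ (shiftApp ψ y).hom ≫ u = (ψ x).hom ≫ inc A _ _ ≫ u := by
  rw [← Category.assoc, inc_shiftApp, Category.assoc]

theorem shift_hom_ext {y : Strip (periodShift n)} {Z : C} {u w : Sh.functor.obj (obj A y) ⟶ Z}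
    (h : ∀ x, x ≤ y ∧ y ≤ corner x →
      Sh.functor.map (inc A y x) ≫ u = Sh.functor.map (inc A y x) ≫ w) : u = w := by
  rw [← cancel_epi (Sh.functor.mapBiproduct _).inv]
  refine biproduct.hom_ext' _ _ fun x => ?_
  rw [Functor.mapBiproduct_inv, biproduct.ι_desc_assoc, biproduct.ι_desc_assoc, ← inc_of_mem x.2]
  exact h x.1 x.2

theorem shiftApp_prj (y x : Strip (periodShift n)) :
    (shiftApp ψ y).hom ≫ prj A _ ((Strip.shift _).obj x) =
      Sh.functor.map (prj A y x) ≫ (ψ x).hom :=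
  shift_hom_ext fun x' hx' => by
    rw [inc_shiftApp_assoc, ← Functor.map_comp_assoc]
    rcases eq_or_ne x' x with rfl | h
    · rw [inc_prj hx', inc_prj (shift_mem_iff.1 hx'), CategoryTheory.Functor.map_id,
        Category.id_comp, Category.comp_id]
    · have h' : (Strip.shift _).obj x' ≠ (Strip.shift _).obj x := (shiftPerm n).injective.ne h
      rw [inc_prj_ne h, inc_prj_ne h', Functor.map_zero, zero_comp, comp_zero]

/-- A periodic family of summands yields a periodic structure on the sum of rectangles. -/
noncomputable def periodicStructure : PeriodicStructure Sh (diagram A) :=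
  NatIso.ofComponents (shiftApp ψ) fun {y z} f => shift_hom_ext fun x hx => by
    rw [Functor.comp_map, Functor.comp_map, ← Functor.map_comp_assoc, inc_map f hx, inc_shiftApp,
      inc_shiftApp_assoc, inc_map _ (shift_mem_iff.1 hx)]

theorem periodicStructure_hom_app (y : Strip (periodShift n)) :
    (periodicStructure ψ).hom.app y = (shiftApp ψ y).hom := rfl

variable {ψ ω}

theorem equivariant_map {k : ∀ x, A x ⟶ B x}
    (hk : ∀ x, Sh.functor.map (k x) ≫ (ω x).hom = (ψ x).hom ≫ k _) :
    Equivariant (periodicStructure ψ) (periodicStructure ω) (map k) := fun y =>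
  shift_hom_ext fun x _ => by
    rw [periodicStructure_hom_app, periodicStructure_hom_app, ← Functor.map_comp_assoc, inc_map_app,
      inc_shiftApp_assoc, inc_map_app, Functor.map_comp, Category.assoc, inc_shiftApp,
      ← Category.assoc, hk, Category.assoc]

variable {Y : Strip (periodShift n) ⥤ C} {φ : PeriodicStructure Sh Y}

theorem equivariant_fromDiagram (hY : VanishesOnBoundary Y) {k : ∀ x, A x ⟶ Y.obj x}
    (hk : ∀ x, Sh.functor.map (k x) ≫ φ.hom.app x = (ψ x).hom ≫ k _) :
    Equivariant (periodicStructure ψ) φ (fromDiagram hY k) := fun y =>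
  shift_hom_ext fun x hx => by
    have := φ.hom.naturality (homOfLE hx.1)
    rw [Functor.comp_map, Functor.comp_map] at this
    rw [periodicStructure_hom_app, ← Functor.map_comp_assoc, inc_fromDiagram hY k hx,
      inc_shiftApp_assoc, inc_fromDiagram hY k (shift_mem_iff.1 hx), Functor.map_comp,
      Category.assoc, this, reassoc_of% hk]
    rfl

/-- The periodic family obtained from a diagram with a periodic structure by evaluating it at `c x`,
where `c` commutes with the shift. -/
noncomputable abbrev reindex (φ : PeriodicStructure Sh Y)
    {c : Strip (periodShift n) → Strip (periodShift n)}
    (hc : ∀ x, (Strip.shift _).obj (c x) = c ((Strip.shift _).obj x)) (x : Strip (periodShift n)) :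
    Sh.functor.obj (Y.obj (c x)) ≅ Y.obj (c ((Strip.shift _).obj x)) :=
  φ.app (c x) ≪≫ Y.mapIso (eqToIso (hc x))

theorem equivariant_toDiagram (hY : VanishesOnBoundary Y) {k : ∀ x, Y.obj (corner x) ⟶ A x}
    (hk : ∀ x, Sh.functor.map (k x) ≫ (ψ x).hom = (reindex φ shift_corner x).hom ≫ k _) :
    Equivariant φ (periodicStructure ψ) (toDiagram hY k) := fun y =>
  hom_ext' fun z hz => by
    obtain ⟨x, rfl⟩ : ∃ x, (Strip.shift _).obj x = z := (shiftPerm n).surjective z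
    have hx := shift_mem_iff.2 hz
    have := φ.hom.naturality (homOfLE hx.2)
    rw [Functor.comp_map, Functor.comp_map] at this
    rw [periodicStructure_hom_app, Category.assoc, Category.assoc, shiftApp_prj,
      ← Functor.map_comp_assoc, toDiagram_prj hY k hx, toDiagram_prj hY k hz, Functor.map_comp,
      Category.assoc, hk, Iso.trans_hom, Category.assoc]
    change _ ≫ φ.hom.app _ ≫ _ = _
    rw [reassoc_of% this]
    change _ ≫ Y.map _ ≫ Y.map _ ≫ _ = _
    rw [← Y.map_comp_assoc]
    rfl

end RectangleSum

end PeriodicRectangleSum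

/-! ### Bijective periodic pretriangles -/

namespace RectangleSum

variable {n : ℕ} {C : Type u} [Category.{v} C] {X Y : Strip (periodShift n) ⥤ C}

section Naturality

variable [Preadditive C] [HasFiniteBiproducts C]

theorem map_comp_counit (hX : VanishesOnBoundary X) (hY : VanishesOnBoundary Y) (f : X ⟶ Y) :
    map (fun x => f.app x) ≫ counit hY = counit hX ≫ f :=
  fromDiagram_ext fun x hx => by
    rw [NatTrans.comp_app, NatTrans.comp_app, ← Category.assoc, ← Category.assoc, inc_map_app,
      Category.assoc, inc_fromDiagram_self hY _ hx, inc_fromDiagram_self hX _ hx, Category.comp_id,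
      Category.id_comp]

theorem unit_comp_map (hX : VanishesOnBoundary X) (hY : VanishesOnBoundary Y) (f : X ⟶ Y) :
    f ≫ unit hY = unit hX ≫ map fun x => f.app (corner x) :=
  toDiagram_ext fun x hx => by
    rw [NatTrans.comp_app, NatTrans.comp_app, Category.assoc, Category.assoc, map_app_prj,
      ← Category.assoc (toDiagram _ _ |>.app _), toDiagram_prj_corner hY _ hx,
      toDiagram_prj_corner hX _ hx, Category.comp_id, Category.id_comp]

end Naturality

variable {Sh : IsoCat C C} {φ : PeriodicStructure Sh X} {φ' : PeriodicStructure Sh Y}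

theorem reindex_id_hom (φ : PeriodicStructure Sh X) (x : Strip (periodShift n)) :
    (reindex φ (c := fun x => x) (fun _ => rfl) x).hom = φ.hom.app x := by
  simp [reindex]

theorem reindex_naturality {f : X ⟶ Y} (hf : Equivariant φ φ' f)
    {c : Strip (periodShift n) → Strip (periodShift n)}
    (hc : ∀ x, (Strip.shift _).obj (c x) = c ((Strip.shift _).obj x)) (x : Strip (periodShift n)) :
    Sh.functor.map (f.app (c x)) ≫ (reindex φ' hc x).hom = (reindex φ hc x).hom ≫ f.app _ := by
  change _ ≫ φ'.hom.app (c x) ≫ Y.map _ = (φ.hom.app (c x) ≫ X.map _) ≫ _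
  rw [← Category.assoc, hf, Category.assoc, Category.assoc, f.naturality]

theorem map_reindex_corner (φ : PeriodicStructure Sh X) {x : Strip (periodShift n)}
    (hx : x ≤ corner x) (hx' : (Strip.shift _).obj x ≤ corner ((Strip.shift _).obj x)) :
    Sh.functor.map (X.map (homOfLE hx)) ≫ (reindex φ shift_corner x).hom =
      φ.hom.app x ≫ X.map (homOfLE hx') := by
  have := φ.hom.naturality (homOfLE hx)
  rw [Functor.comp_map, Functor.comp_map] at this
  change _ ≫ φ.hom.app (corner x) ≫ X.map _ = _
  rw [reassoc_of% this, ← X.map_comp]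
  rfl

end RectangleSum

namespace PeriodicPretriangle

open RectangleSum

variable {n : ℕ} {C : Type u} [Category.{v} C] [Preadditive C] [HasFiniteBiproducts C]
  {Sh : IsoCat C C}

instance : Sh.functor.Additive := IsoCat_functor_additive Sh

theorem vanishesOnBoundary (X : PeriodicPretriangle (periodShift n) Sh) :
    VanishesOnBoundary X.pre.obj :=
  X.pre.vanishesOnBoundary

/-- The summands of a periodic sum of rectangles can be mapped independently, up to periodicity. Thus
the pointwise splittings allow for periodic lifts and extensions. -/
theorem isBijective_of_iso {A : Strip (periodShift n) → C}
    {ψ : ∀ x, Sh.functor.obj (A x) ≅ A ((Strip.shift _).obj x)}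
    {P : PeriodicPretriangle (periodShift n) Sh} {e : P.pre.obj ≅ diagram A}
    (he : Equivariant P.iso (periodicStructure ψ) e.hom) :
    IsBijective (pure (periodShift n) Sh) P := by
  refine ⟨fun Y Z g hg f => ?_, fun Z Y g hg f => ?_⟩
  · have hF : Equivariant (periodicStructure ψ) Z.iso (e.inv ≫ f.1.hom) :=
      he.inv.comp (equivariant f)
    obtain ⟨k, hk, hk'⟩ := exists_periodicFamily ψ (fun x => Y.iso.app x)
      (fun x k => k ≫ g.1.hom.app x = inc A x x ≫ (e.inv ≫ f.1.hom).app x)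
      (fun x k k' h => by
        have h₁ : Sh.functor.map (k ≫ g.1.hom.app x) ≫ Z.iso.hom.app x =
            (ψ x).hom ≫ k' ≫ g.1.hom.app _ := by
          rw [Functor.map_comp, Category.assoc, equivariant g x, ← Category.assoc,
            ← Category.assoc, ← h]
          rfl
        have h₂ : Sh.functor.map (inc A x x ≫ (e.inv ≫ f.1.hom).app x) ≫ Z.iso.hom.app x =
            (ψ x).hom ≫ inc A _ _ ≫ (e.inv ≫ f.1.hom).app _ := by
          rw [Functor.map_comp, Category.assoc, hF x, periodicStructure_hom_app,
            inc_shiftApp_assoc]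
        rw [← Sh.functor.map_injective.eq_iff, ← cancel_mono (Z.iso.hom.app x), h₁, h₂,
          cancel_epi])
      (fun x => by
        obtain ⟨K, κ, hκ, ⟨σ⟩⟩ := hg.map _ x
        have : σ.s ≫ g.1.hom.app x = 𝟙 _ := σ.s_g
        refine ⟨(inc A x x ≫ (e.inv ≫ f.1.hom).app x) ≫ σ.s, ?_⟩
        exact (Category.assoc _ _ _).trans ((congrArg _ this).trans (Category.comp_id _)))
    refine ⟨homMk (e.hom ≫ fromDiagram Y.vanishesOnBoundary k)
      (he.comp (equivariant_fromDiagram _ hk')), hom_ext ?_⟩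
    change (e.hom ≫ fromDiagram Y.vanishesOnBoundary k) ≫ g.1.hom = f.1.hom
    rw [Category.assoc, fromDiagram_comp Y.vanishesOnBoundary g.1.hom (e.inv ≫ f.1.hom) k hk,
      Iso.hom_inv_id_assoc]
  · have hF : Equivariant Z.iso (periodicStructure ψ) (f.1.hom ≫ e.hom) :=
      (equivariant f).comp he
    obtain ⟨k, hk, hk'⟩ := exists_periodicFamily (fun x => reindex Y.iso shift_corner x) ψ
      (fun x k => g.1.hom.app (corner x) ≫ k =
        (f.1.hom ≫ e.hom).app (corner x) ≫ prj A (corner x) x)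
      (fun x k k' h => by
        have h₁ : Sh.functor.map (g.1.hom.app (corner x) ≫ k) ≫ (ψ x).hom =
            (reindex Z.iso shift_corner x).hom ≫ g.1.hom.app _ ≫ k' := by
          rw [Functor.map_comp, Category.assoc, h, ← Category.assoc,
            reindex_naturality (equivariant g), Category.assoc]
        have h₂ : Sh.functor.map ((f.1.hom ≫ e.hom).app (corner x) ≫ prj A (corner x) x) ≫
            (ψ x).hom = (reindex Z.iso shift_corner x).hom ≫ (f.1.hom ≫ e.hom).app _ ≫
              prj A _ _ := by
          rw [Functor.map_comp, Category.assoc, ← shiftApp_prj, ← periodicStructure_hom_app,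
            ← Category.assoc, hF]
          have key : ∀ {y z : Strip (periodShift n)} (h : y = z) (x),
              (f.1.hom ≫ e.hom).app y ≫ prj A y x =
                Z.pre.obj.map (eqToHom h) ≫ (f.1.hom ≫ e.hom).app z ≫ prj A z x := by
            rintro y _ rfl x
            rw [eqToHom_refl, CategoryTheory.Functor.map_id, Category.id_comp]
          rw [Category.assoc, key (shift_corner x)]
          exact (Category.assoc _ _ _).symm
        rw [← Sh.functor.map_injective.eq_iff, ← cancel_mono (ψ x).hom, h₁, h₂, cancel_epi])
      (fun x => by
        obtain ⟨K, κ, hκ, ⟨σ⟩⟩ := hg.map _ (corner x)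
        have : g.1.hom.app (corner x) ≫ σ.r = 𝟙 _ := σ.f_r
        refine ⟨σ.r ≫ (f.1.hom ≫ e.hom).app (corner x) ≫ prj A (corner x) x, ?_⟩
        exact (Category.assoc _ _ _).symm.trans ((congrArg (· ≫ _) this).trans
          (Category.id_comp _)))
    refine ⟨homMk (toDiagram Y.vanishesOnBoundary k ≫ e.inv)
      ((equivariant_toDiagram _ hk').comp he.inv), hom_ext ?_⟩
    change g.1.hom ≫ toDiagram Y.vanishesOnBoundary k ≫ e.inv = f.1.hom
    rw [← Category.assoc, comp_toDiagram Y.vanishesOnBoundary g.1.hom (f.1.hom ≫ e.hom) k hk,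
      Category.assoc, Iso.hom_inv_id, Category.comp_id]

section Rectangles

variable {c : Strip (periodShift n) → Strip (periodShift n)}
  (hc : ∀ x, (Strip.shift _).obj (c x) = c ((Strip.shift _).obj x))

theorem exists_rectangles (X : PeriodicPretriangle (periodShift n) Sh) :
    ∃ (R : PeriodicPretriangle (periodShift n) Sh)
      (e : R.pre.obj ≅ diagram fun x => X.pre.obj.obj (c x)),
      Equivariant R.iso (periodicStructure (reindex X.iso hc)) e.hom :=
  exists_iso (RectangleSum.hasLongExactSequences _) _

/-- A strictly periodic version of the sum of rectangles with values `X_(c x)`. -/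
noncomputable def rectanglesObj (X : PeriodicPretriangle (periodShift n) Sh) :
    PeriodicPretriangle (periodShift n) Sh :=
  (exists_rectangles hc X).choose

/-- The comparison of the strictly periodic sum of rectangles with the actual one. -/
noncomputable def rectanglesIso (X : PeriodicPretriangle (periodShift n) Sh) :
    (rectanglesObj hc X).pre.obj ≅ diagram fun x => X.pre.obj.obj (c x) :=
  (exists_rectangles hc X).choose_spec.choose

theorem equivariant_rectanglesIso (X : PeriodicPretriangle (periodShift n) Sh) :
    Equivariant (rectanglesObj hc X).iso (periodicStructure (reindex X.iso hc))
      (rectanglesIso hc X).hom :=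
  (exists_rectangles hc X).choose_spec.choose_spec

variable (Sh) in
/-- The functor that maps `X` to the sum of rectangles with values `X_(c x)`. -/
noncomputable def rectangles :
    PeriodicPretriangle (periodShift n) Sh ⥤ PeriodicPretriangle (periodShift n) Sh where
  obj := rectanglesObj hc
  map {X Y} f := homMk ((rectanglesIso hc X).hom ≫ RectangleSum.map (fun x => f.1.hom.app (c x)) ≫
    (rectanglesIso hc Y).inv) ((equivariant_rectanglesIso hc X).comp
      ((equivariant_map (reindex_naturality (equivariant f) hc)).comp
        (equivariant_rectanglesIso hc Y).inv))
  map_id X := hom_ext <| by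
    change _ ≫ RectangleSum.map (fun x => 𝟙 (X.pre.obj.obj (c x))) ≫ _ = 𝟙 _
    rw [RectangleSum.map_id, Category.id_comp, Iso.hom_inv_id]
  map_comp {X Y Z} f g := hom_ext <| by
    change _ ≫ RectangleSum.map (fun x => f.1.hom.app (c x) ≫ g.1.hom.app (c x)) ≫ _ =
      (_ ≫ _ ≫ _) ≫ _ ≫ _ ≫ _
    rw [RectangleSum.map_comp]
    simp

instance : (rectangles Sh hc).Additive where
  map_add {X Y f g} := hom_ext <| by
    change _ ≫ RectangleSum.map (fun x => f.1.hom.app (c x) + g.1.hom.app (c x)) ≫ _ =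
      _ ≫ _ ≫ _ + _ ≫ _ ≫ _
    rw [RectangleSum.map_add, Preadditive.add_comp, Preadditive.comp_add]
    rfl

theorem isBijective_rectangles (X : PeriodicPretriangle (periodShift n) Sh) :
    IsBijective (pure (periodShift n) Sh) ((rectangles Sh hc).obj X) :=
  isBijective_of_iso (equivariant_rectanglesIso hc X)

end Rectangles

variable (n Sh)

/-- The functorial cover by the sum of rectangles with values `X_x`. -/
noncomputable abbrev cover :
    PeriodicPretriangle (periodShift n) Sh ⥤ PeriodicPretriangle (periodShift n) Sh :=
  rectangles Sh (c := fun x => x) fun _ => rfl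

/-- The functorial embedding into the sum of rectangles with values `X_(corner x)`. -/
noncomputable abbrev hull :
    PeriodicPretriangle (periodShift n) Sh ⥤ PeriodicPretriangle (periodShift n) Sh :=
  rectangles Sh shift_corner

variable {n Sh}

theorem equivariant_counit (X : PeriodicPretriangle (periodShift n) Sh) :
    Equivariant (periodicStructure (reindex X.iso (c := fun x => x) fun _ => rfl)) X.iso
      (counit X.vanishesOnBoundary) :=
  equivariant_fromDiagram _ fun x => by
    rw [reindex_id_hom, CategoryTheory.Functor.map_id, Category.id_comp]
    exact (Category.comp_id _).symm

theorem equivariant_unit (X : PeriodicPretriangle (periodShift n) Sh) :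
    Equivariant X.iso (periodicStructure (reindex X.iso shift_corner))
      (unit X.vanishesOnBoundary) :=
  equivariant_toDiagram _ fun x => by
    rw [CategoryTheory.Functor.map_id, Category.id_comp, Category.comp_id]

variable (n Sh)

/-- The natural transformation that covers each periodic pretriangle, induced by `counit`. -/
noncomputable def coverπ : cover n Sh ⟶ 𝟭 (PeriodicPretriangle (periodShift n) Sh) where
  app X := homMk ((rectanglesIso _ X).hom ≫ counit X.vanishesOnBoundary)
    ((equivariant_rectanglesIso _ X).comp (equivariant_counit X))
  naturality X Y f := hom_ext <| by
    have key : ∀ {R R' D D' X Y : Strip (periodShift n) ⥤ C} (e : R ≅ D) (e' : R' ≅ D')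
        {m : D ⟶ D'} {p : D ⟶ X} {p' : D' ⟶ Y} {f : X ⟶ Y}, m ≫ p' = p ≫ f →
        (e.hom ≫ m ≫ e'.inv) ≫ e'.hom ≫ p' = (e.hom ≫ p) ≫ f := fun e e' _ _ _ _ h => by simp [h]
    exact key _ _ (map_comp_counit X.vanishesOnBoundary Y.vanishesOnBoundary f.1.hom)

/-- The natural transformation that embeds each periodic pretriangle, induced by `unit`. -/
noncomputable def hullι : 𝟭 (PeriodicPretriangle (periodShift n) Sh) ⟶ hull n Sh where
  app X := homMk (unit X.vanishesOnBoundary ≫ (rectanglesIso _ X).inv)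
    ((equivariant_unit X).comp (equivariant_rectanglesIso _ X).inv)
  naturality X Y f := hom_ext <| by
    have key : ∀ {R R' D D' X Y : Strip (periodShift n) ⥤ C} (e : R ≅ D) (e' : R' ≅ D')
        {m : D ⟶ D'} {i : X ⟶ D} {i' : Y ⟶ D'} {f : X ⟶ Y}, f ≫ i' = i ≫ m →
        f ≫ i' ≫ e'.inv = (i ≫ e.inv) ≫ e.hom ≫ m ≫ e'.inv :=
      fun e e' _ _ _ _ h => by simp [reassoc_of% h]
    exact key _ _ (unit_comp_map X.vanishesOnBoundary Y.vanishesOnBoundary f.1.hom)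

theorem isPureEpi_coverπ_app (X : PeriodicPretriangle (periodShift n) Sh) :
    IsPureEpi (pure (periodShift n) Sh) ((coverπ n Sh).app X) := by
  have := hasBinaryBiproducts_of_finite_biproducts C
  obtain ⟨Z, hZ⟩ := (inferInstance : HasZeroObject C)
  refine isPureEpi_of_pointwise _ fun x => isPureEpi_of_op ?_
  change IsPureMono _ ((rectanglesIso _ X).hom.app x ≫ (counit X.vanishesOnBoundary).app x).op
  rw [op_comp]
  exact isPureMono_split_comp (isPureMono_op (isPureEpi_counit_app _ x))
    (isPureMono_split_of_isIso _ hZ.op)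

theorem isPureMono_hullι_app (X : PeriodicPretriangle (periodShift n) Sh) :
    IsPureMono (pure (periodShift n) Sh) ((hullι n Sh).app X) := by
  have := hasBinaryBiproducts_of_finite_biproducts C
  obtain ⟨Z, hZ⟩ := (inferInstance : HasZeroObject C)
  refine isPureMono_of_pointwise _ fun x => ?_
  have := isPureMono_split_comp (isPureMono_unit_app X.vanishesOnBoundary x)
    (isPureMono_split_of_isIso ((rectanglesIso shift_corner X).inv.app x) hZ)
  exact this

theorem isAdditivelyFunctorialFrobeniusCategory :
    IsAdditivelyFunctorialFrobeniusCategory (pure (periodShift n) Sh) where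
  isFrobeniusCategory :=
    ⟨isExactCategory n Sh, fun X =>
      ⟨⟨_, _, isBijective_rectangles _ X, isPureEpi_coverπ_app n Sh X⟩,
        ⟨_, _, isBijective_rectangles _ X, isPureMono_hullι_app n Sh X⟩⟩⟩
  functorial_embedding := ⟨hull n Sh, hullι n Sh, inferInstance, fun X =>
    ⟨isPureMono_hullι_app n Sh X, isBijective_rectangles _ X⟩⟩
  functorial_cover := ⟨cover n Sh, coverπ n Sh, inferInstance, fun X =>
    ⟨isPureEpi_coverπ_app n Sh X, isBijective_rectangles _ X⟩⟩

/-- In a split periodic pretriangle, the quasi-inverses can be chosen to be periodic, so that it is a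
direct summand of a periodic sum of rectangles. -/
theorem isBijective_eq :
    IsBijective (pure (periodShift n) Sh) = IsSplitPeriodicPretriangle (periodShift n) Sh := by
  ext X
  constructor
  · intro hX
    obtain ⟨r, hr⟩ := hX.2 _ (isPureMono_hullι_app n Sh X) (𝟙 X)
    refine isSplitPretriangle_of_retract (unit X.vanishesOnBoundary)
      ((rectanglesIso _ X).inv ≫ r.1.hom) ?_
    exact (Category.assoc _ _ _).symm.trans (congrArg (fun t => t.1.hom) hr)
  · intro hX
    obtain ⟨h, hh, hper⟩ := exists_periodicFamily (fun x => reindex X.iso shift_corner x)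
      (fun x => reindex X.iso (c := fun x => x) (fun _ => rfl) x)
      (fun x h => ∀ hx : x ≤ corner x, X.pre.obj.map (homOfLE hx) ≫ h ≫
        X.pre.obj.map (homOfLE hx) = X.pre.obj.map (homOfLE hx))
      (fun x k k' h => by
        have hx₀ := shift_mem_iff (x := x) (y := x)
        simp only [le_refl, true_and] at hx₀
        have key : ∀ hx hx', X.pre.obj.map (homOfLE hx) ≫ k ≫ X.pre.obj.map (homOfLE hx) =
            X.pre.obj.map (homOfLE hx) ↔ X.pre.obj.map (homOfLE hx') ≫ k' ≫
              X.pre.obj.map (homOfLE hx') = X.pre.obj.map (homOfLE hx') := fun hx hx' => by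
          have e := map_reindex_corner X.iso hx hx'
          rw [reindex_id_hom] at h
          rw [← Sh.functor.map_injective.eq_iff, ← cancel_mono (reindex X.iso shift_corner x).hom,
            ← cancel_epi (X.iso.hom.app x), e, Functor.map_comp, Functor.map_comp, Category.assoc,
            Category.assoc, e, reassoc_of% h, reassoc_of% e]
        exact ⟨fun H hx' => (key (hx₀.2 hx') hx').1 (H _),
          fun H hx => (key hx (hx₀.1 hx)).2 (H _)⟩)
      (fun x => by
        by_cases hx : x ≤ corner x
        · obtain ⟨h, hh⟩ := (isSplitInFreyd_iff _).1 (hX (homOfLE hx))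
          exact ⟨h, fun _ => hh⟩
        · exact ⟨0, fun hx' => (hx hx').elim⟩)
    have := X.hasLongExactSequences.isIso_toDiagram_comp_counit h hh
    have hc := (equivariant_toDiagram X.vanishesOnBoundary hper).comp (equivariant_counit X)
    have hc' := Equivariant.inv
      (e := asIso (toDiagram X.vanishesOnBoundary h ≫ counit X.vanishesOnBoundary)) hc
    refine (isBijective_rectangles (c := fun x => x) (fun _ => rfl) X).of_retract
      (homMk (toDiagram X.vanishesOnBoundary h ≫ (rectanglesIso _ X).inv)
        ((equivariant_toDiagram _ hper).comp (equivariant_rectanglesIso _ X).inv))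
      (homMk ((rectanglesIso _ X).hom ≫ counit X.vanishesOnBoundary ≫ inv _)
        ((equivariant_rectanglesIso _ X).comp ((equivariant_counit X).comp hc'))) (hom_ext ?_)
    have key : ∀ {R D Y : Strip (periodShift n) ⥤ C} (e : R ≅ D) (i : Y ⟶ D) (p : D ⟶ Y)
        [IsIso (i ≫ p)], (i ≫ e.inv) ≫ e.hom ≫ p ≫ inv (i ≫ p) = 𝟙 Y := fun e i p _ => by
      rw [Category.assoc, Iso.inv_hom_id_assoc, ← Category.assoc, IsIso.hom_inv_id]
    exact key _ _ _

end PeriodicPretriangle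

theorem mainTheorem6 {C : Type u} [Category.{v} C] [Preadditive C] [HasFiniteBiproducts C]
    (hC : WeaklyAbelian C) (n : ℕ) :
    (IsFrobeniusCategory (Pretriangle.pure (periodShift n) C) ∧
      IsBijective (Pretriangle.pure (periodShift n) C) = IsSplitPretriangle (periodShift n) C ∧
      (∀ B : ObjectProperty (Pretriangle (periodShift n) C),
        IsAdditiveSubcategory B →
        B ≤ IsBijective (Pretriangle.pure (periodShift n) C) →
        IsSufficientlyBig (Pretriangle.pure (periodShift n) C) B →
        Nonempty (StableCategory (Pretriangle.pure (periodShift n) C) B ≌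
            AdditiveQuotient (IsSplitPretriangle (periodShift n) C)) ∧
          QuotientWeaklyAbelian (IsSplitAcyclic (Pretriangle.pure (periodShift n) C) B)) ∧
      QuotientWeaklyAbelian (IsSplitPretriangle (periodShift n) C)) ∧
    ∀ Sh : IsoCat C C,
      IsAdditivelyFunctorialFrobeniusCategory (PeriodicPretriangle.pure (periodShift n) Sh) ∧
      IsBijective (PeriodicPretriangle.pure (periodShift n) Sh) =
        IsSplitPeriodicPretriangle (periodShift n) Sh := by
  refine ⟨⟨Pretriangle.isFrobeniusCategory n C, Pretriangle.isBijective_eq n C,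
    fun B hB hBb hBbig => ⟨?_, ?_⟩, ?_⟩, fun Sh => ?_⟩
  · rw [← Pretriangle.isBijective_eq]
    exact (Pretriangle.isFrobeniusCategory n C).exists_stableEquivalence hB hBb hBbig
  · exact (Pretriangle.isFrobeniusCategory n C).quotientWeaklyAbelian_isSplitAcyclic hB hBb hBbig
  · rw [← Pretriangle.isBijective_eq]
    exact (Pretriangle.isFrobeniusCategory n C).quotientWeaklyAbelian
  · exact ⟨PeriodicPretriangle.isAdditivelyFunctorialFrobeniusCategory n Sh,
      PeriodicPretriangle.isBijective_eq n Sh⟩
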